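/- **Setting.** Fix $N\in\mathbb N$; $|\cdot|$ is the Euclidean norm and $B_j\subset\mathbb R^N$ the closed ball of radius $j$ centred at $0$. $L^1_{loc}$ is the set of functions $\mathbb R\to\mathbb R$ that are integrable on every compact interval. Let $V$ be $\mathbb R^N$ or $\mathbb R^{N\times N}$. For $f:\mathbb R\times\mathbb R^N\to V$ write $f_t(s,x)=f(s+t,x)$. An *$m$-bound* of $f$ on $K\subset\mathbb R^N$ is a function $m\in L^1_{loc}$ such that for a.e. $t$, $|f(t,x)|\le m(t)$ for all $x\in K$. The function $f$ is *Carathéodory* if it is Borel measurable and has an $m$-bound on every compact set. It is in $\mathfrak{LC}(V)$ if moreover for every compact $K$ there is $l^K\in L^1_{loc}$ such that for a.e. $t$, $|f(t,x)-f(t,y)|\le l^K(t)|x-y|$ for all $x,y\in K$; $\mathfrak{LC}=\mathfrak{LC}(\mathbb R^N)$. A set $S\subset L^1_{loc}$ of ($m$-bound) functions is $L^1_{loc}$-equicontinuous if for all $r,\varepsilon>0$ there is $\delta>0$ with $\sup_{m\in S}\int_s^t m<\varepsilon$ whenever $-r\le s\le t\le r$, $t-s<\delta$. A Carathéodory function $f$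 *has $L^1_{loc}$-equicontinuous $m$-bounds* if for every $j\in\mathbb N$ there is an $L^1_{loc}$-equicontinuous set $S^j$ of $m$-bounds on $B_j$ of the functions $f_t$, $t\in\mathbb R$, containing an $m$-bound of each $f_t$. A *suitable set of moduli* is a family $\Theta=(\theta_j)_{j\in\mathbb N}$ of continuous nondecreasing functions $[0,\infty)\to[0,\infty)$ with $\theta_j(0)=0$ and $\theta_i\le\theta_j$ for $i\le j$. For $I=[q_1,q_2]$ with $q_1\le q_2$ rational let $\mathcal K_j^I$ be the set of continuous $x:I\to B_j$ with $|x(s)-x(t)|\le\theta_j(|s-t|)$ for $s,t\in I$. A Carathéodory function $f$ is in $\mathfrak{W\Theta C}(V)$ if, for all such $j$ and $I$, $\int_I f(t,x_n(t))\,dt\to\int_I f(t,x(t))\,dt$ whenever $x_n,x\in\mathcal K^I_j$ and $x_n\to x$ uniformly on $I$; $\mathfrak{W\Theta C}=\mathfrak{W\Theta C}(\mathbb R^N)$. In each of the sets $\mathfrak{LC}$ and $\mathfrak{W\Theta C}(V)$, functions that differ only on a Lebesgue null set of $\mathbb R\times\mathbb R^N$ are identified, and the resulting space carries the topology $\sigma_\Theta$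 generated by the seminorms $p_{I,j}(f)=\sup_{x\in\mathcal K_j^I}\big|\int_I f(t,x(t))\,dt\big|$. The *hull* of $f$ is the closure of $\{f_t: t\in\mathbb R\}$ in the space in question; the hull of a triple $(f,F,h)$ is the closure of $\{(f_t,F_t,h_t):t\in\mathbb R\}$ in the product space; hulls carry the induced topologies. A *continuous local skew-product flow* on $B\times Y$ over a continuous flow $\varphi$ on $B$ is a continuous map $\Pi:U\to B\times Y$ where $U\subset\mathbb R\times B\times Y$ is open, contains $\{0\}\times B\times Y$ and has intervals $U_z=\{t:(t,z)\in U\}$ as sections; $\Pi(0,z)=z$; if $(s,z)\in U$, then $(t,\Pi(s,z))\in U\iff(t+s,z)\in U$, and in that case $\Pi(t+s,z)=\Pi(t,\Pi(s,z))$; and the $B$-component of $\Pi(t,b,y)$ is $\varphi(t,b)$. **Theorem.** Let $f\in\mathfrak{LC}$ have $L^1_{loc}$-equicontinuous $m$-bounds, let $m^j(t)=\sup_{x\in B_j}|f(t,x)|$, and let $\Theta=(\theta_j)_j$ be the suitable set of moduli $\theta_j(s)=\sup_{t\in\mathbb R}\int_t^{t+s}m^j(u)\,du$. Let $F\in\mathfrak{W\Theta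 C}(\mathbb R^{N\times N})$ and $h\in\mathfrak{W\Theta C}$ have $L^1_{loc}$-equicontinuous $m$-bounds. For $g\in\mathfrak{LC}$ and $x_0\in\mathbb R^N$, the Cauchy problem $\dot x=g(t,x)$, $x(0)=x_0$ has a unique maximal solution $x(\cdot,g,x_0)$ in the Carathéodory (integral) sense, defined on an open interval $I_{g,x_0}\ni 0$ and not depending on the representative of $g$, and the following hold. (i) Let $H_1=\mathrm{Hull}_{(\mathfrak{LC},\sigma_\Theta)}(f)$. Then $(t,g)\mapsto g_t$ is a continuous flow on $H_1$, the set $\mathcal U_1=\{(t,g,x_0): g\in H_1,\ x_0\in\mathbb R^N,\ t\in I_{g,x_0}\}$ is open in $\mathbb R\times H_1\times\mathbb R^N$, and $$\Pi:\mathcal U_1\to H_1\times\mathbb R^N,\qquad (t,g,x_0)\mapsto\big(g_t,\,x(t,g,x_0)\big)$$ is a continuous local skew-product flow on $H_1\times\mathbb R^N$ over it. (ii) Let $H$ be the hull of $(f,F,h)$ in $(\mathfrak{LC},\sigma_\Theta)\times(\mathfrak{W\Theta C}(\mathbb R^{N\times N}),\sigma_\Theta)\times(\mathfrak{W\Theta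 C},\sigma_\Theta)$. For $(g,G,k)\in H$ and $x_0,y_0\in\mathbb R^N$ the system $\dot x=g(t,x)$, $\dot y=G(t,x)\,y+k(t,x)$, $x(0)=x_0$, $y(0)=y_0$ has a unique maximal solution $\big(x(\cdot,g,x_0),\,y(\cdot,g,G,k,x_0,y_0)\big)$; it is defined on $I_{g,x_0}$ and does not depend on the representatives of $g,G,k$. The map $(t,g,G,k)\mapsto(g_t,G_t,k_t)$ is a continuous flow on $H$, the set $\mathcal U_2=\{(t,g,G,k,x_0,y_0):(g,G,k)\in H,\ x_0,y_0\in\mathbb R^N,\ t\in I_{g,x_0}\}$ is open in $\mathbb R\times H\times\mathbb R^N\times\mathbb R^N$, and $$\Psi:\mathcal U_2\to H\times\mathbb R^N\times\mathbb R^N,\quad (t,g,G,k,x_0,y_0)\mapsto\big(g_t,G_t,k_t,\,x(t,g,x_0),\,y(t,g,G,k,x_0,y_0)\big)$$ is a continuous local skew-product flow on $H\times\mathbb R^N\times\mathbb R^N$ over it. -/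

import Mathlib

open MeasureTheory Set Filter Topology

/-- Euclidean space `ℝ^N`. -/
abbrev Euc (N : ℕ) : Type := EuclideanSpace ℝ (Fin N)

/-- `m ∈ L¹_loc`: integrable on every compact interval. -/
def IsL1loc (m : ℝ → ℝ) : Prop := ∀ a b : ℝ, IntervalIntegrable m volume a b

section Functions

variable {N : ℕ} {V : Type*} [NormedAddCommGroup V]

/-- `m` is an `m`-bound of `f` on `K`. -/
def IsMBound (f : ℝ → Euc N → V) (K : Set (Euc N)) (m : ℝ → ℝ) : Prop :=
  IsL1loc m ∧ ∀ᵐ t : ℝ, ∀ x ∈ K, ‖f t x‖ ≤ m t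

/-- The time translation `f_t (s, x) = f (s + t, x)`. -/
def timeTranslate {N : ℕ} {V : Type*} (t : ℝ) (f : ℝ → Euc N → V) : ℝ → Euc N → V := fun s x => f (s + t) x

/-- Conditions (C1) and (C2): Borel measurability and existence of `m`-bounds on compact sets. -/
structure IsCaratheodory [MeasurableSpace V] (f : ℝ → Euc N → V) : Prop where
  measurable : Measurable (Function.uncurry f)
  exists_mBound : ∀ K : Set (Euc N), IsCompact K → ∃ m, IsMBound f K m

/-- Lipschitz Carathéodory functions. -/
structure IsLC [MeasurableSpace V] (f : ℝ → Euc N → V) : Prop extends IsCaratheodory f where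
  exists_lBound : ∀ K : Set (Euc N), IsCompact K → ∃ l : ℝ → ℝ, IsL1loc l ∧
    ∀ᵐ t : ℝ, ∀ x ∈ K, ∀ y ∈ K, ‖f t x - f t y‖ ≤ l t * ‖x - y‖

/-- The optimal `m`-bound `t ↦ sup_{x ∈ K} |f (t, x)|`. -/
noncomputable def optimalMBound (f : ℝ → Euc N → V) (K : Set (Euc N)) (t : ℝ) : ℝ :=
  ⨆ x : K, ‖f t x‖

end Functions

/-- `L¹_loc`-equicontinuity of a set of functions. -/
def L1locEquicontinuous (S : Set (ℝ → ℝ)) : Prop :=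
  ∀ r > 0, ∀ ε > 0, ∃ δ > 0, ∀ s t : ℝ, -r ≤ s → s ≤ t → t ≤ r → t - s < δ →
    ∀ m ∈ S, ∫ u in s..t, m u < ε

/-- A set `E` of functions has `L¹_loc`-equicontinuous `m`-bounds: for every `j` there is an
`L¹_loc`-equicontinuous set consisting of `m`-bounds on the closed ball `B_j`, one at least for
each member of `E`. -/
def SetHasEquicontMBounds {N : ℕ} {V : Type*} [NormedAddCommGroup V]
    (E : Set (ℝ → Euc N → V)) : Prop :=
  ∀ j : ℕ, ∃ S : Set (ℝ → ℝ),
    (∀ m ∈ S, ∃ f ∈ E, IsMBound f (Metric.closedBall 0 j) m) ∧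
    (∀ f ∈ E, ∃ m ∈ S, IsMBound f (Metric.closedBall 0 j) m) ∧
    L1locEquicontinuous S

/-- `f` has `L¹_loc`-equicontinuous `m`-bounds: the set of its time translations does. -/
def HasEquicontMBounds {N : ℕ} {V : Type*} [NormedAddCommGroup V]
    (f : ℝ → Euc N → V) : Prop :=
  SetHasEquicontMBounds (range fun t : ℝ => timeTranslate t f)

/-- A suitable set of moduli of continuity `Θ = (θ_j)_j` (the same for all time intervals);
only the values on `[0, ∞)` matter. -/
structure SuitableModuli where
  toFun : ℕ → ℝ → ℝ
  zero : ∀ j, toFun j 0 = 0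
  continuousOn : ∀ j, ContinuousOn (toFun j) (Ici 0)
  monotoneOn : ∀ j, MonotoneOn (toFun j) (Ici 0)
  mono : ∀ i j, i ≤ j → ∀ s, 0 ≤ s → toFun i s ≤ toFun j s

/-- `𝒦_j^I`, `I = [a, b]`: continuous functions `I → B_j` admitting `θ_j` as modulus of
continuity. Only the values on `I` of the function `x` matter. -/
def modulusClass (N : ℕ) (Θ : SuitableModuli) (a b : ℝ) (j : ℕ) : Set (ℝ → Euc N) :=
  {x | ContinuousOn x (Icc a b) ∧ MapsTo x (Icc a b) (Metric.closedBall 0 j) ∧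
    ∀ s ∈ Icc a b, ∀ t ∈ Icc a b, ‖x s - x t‖ ≤ Θ.toFun j |s - t|}

section Weak

variable {N : ℕ} {V : Type*} [NormedAddCommGroup V] [NormedSpace ℝ V]

/-- Weak `Θ`-Carathéodory functions. -/
structure IsWTC [MeasurableSpace V] (Θ : SuitableModuli) (f : ℝ → Euc N → V) : Prop
    extends IsCaratheodory f where
  tendsto_integral : ∀ (j : ℕ) (a b : ℚ), a ≤ b → ∀ (x : ℕ → ℝ → Euc N) (y : ℝ → Euc N),
    (∀ n, x n ∈ modulusClass N Θ a b j) → y ∈ modulusClass N Θ a b j →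
    TendstoUniformlyOn x y atTop (Icc (a : ℝ) b) →
    Tendsto (fun n => ∫ t in (a : ℝ)..b, f t (x n t)) atTop (𝓝 (∫ t in (a : ℝ)..b, f t (y t)))

/-- The seminorm `p_{I,j}(f) = sup_{x ∈ 𝒦_j^I} |∫_I f(t, x(t)) dt|`, `I = [a, b]`. -/
noncomputable def pSeminorm (Θ : SuitableModuli) (a b : ℚ) (j : ℕ) (f : ℝ → Euc N → V) :
    ENNReal :=
  ⨆ x ∈ modulusClass N Θ a b j, ‖∫ t in (a : ℝ)..b, f t (x t)‖ₑ

end Weak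

lemma ae_timeTranslate {N : ℕ} {V : Type*} {f g : ℝ → Euc N → V} (t : ℝ)
    (h : ∀ᵐ p : ℝ × Euc N, f p.1 p.2 = g p.1 p.2) :
    ∀ᵐ p : ℝ × Euc N, timeTranslate t f p.1 p.2 = timeTranslate t g p.1 p.2 := by
  have hmp : MeasurePreserving (Prod.map (fun s : ℝ => s + t) (id : Euc N → Euc N))
      (volume : Measure (ℝ × Euc N)) (volume : Measure (ℝ × Euc N)) :=
    (measurePreserving_add_right volume t).prod (MeasurePreserving.id volume)
  exact hmp.quasiMeasurePreserving.ae h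

section Spaces

variable {N : ℕ} {V : Type*} [NormedAddCommGroup V] [NormedSpace ℝ V]

/-- The functions satisfying `P`, to be endowed with the topology `σ_Θ`. -/
structure CFun (Θ : SuitableModuli) (P : (ℝ → Euc N → V) → Prop) where
  toFun : ℝ → Euc N → V
  prop : P toFun

/-- The topology generated by the seminorms `p_{I,j}`. -/
instance CFun.instTopologicalSpace (Θ : SuitableModuli) (P : (ℝ → Euc N → V) → Prop) :
    TopologicalSpace (CFun Θ P) :=
  TopologicalSpace.generateFrom
    {U | ∃ (f : CFun Θ P) (a b : ℚ) (j : ℕ) (ε : ENNReal), a ≤ b ∧ 0 < ε ∧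
      U = {g | pSeminorm Θ a b j (g.toFun - f.toFun) < ε}}

/-- Identification of functions that differ on a Lebesgue null subset of `ℝ × ℝ^N` only. -/
instance CFun.instSetoid (Θ : SuitableModuli) (P : (ℝ → Euc N → V) → Prop) :
    Setoid (CFun Θ P) where
  r f g := ∀ᵐ p : ℝ × Euc N, f.toFun p.1 p.2 = g.toFun p.1 p.2
  iseqv :=
    { refl := fun _ => Eventually.of_forall fun _ => rfl
      symm := fun h => h.mono fun _ hp => hp.symm
      trans := fun h h' => (h.and h').mono fun _ hp => hp.1.trans hp.2 }

/-- The space of classes, with the topology `σ_Θ`. -/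
def CSpace (Θ : SuitableModuli) (P : (ℝ → Euc N → V) → Prop) : Type _ :=
  Quotient (CFun.instSetoid Θ P)

instance CSpace.instTopologicalSpace (Θ : SuitableModuli) (P : (ℝ → Euc N → V) → Prop) :
    TopologicalSpace (CSpace Θ P) :=
  inferInstanceAs (TopologicalSpace (Quotient (CFun.instSetoid Θ P)))

/-- The class of `f`. -/
def CSpace.mk (Θ : SuitableModuli) {P : (ℝ → Euc N → V) → Prop} (f : ℝ → Euc N → V) (hf : P f) :
    CSpace Θ P :=
  Quotient.mk (CFun.instSetoid Θ P) ⟨f, hf⟩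

/-- `f` represents the class `c`. -/
def CSpace.Represents {Θ : SuitableModuli} {P : (ℝ → Euc N → V) → Prop}
    (f : ℝ → Euc N → V) (c : CSpace Θ P) : Prop :=
  ∃ hf : P f, CSpace.mk Θ f hf = c

/-- `P` is stable under time translations. -/
class TranslationStable (P : (ℝ → Euc N → V) → Prop) : Prop where
  timeTranslate : ∀ (t : ℝ) (f : ℝ → Euc N → V), P f → P (timeTranslate t f)

/-- The time translation of a class. -/
def CSpace.translate {Θ : SuitableModuli} {P : (ℝ → Euc N → V) → Prop} [hP : TranslationStable P]
    (t : ℝ) : CSpace Θ P → CSpace Θ P :=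
  Quotient.map (fun f => (⟨timeTranslate t f.toFun, hP.timeTranslate t f.toFun f.prop⟩ : CFun Θ P))
    fun _ _ h => ae_timeTranslate t h

end Spaces

section Stability

variable {N : ℕ} {V : Type*} [NormedAddCommGroup V]

lemma IsL1loc.comp_add_right {m : ℝ → ℝ} (h : IsL1loc m) (t : ℝ) :
    IsL1loc fun s => m (s + t) := by
  intro a b
  have := (h (a + t) (b + t)).comp_add_right t
  simpa using this

lemma ae_comp_add_right {p : ℝ → Prop} (h : ∀ᵐ s : ℝ, p s) (t : ℝ) : ∀ᵐ s : ℝ, p (s + t) :=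
  (measurePreserving_add_right volume t).quasiMeasurePreserving.ae h

lemma IsMBound.timeTranslate {f : ℝ → Euc N → V} {K : Set (Euc N)} {m : ℝ → ℝ}
    (h : IsMBound f K m) (t : ℝ) : IsMBound (timeTranslate t f) K fun s => m (s + t) :=
  ⟨h.1.comp_add_right t, ae_comp_add_right h.2 t⟩

lemma IsCaratheodory.timeTranslate [MeasurableSpace V] {f : ℝ → Euc N → V}
    (h : IsCaratheodory f) (t : ℝ) : IsCaratheodory (timeTranslate t f) where
  measurable := by
    have : Measurable fun p : ℝ × Euc N => (p.1 + t, p.2) := by fun_prop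
    exact h.measurable.comp this
  exists_mBound K hK := by
    obtain ⟨m, hm⟩ := h.exists_mBound K hK
    exact ⟨_, hm.timeTranslate t⟩

instance IsLC.translationStable [MeasurableSpace V] :
    TranslationStable (IsLC : (ℝ → Euc N → V) → Prop) where
  timeTranslate t f hf :=
    { toIsCaratheodory := hf.toIsCaratheodory.timeTranslate t
      exists_lBound := fun K hK => by
        obtain ⟨l, hl, hl'⟩ := hf.exists_lBound K hK
        exact ⟨_, hl.comp_add_right t, ae_comp_add_right hl' t⟩ }

lemma IsCaratheodory.intervalIntegrable [MeasurableSpace V] [BorelSpace V]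
    [SecondCountableTopology V] {f : ℝ → Euc N → V} (h : IsCaratheodory f) {j : ℕ} {m : ℝ → ℝ}
    (hm : IsMBound f (Metric.closedBall 0 j) m) {x : ℝ → Euc N} {a b : ℝ} (hab : a ≤ b)
    (hx : ContinuousOn x (Icc a b)) (hxj : MapsTo x (Icc a b) (Metric.closedBall 0 j)) :
    IntervalIntegrable (fun t => f t (x t)) volume a b := by
  rw [intervalIntegrable_iff_integrableOn_Icc_of_le hab]
  have hmi := (intervalIntegrable_iff_integrableOn_Icc_of_le hab).1 (hm.1 a b)
  refine Integrable.mono' hmi ?_ ?_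
  · have h1 : AEMeasurable x (volume.restrict (Icc a b)) := hx.aemeasurable measurableSet_Icc
    have h2 : AEMeasurable (fun t => (t, x t)) (volume.restrict (Icc a b)) :=
      aemeasurable_id.prodMk h1
    exact (h.measurable.comp_aemeasurable h2).aestronglyMeasurable
  · filter_upwards [ae_restrict_of_ae hm.2, ae_restrict_mem measurableSet_Icc] with t ht hmem
    exact ht _ (hxj hmem)

lemma IsMBound.norm_integral_le [NormedSpace ℝ V] {f : ℝ → Euc N → V} {j : ℕ} {m : ℝ → ℝ}
    (hm : IsMBound f (Metric.closedBall 0 j) m) {x : ℝ → Euc N} {a b : ℝ} (hab : a ≤ b)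
    (hxj : MapsTo x (Icc a b) (Metric.closedBall 0 j)) :
    ‖∫ t in a..b, f t (x t)‖ ≤ ∫ t in a..b, m t := by
  refine intervalIntegral.norm_integral_le_of_norm_le hab ?_ (hm.1 a b)
  filter_upwards [hm.2] with t ht hmem
  exact ht _ (hxj (Ioc_subset_Icc_self hmem))

/-- Extension by constants of `x` from `[a, b]`, shifted by `t`. -/
def clampShift (a b t : ℝ) (x : ℝ → Euc N) : ℝ → Euc N := fun u => x (max a (min b (u - t)))

lemma clamp_mem {a b : ℝ} (hab : a ≤ b) (v : ℝ) : max a (min b v) ∈ Icc a b :=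
  ⟨le_max_left _ _, max_le hab (min_le_left _ _)⟩

lemma abs_clamp_sub_le (a b v w : ℝ) :
    |max a (min b v) - max a (min b w)| ≤ |v - w| := by
  refine (abs_max_sub_max_le_max a (min b v) a (min b w)).trans ?_
  refine max_le (by simp) ?_
  refine (abs_min_sub_min_le_max b v b w).trans ?_
  exact max_le (by simp) le_rfl

lemma clampShift_mem {Θ : SuitableModuli} {a b : ℝ} (hab : a ≤ b) (t : ℝ) {j : ℕ}
    {x : ℝ → Euc N} (hx : x ∈ modulusClass N Θ a b j) (p q : ℝ) :
    clampShift a b t x ∈ modulusClass N Θ p q j := by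
  obtain ⟨h1, h2, h3⟩ := hx
  refine ⟨?_, fun u _ => h2 (clamp_mem hab _), fun u _ v _ => ?_⟩
  · exact (h1.comp_continuous (by fun_prop) fun u => clamp_mem hab (u - t)).continuousOn
  · refine (h3 _ (clamp_mem hab _) _ (clamp_mem hab _)).trans ?_
    refine Θ.monotoneOn j (mem_Ici.2 (abs_nonneg _)) (mem_Ici.2 (abs_nonneg _)) ?_
    refine (abs_clamp_sub_le a b (u - t) (v - t)).trans ?_
    simp

lemma norm_integral_sub_clampShift_le [NormedSpace ℝ V] [MeasurableSpace V] [BorelSpace V]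
    [SecondCountableTopology V] {Θ : SuitableModuli} {f : ℝ → Euc N → V} (h : IsCaratheodory f)
    {j : ℕ} {m : ℝ → ℝ} (hm : IsMBound f (Metric.closedBall 0 j) m) {a b t p q : ℝ} (hab : a ≤ b)
    (hp : p ≤ a + t) (hq : b + t ≤ q) {x : ℝ → Euc N} (hx : x ∈ modulusClass N Θ a b j) :
    ‖(∫ s in a..b, timeTranslate t f s (x s)) - ∫ u in p..q, f u (clampShift a b t x u)‖ ≤
      (∫ u in p..(a + t), m u) + ∫ u in (b + t)..q, m u := by
  have hmem := clampShift_mem hab t hx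
  have hii : ∀ c d : ℝ, c ≤ d →
      IntervalIntegrable (fun u => f u (clampShift a b t x u)) volume c d := fun c d hcd =>
    h.intervalIntegrable hm hcd (hmem c d).1 (hmem c d).2.1
  have habt : a + t ≤ b + t := by linarith
  have e1 : (∫ s in a..b, timeTranslate t f s (x s)) =
      ∫ u in (a + t)..(b + t), f u (clampShift a b t x u) := by
    rw [← intervalIntegral.integral_comp_add_right (fun u => f u (clampShift a b t x u)) t]
    refine intervalIntegral.integral_congr fun s hs => ?_
    rw [uIcc_of_le hab] at hs
    simp [timeTranslate, clampShift, hs.1, hs.2]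
  have e2 : (∫ u in p..q, f u (clampShift a b t x u)) =
      (∫ u in p..(a + t), f u (clampShift a b t x u)) +
      (∫ u in (a + t)..(b + t), f u (clampShift a b t x u)) +
      ∫ u in (b + t)..q, f u (clampShift a b t x u) := by
    rw [intervalIntegral.integral_add_adjacent_intervals (hii _ _ hp) (hii _ _ habt),
      intervalIntegral.integral_add_adjacent_intervals (hii _ _ (hp.trans habt)) (hii _ _ hq)]
  have n1 := hm.norm_integral_le hp (hmem p (a + t)).2.1
  have n2 := hm.norm_integral_le hq (hmem (b + t) q).2.1
  rw [e1, e2]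
  have : ∀ A B C : V, ‖B - (A + B + C)‖ ≤ ‖A‖ + ‖C‖ := fun A B C => by
    have : B - (A + B + C) = -(A + C) := by abel
    rw [this, norm_neg]
    exact norm_add_le _ _
  exact (this _ _ _).trans (add_le_add n1 n2)

instance IsWTC.translationStable [NormedSpace ℝ V] [MeasurableSpace V] [BorelSpace V]
    [SecondCountableTopology V] (Θ : SuitableModuli) : TranslationStable (IsWTC Θ : (ℝ → Euc N → V) → Prop) where
  timeTranslate t f hf :=
    { toIsCaratheodory := hf.toIsCaratheodory.timeTranslate t
      tendsto_integral := fun j a b hab x y hx hy hxy => by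
        have hab' : (a : ℝ) ≤ b := by exact_mod_cast hab
        obtain ⟨m, hm⟩ := hf.exists_mBound (Metric.closedBall 0 j) (isCompact_closedBall 0 j)
        rw [Metric.tendsto_atTop]
        intro ε hε
        have hc1 : Continuous fun p : ℝ => ∫ u in (a + t)..p, m u :=
          intervalIntegral.continuous_primitive hm.1 _
        have hc2 : Continuous fun p : ℝ => ∫ u in (b + t)..p, m u :=
          intervalIntegral.continuous_primitive hm.1 _
        obtain ⟨δ₁, hδ₁, h₁⟩ := Metric.continuous_iff.1 hc1 (a + t) (ε / 8) (by positivity)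
        obtain ⟨δ₂, hδ₂, h₂⟩ := Metric.continuous_iff.1 hc2 (b + t) (ε / 8) (by positivity)
        obtain ⟨p, hp, hp'⟩ := exists_rat_btwn (show (a : ℝ) + t - δ₁ < a + t by linarith)
        obtain ⟨q, hq, hq'⟩ := exists_rat_btwn (show (b : ℝ) + t < b + t + δ₂ by linarith)
        have b₁ : |∫ u in (p : ℝ)..(a + t), m u| < ε / 8 := by
          have := h₁ p (by rw [Real.dist_eq, abs_lt]; constructor <;> linarith)
          rw [Real.dist_eq, intervalIntegral.integral_same, sub_zero] at this
          rwa [intervalIntegral.integral_symm, abs_neg]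
        have b₂ : |∫ u in (b + t)..(q : ℝ), m u| < ε / 8 := by
          have := h₂ q (by rw [Real.dist_eq, abs_lt]; constructor <;> linarith)
          rwa [Real.dist_eq, intervalIntegral.integral_same, sub_zero] at this
        have hpq : p ≤ q := by
          have : (p : ℝ) ≤ q := by linarith
          exact_mod_cast this
        have hunif : TendstoUniformlyOn (fun n => clampShift (a : ℝ) b t (x n))
            (clampShift (a : ℝ) b t y) atTop (Icc (p : ℝ) q) := by
          rw [Metric.tendstoUniformlyOn_iff] at hxy ⊢
          intro η hη
          filter_upwards [hxy η hη] with n hn u _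
          exact hn _ (clamp_mem hab' _)
        have hlim := hf.tendsto_integral j p q hpq _ _
          (fun n => clampShift_mem hab' t (hx n) _ _) (clampShift_mem hab' t hy _ _) hunif
        obtain ⟨n₀, hn₀⟩ := Metric.tendsto_atTop.1 hlim (ε / 4) (by positivity)
        refine ⟨n₀, fun n hn => ?_⟩
        have k1 := norm_integral_sub_clampShift_le hf.toIsCaratheodory hm hab' hp'.le hq.le (hx n)
        have k2 := norm_integral_sub_clampShift_le hf.toIsCaratheodory hm hab' hp'.le hq.le hy
        have k3 := hn₀ n hn
        rw [dist_eq_norm] at k3 ⊢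
        have c1 := (abs_lt.1 b₁).2
        have c2 := (abs_lt.1 b₂).2
        have : ∀ A B C D : V, ‖A - B‖ ≤ ‖A - C‖ + ‖C - D‖ + ‖B - D‖ := fun A B C D => by
          have : A - B = (A - C) + (C - D) - (B - D) := by abel
          rw [this]
          exact (norm_sub_le _ _).trans (by gcongr; exact norm_add_le _ _)
        refine (this _ _ _ _).trans_lt (lt_of_le_of_lt (add_le_add (add_le_add k1 le_rfl) k2) ?_)
        linarith }

end Stability

section Theta

variable {N : ℕ} {V : Type*} [NormedAddCommGroup V]

lemma optimalMBound_le {f : ℝ → Euc N → V} {j : ℕ} {m : ℝ → ℝ}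
    (hm : IsMBound f (Metric.closedBall 0 j) m) :
    ∀ᵐ t : ℝ, optimalMBound f (Metric.closedBall 0 j) t ≤ m t := by
  filter_upwards [hm.2] with t ht
  have : Nonempty (Metric.closedBall (0 : Euc N) (j : ℝ)) := ⟨⟨0, by simp⟩⟩
  exact ciSup_le fun x => ht x x.2

lemma optimalMBound_nonneg (f : ℝ → Euc N → V) (K : Set (Euc N)) (t : ℝ) :
    0 ≤ optimalMBound f K t :=
  Real.iSup_nonneg fun _ => norm_nonneg _

lemma IsLC.isL1loc_optimalMBound [MeasurableSpace V] [BorelSpace V] {f : ℝ → Euc N → V}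
    (hf : IsLC f) (j : ℕ) : IsL1loc (optimalMBound f (Metric.closedBall 0 j)) := by
  obtain ⟨m, hm⟩ := hf.exists_mBound (Metric.closedBall 0 j) (isCompact_closedBall 0 j)
  obtain ⟨l, -, hl⟩ := hf.exists_lBound (Metric.closedBall 0 j) (isCompact_closedBall 0 j)
  have : Nonempty (Metric.closedBall (0 : Euc N) (j : ℝ)) := ⟨⟨0, by simp⟩⟩
  let D := TopologicalSpace.denseSeq (Metric.closedBall (0 : Euc N) (j : ℝ))
  have hmeas : Measurable fun t => ⨆ n : ℕ, ‖f t (D n)‖ := by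
    refine Measurable.iSup fun n => ?_
    have h1 : Measurable fun t : ℝ => (t, ((D n : Metric.closedBall (0 : Euc N) (j : ℝ)) : Euc N)) := by
      fun_prop
    exact (hf.measurable.comp h1).norm
  have hae : (fun t => ⨆ n : ℕ, ‖f t (D n)‖) =ᵐ[volume]
      optimalMBound f (Metric.closedBall 0 j) := by
    filter_upwards [hm.2, hl] with t ht hlt
    have hcont : Continuous fun x : Metric.closedBall (0 : Euc N) (j : ℝ) => f t x := by
      have : LipschitzWith (Real.toNNReal (l t))
          fun x : Metric.closedBall (0 : Euc N) (j : ℝ) => f t x := by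
        refine LipschitzWith.of_dist_le_mul fun x y => ?_
        rw [dist_eq_norm]
        refine (hlt x x.2 y y.2).trans ?_
        rw [Subtype.dist_eq, dist_eq_norm]
        gcongr
        exact Real.le_coe_toNNReal _
      exact this.continuous
    have hb : BddAbove (range fun x : Metric.closedBall (0 : Euc N) (j : ℝ) => ‖f t x‖) :=
      ⟨m t, by rintro _ ⟨x, rfl⟩; exact ht x x.2⟩
    have hb' : BddAbove (range fun n => ‖f t (D n)‖) :=
      ⟨m t, by rintro _ ⟨n, rfl⟩; exact ht _ (D n).2⟩
    refine le_antisymm (ciSup_le fun n => le_ciSup hb (D n)) (ciSup_le fun x => ?_)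
    have hcl : IsClosed {x : Metric.closedBall (0 : Euc N) (j : ℝ) |
        ‖f t x‖ ≤ ⨆ n : ℕ, ‖f t (D n)‖} := isClosed_le hcont.norm continuous_const
    have := (TopologicalSpace.denseRange_denseSeq
      (Metric.closedBall (0 : Euc N) (j : ℝ))).closure_eq
    have hsub : closure (range D) ⊆ _ :=
      hcl.closure_subset_iff.2 (by rintro _ ⟨n, rfl⟩; exact le_ciSup hb' n)
    exact hsub (this ▸ mem_univ x)
  intro a b
  refine (hm.1 a b).mono_fun (hmeas.aestronglyMeasurable.congr hae).restrict ?_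
  refine ae_restrict_of_ae ?_
  filter_upwards [optimalMBound_le hm] with t ht
  rw [Real.norm_of_nonneg (optimalMBound_nonneg _ _ _)]
  exact ht.trans (le_abs_self _)

/-- `∫_t^{t+s}` of the optimal `m`-bound of `f` on `B_j`. -/
noncomputable def mBoundIntegral (f : ℝ → Euc N → V) (j : ℕ) (s t : ℝ) : ℝ :=
  ∫ u in t..(t + s), optimalMBound f (Metric.closedBall 0 j) u

lemma mBoundIntegral_nonneg (f : ℝ → Euc N → V) (j : ℕ) {s : ℝ} (hs : 0 ≤ s) (t : ℝ) :
    0 ≤ mBoundIntegral f j s t :=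
  intervalIntegral.integral_nonneg (by linarith) fun _ _ => optimalMBound_nonneg _ _ _

lemma exists_mBoundIntegral_le [MeasurableSpace V] [BorelSpace V] {f : ℝ → Euc N → V}
    (hf : IsLC f) (hm : HasEquicontMBounds f) (j : ℕ) {ε : ℝ} (hε : 0 < ε) :
    ∃ δ > 0, ∀ s, 0 ≤ s → s < δ → ∀ t, mBoundIntegral f j s t ≤ ε := by
  obtain ⟨S, -, hS, hS'⟩ := hm j
  obtain ⟨δ, hδ, h⟩ := hS' 1 one_pos ε hε
  refine ⟨min δ 1, lt_min hδ one_pos, fun s hs hsδ t => ?_⟩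
  obtain ⟨m, hmS, hmb⟩ := hS _ ⟨t, rfl⟩
  have h1 := h 0 s (by norm_num) hs (hsδ.le.trans (min_le_right _ _))
    (by simpa using hsδ.trans_le (min_le_left _ _)) m hmS
  have h2 : mBoundIntegral f j s t =
      ∫ u in (0 : ℝ)..s, optimalMBound (timeTranslate t f) (Metric.closedBall 0 j) u := by
    have := intervalIntegral.integral_comp_add_right (a := 0) (b := s)
      (fun u => optimalMBound f (Metric.closedBall 0 j) u) t
    rw [zero_add, add_comm s t] at this
    exact this.symm
  rw [h2]
  refine le_trans ?_ h1.le
  exact intervalIntegral.integral_mono_ae hs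
    ((TranslationStable.timeTranslate (P := IsLC) t f hf).isL1loc_optimalMBound j 0 s) (hmb.1 0 s)
    (optimalMBound_le hmb)

lemma mBoundIntegral_add [MeasurableSpace V] [BorelSpace V] {f : ℝ → Euc N → V}
    (hf : IsLC f) (j : ℕ) (s s' t : ℝ) :
    mBoundIntegral f j (s + s') t = mBoundIntegral f j s t + mBoundIntegral f j s' (t + s) := by
  unfold mBoundIntegral
  rw [← add_assoc, intervalIntegral.integral_add_adjacent_intervals] <;>
    exact hf.isL1loc_optimalMBound j _ _

lemma bddAbove_mBoundIntegral [MeasurableSpace V] [BorelSpace V] {f : ℝ → Euc N → V}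
    (hf : IsLC f) (hm : HasEquicontMBounds f) (j : ℕ) {s : ℝ} (_hs : 0 ≤ s) :
    BddAbove (range (mBoundIntegral f j s)) := by
  obtain ⟨δ, hδ, h⟩ := exists_mBoundIntegral_le hf hm j one_pos
  have key : ∀ n : ℕ, ∀ t, mBoundIntegral f j (n * (δ / 2)) t ≤ n := by
    intro n
    induction n with
    | zero => intro t; simp [mBoundIntegral]
    | succ n ih =>
      intro t
      have : ((n + 1 : ℕ) : ℝ) * (δ / 2) = n * (δ / 2) + δ / 2 := by push_cast; ring
      rw [this, mBoundIntegral_add hf]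
      push_cast
      exact add_le_add (ih t) (h _ (by positivity) (by linarith) _)
  obtain ⟨n, hn⟩ := exists_nat_ge (s / (δ / 2))
  have hsn : s ≤ n * (δ / 2) := by rwa [div_le_iff₀ (by positivity)] at hn
  refine ⟨n, ?_⟩
  rintro _ ⟨t, rfl⟩
  have := mBoundIntegral_add hf j s (n * (δ / 2) - s) t
  rw [add_sub_cancel] at this
  have h0 := mBoundIntegral_nonneg f j (sub_nonneg.2 hsn) (t + s)
  linarith [key n t]

/-- The suitable set of moduli of continuity
`θ_j(s) = sup_{t ∈ ℝ} ∫_t^{t+s} m^j(u) du` given by the optimal `m`-bounds `m^j` of `f`. -/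
noncomputable def moduliOf [MeasurableSpace V] [BorelSpace V] (f : ℝ → Euc N → V)
    (hf : IsLC f) (hm : HasEquicontMBounds f) : SuitableModuli where
  toFun j s := ⨆ t : ℝ, ∫ u in t..(t + s), optimalMBound f (Metric.closedBall 0 j) u
  zero j := by simp
  monotoneOn j := fun s hs s' hs' hss => by
    refine ciSup_le fun t => le_trans ?_ (le_ciSup (bddAbove_mBoundIntegral hf hm j hs') t)
    have := mBoundIntegral_add hf j s (s' - s) t
    rw [add_sub_cancel] at this
    have h0 := mBoundIntegral_nonneg f j (sub_nonneg.2 hss) (t + s)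
    change mBoundIntegral f j s t ≤ _
    linarith
  continuousOn j := by
    have key : ∀ ε > 0, ∃ δ > 0, ∀ s s' : ℝ, 0 ≤ s → s ≤ s' → s' - s < δ →
        |(⨆ t : ℝ, mBoundIntegral f j s' t) - ⨆ t : ℝ, mBoundIntegral f j s t| ≤ ε := by
      intro ε hε
      obtain ⟨δ, hδ, h⟩ := exists_mBoundIntegral_le hf hm j hε
      refine ⟨δ, hδ, fun s s' hs hss hd => ?_⟩
      have e : ∀ t, mBoundIntegral f j s' t =
          mBoundIntegral f j s t + mBoundIntegral f j (s' - s) (t + s) := fun t => by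
        rw [← mBoundIntegral_add hf, add_sub_cancel]
      rw [abs_le]
      constructor
      · have : (⨆ t : ℝ, mBoundIntegral f j s t) ≤ ⨆ t : ℝ, mBoundIntegral f j s' t :=
          ciSup_le fun t =>
            le_trans (by linarith [e t, mBoundIntegral_nonneg f j (sub_nonneg.2 hss) (t + s)])
              (le_ciSup (bddAbove_mBoundIntegral hf hm j (hs.trans hss)) t)
        linarith
      · have : (⨆ t : ℝ, mBoundIntegral f j s' t) ≤ (⨆ t : ℝ, mBoundIntegral f j s t) + ε :=
          ciSup_le fun t => by
            have h1 := le_ciSup (bddAbove_mBoundIntegral hf hm j hs) t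
            have h2 := h _ (sub_nonneg.2 hss) hd (t + s)
            linarith [e t]
        linarith
    rw [Metric.continuousOn_iff]
    intro s hs ε hε
    obtain ⟨δ, hδ, h⟩ := key (ε / 2) (by positivity)
    refine ⟨δ, hδ, fun s' hs' hd => ?_⟩
    rw [Real.dist_eq] at hd ⊢
    refine lt_of_le_of_lt ?_ (half_lt_self hε)
    rcases le_total s s' with hss | hss
    · exact h s s' hs hss (lt_of_le_of_lt (le_abs_self _) hd)
    · rw [abs_sub_comm] at hd ⊢
      exact h s' s hs' hss (lt_of_le_of_lt (le_abs_self _) hd)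
  mono i j hij s hs := by
    refine ciSup_le fun t => le_trans ?_ (le_ciSup (bddAbove_mBoundIntegral hf hm j hs) t)
    refine intervalIntegral.integral_mono_ae (by linarith) (hf.isL1loc_optimalMBound i _ _)
      (hf.isL1loc_optimalMBound j _ _) ?_
    obtain ⟨m, hm⟩ := hf.exists_mBound (Metric.closedBall 0 j) (isCompact_closedBall 0 j)
    filter_upwards [hm.2] with u hu
    have : Nonempty (Metric.closedBall (0 : Euc N) (i : ℝ)) := ⟨⟨0, by simp⟩⟩
    have hb : BddAbove (range fun x : Metric.closedBall (0 : Euc N) (j : ℝ) => ‖f u x‖) :=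
      ⟨m u, by rintro _ ⟨x, rfl⟩; exact hu x x.2⟩
    refine ciSup_le fun x => ?_
    exact le_ciSup hb ⟨x.1, Metric.closedBall_subset_closedBall (by exact_mod_cast hij) x.2⟩

end Theta

section Dynamics

/-- The hull of `ω`: the closure of its orbit under the translations `τ`. -/
def hull {Ω : Type*} [TopologicalSpace Ω] (τ : ℝ → Ω → Ω) (ω : Ω) : Set Ω :=
  closure (range fun t : ℝ => τ t ω)

/-- `LC` with the topology `σ_Θ`. -/
abbrev LCSpace (Θ : SuitableModuli) (N : ℕ) : Type :=
  CSpace Θ (IsLC : (ℝ → Euc N → Euc N) → Prop)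

/-- `WΘC(V)` with the topology `σ_Θ`. -/
abbrev WTCSpace (Θ : SuitableModuli) (N : ℕ) (V : Type) [NormedAddCommGroup V]
    [NormedSpace ℝ V] [MeasurableSpace V] : Type :=
  CSpace Θ (IsWTC Θ : (ℝ → Euc N → V) → Prop)

/-- `LC × WΘC(ℝ^{N×N}) × WΘC` with the product topology; `N × N` matrices are regarded as linear
maps of `ℝ^N`. -/
abbrev TripleSpace (Θ : SuitableModuli) (N : ℕ) : Type :=
  LCSpace Θ N × WTCSpace Θ N (Euc N →L[ℝ] Euc N) × WTCSpace Θ N (Euc N)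

/-- `(g, G, k) ↦ (g_t, G_t, k_t)`. -/
def tripleTranslate {Θ : SuitableModuli} {N : ℕ} (t : ℝ) (ω : TripleSpace Θ N) :
    TripleSpace Θ N :=
  (CSpace.translate t ω.1, CSpace.translate t ω.2.1, CSpace.translate t ω.2.2)

/-- `x` is a (Carathéodory) solution of `ẋ = g(t, x)`, `x(0) = x₀`, on the interval `J`. -/
structure IsSolution {N : ℕ} (g : ℝ → Euc N → Euc N) (x₀ : Euc N) (J : Set ℝ)
    (x : ℝ → Euc N) : Prop where
  ordConnected : J.OrdConnected
  zero_mem : (0 : ℝ) ∈ J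
  continuousOn : ContinuousOn x J
  integrable : ∀ t ∈ J, IntervalIntegrable (fun s => g s (x s)) volume 0 t
  eq : ∀ t ∈ J, x t = x₀ + ∫ s in (0 : ℝ)..t, g s (x s)

/-- `x` is the unique solution on the open interval `J`, and `J` is the maximal interval of
existence. -/
structure IsMaximalSolution {N : ℕ} (g : ℝ → Euc N → Euc N) (x₀ : Euc N) (J : Set ℝ)
    (x : ℝ → Euc N) : Prop extends IsSolution g x₀ J x where
  isOpen : IsOpen J
  maximal : ∀ (J' : Set ℝ) (x' : ℝ → Euc N), IsSolution g x₀ J' x' → J' ⊆ J ∧ EqOn x' x J'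

/-- `(x, y)` is a solution on `J` of the triangular system `ẋ = g(t, x)`,
`ẏ = G(t, x) y + k(t, x)`, `x(0) = x₀`, `y(0) = y₀`. -/
structure IsTriangularSolution {N : ℕ} (g : ℝ → Euc N → Euc N)
    (G : ℝ → Euc N → (Euc N →L[ℝ] Euc N)) (k : ℝ → Euc N → Euc N) (x₀ y₀ : Euc N) (J : Set ℝ)
    (x y : ℝ → Euc N) : Prop extends IsSolution g x₀ J x where
  continuousOn_snd : ContinuousOn y J
  integrable_snd : ∀ t ∈ J,
    IntervalIntegrable (fun s => G s (x s) (y s) + k s (x s)) volume 0 t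
  eq_snd : ∀ t ∈ J, y t = y₀ + ∫ s in (0 : ℝ)..t, (G s (x s) (y s) + k s (x s))

/-- `(x, y)` is the unique solution of the triangular system on the open interval `J`, and `J` is
the maximal interval of existence. -/
structure IsMaximalTriangularSolution {N : ℕ} (g : ℝ → Euc N → Euc N)
    (G : ℝ → Euc N → (Euc N →L[ℝ] Euc N)) (k : ℝ → Euc N → Euc N) (x₀ y₀ : Euc N) (J : Set ℝ)
    (x y : ℝ → Euc N) : Prop extends IsTriangularSolution g G k x₀ y₀ J x y where
  isOpen : IsOpen J
  maximal : ∀ (J' : Set ℝ) (x' y' : ℝ → Euc N), IsTriangularSolution g G k x₀ y₀ J' x' y' →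
    J' ⊆ J ∧ EqOn x' x J' ∧ EqOn y' y J'

/-- `Π : U ⊆ ℝ × B × Y → B × Y` is a continuous local skew-product flow over the (global,
continuous) base flow `φ` on `B`. -/
structure IsContinuousLocalSkewProductFlow {B Y : Type*} [TopologicalSpace B] [TopologicalSpace Y]
    (φ : Flow ℝ B) (U : Set (ℝ × B × Y)) (Pi : ℝ × B × Y → B × Y) : Prop where
  isOpen : IsOpen U
  zero_mem : ∀ z : B × Y, (0, z) ∈ U
  ordConnected : ∀ z : B × Y, {t : ℝ | (t, z) ∈ U}.OrdConnected
  map_zero : ∀ z : B × Y, Pi (0, z) = z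
  mem_iff : ∀ (s t : ℝ) (z : B × Y), (s, z) ∈ U → ((t, Pi (s, z)) ∈ U ↔ (t + s, z) ∈ U)
  map_add : ∀ (s t : ℝ) (z : B × Y), (s, z) ∈ U → (t + s, z) ∈ U →
    Pi (t + s, z) = Pi (t, Pi (s, z))
  skew : ∀ (t : ℝ) (b : B) (y : Y), (t, b, y) ∈ U → (Pi (t, b, y)).1 = φ t b
  continuousOn : ContinuousOn Pi U

end Dynamics

/-! The topology `σ_Θ` sees a function only through its integrals along paths in `𝒦_j`, so the
definition of the hull gives no `m`-bounds that are uniform over it. What survives the closure is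
the mass `∫ |c(t, x(t))| dt` along a path. The mass is the supremum of the sums of `|∫ c(t, x(t))
dt|` over the pieces of uniform partitions (`integral_norm_le_of_partition_sums_le`). On an interval
with rational endpoints all these pieces have rational endpoints, so each sum is continuous in `c`
and the mass is lower semicontinuous. Hence smallness of the mass on short intervals, `EquiBounded`,
passes from the orbit to the hull (`EquiBounded.closure`). It makes translation jointly continuous
on the hull (`EquiBounded.continuousOn_translate`) and makes convergence of integrals uniform in the
endpoints and in the path (`EquiBounded.eventually_integral_sub_le`).

The moduli `θ_j` are chosen so that solutions of all equations in the hull are admissible test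
paths. To see this, a path is frozen at partition points. Constants always lie in `𝒦_j`, so the
bound by `θ_j` passes from the translates of `f` to the limit, and the Lipschitz bound of the single
limit function then reaches an arbitrary continuous path (`norm_integral_le_of_mem_hull`,
`IsSolution.mem_modulusClass`).

Continuous dependence compares a solution `x'` for `(c, x₀')` with the solution `x` for `(c₀, x₀)`
by splitting `c(x') - c₀(x)` into `(c - c₀)(x')` and `c₀(x') - c₀(x)`. The first part is small
because `x'` is a test path. The second is handled by Gronwall with the Lipschitz bound of `c₀`
alone, so no Lipschitz bound uniform in `c` is needed (`eventually_maximalSolution_sub_le`).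

Along a converging solution `x`, the second equation is linear with coefficients `G(t, x(t))` and
`k(t, x(t))`. These converge only in the sense of integrals over subintervals, but with bounded
mass. This suffices to pass to the limit against the continuous limit solution, and the mass bound
also makes the Gronwall constant uniform (`eventually_linear_sub_le`).

Independence of representatives is delicate for `G` and `k`, since the graph of a path is a null
set. Moving the graph by small generic vectors and using weak continuity settles it
(`IsWTC.ae_eq_along`). The cocycle identities come from uniqueness. -/

/-! ### Uniform partitions and the mass of an integrable function -/

section Partition

/-- The `k`-th point of the uniform partition of `[a, b]` into `n` intervals. -/
noncomputable def partitionPoint (a b : ℝ) (n k : ℕ) : ℝ := a + k * ((b - a) / n)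

@[simp] lemma partitionPoint_zero (a b : ℝ) (n : ℕ) : partitionPoint a b n 0 = a := by
  simp [partitionPoint]

lemma partitionPoint_last (a b : ℝ) {n : ℕ} (hn : 0 < n) : partitionPoint a b n n = b := by
  have : (n : ℝ) ≠ 0 := by positivity
  unfold partitionPoint
  field_simp
  ring

lemma partitionPoint_succ_sub (a b : ℝ) (n k : ℕ) :
    partitionPoint a b n (k + 1) - partitionPoint a b n k = (b - a) / n := by
  unfold partitionPoint
  push_cast
  ring

lemma partitionPoint_mono {a b : ℝ} (hab : a ≤ b) (n : ℕ) : Monotone (partitionPoint a b n) := by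
  refine monotone_nat_of_le_succ fun k => ?_
  have := partitionPoint_succ_sub a b n k
  have h0 : 0 ≤ (b - a) / n := div_nonneg (by linarith) (by positivity)
  linarith

lemma partitionPoint_mem {a b : ℝ} (hab : a ≤ b) {n k : ℕ} (hn : 0 < n) (hk : k ≤ n) :
    partitionPoint a b n k ∈ Icc a b := by
  constructor
  · simpa using partitionPoint_mono hab n (Nat.zero_le k)
  · simpa [partitionPoint_last a b hn] using partitionPoint_mono hab n hk

lemma partitionPoint_subset {a b : ℝ} (hab : a ≤ b) {n k : ℕ} (hk : k < n) :
    Icc (partitionPoint a b n k) (partitionPoint a b n (k + 1)) ⊆ Icc a b := by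
  have hn : 0 < n := by omega
  exact Icc_subset_Icc (partitionPoint_mem hab hn hk.le).1 (partitionPoint_mem hab hn hk).2

lemma partitionPoint_le_succ {a b : ℝ} (hab : a ≤ b) (n k : ℕ) :
    partitionPoint a b n k ≤ partitionPoint a b n (k + 1) :=
  partitionPoint_mono hab n (Nat.le_succ k)

lemma partitionPoint_ratCast (a b : ℚ) (n k : ℕ) :
    partitionPoint a b n k = ((a + k * ((b - a) / n) : ℚ) : ℝ) := by
  simp [partitionPoint]

lemma eventually_mesh_lt (a b : ℝ) {δ : ℝ} (hδ : 0 < δ) :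
    ∀ᶠ n : ℕ in atTop, 0 < n ∧ (b - a) / n < δ := by
  have h1 : Tendsto (fun n : ℕ => (b - a) / (n : ℝ)) atTop (𝓝 0) :=
    tendsto_const_div_atTop_nhds_zero_nat (b - a)
  filter_upwards [eventually_gt_atTop 0, h1.eventually (gt_mem_nhds hδ)] with n h h'
  exact ⟨h, h'⟩

lemma eventually_oscillation_le {E : Type*} [PseudoMetricSpace E] {a b : ℝ} (hab : a ≤ b)
    {y : ℝ → E} (hy : ContinuousOn y (Icc a b)) {ε : ℝ} (hε : 0 < ε) :
    ∀ᶠ n : ℕ in atTop, ∀ k < n, ∀ u ∈ Icc (partitionPoint a b n k) (partitionPoint a b n (k + 1)),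
      dist (y u) (y (partitionPoint a b n k)) ≤ ε := by
  have huc := isCompact_Icc.uniformContinuousOn_of_continuous hy
  obtain ⟨δ, hδ, h⟩ := Metric.uniformContinuousOn_iff.1 huc ε hε
  filter_upwards [eventually_mesh_lt a b hδ] with n hn k hk u hu
  refine (h u (partitionPoint_subset hab hk hu) _ (partitionPoint_mem hab hn.1 hk.le) ?_).le
  have := partitionPoint_succ_sub a b n k
  rw [Real.dist_eq, abs_lt]
  constructor <;> linarith [hu.1, hu.2, hn.2]

variable {V : Type*} [NormedAddCommGroup V]

lemma IntervalIntegrable.partition {A : ℝ → V} {a b : ℝ} (hab : a ≤ b)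
    (hA : IntervalIntegrable A volume a b) {n k : ℕ} (hk : k < n) :
    IntervalIntegrable A volume (partitionPoint a b n k) (partitionPoint a b n (k + 1)) := by
  refine hA.mono_set ?_
  rw [uIcc_of_le (partitionPoint_le_succ hab n k), uIcc_of_le hab]
  exact partitionPoint_subset hab hk

variable [NormedSpace ℝ V]

lemma sum_integral_partition {A : ℝ → V} {a b : ℝ} (hab : a ≤ b)
    (hA : IntervalIntegrable A volume a b) {n : ℕ} (hn : 0 < n) :
    ∑ k ∈ Finset.range n, ∫ t in (partitionPoint a b n k)..(partitionPoint a b n (k + 1)), A t =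
      ∫ t in a..b, A t := by
  rw [intervalIntegral.sum_integral_adjacent_intervals (a := partitionPoint a b n)
    (fun k hk => hA.partition hab hk), partitionPoint_zero, partitionPoint_last a b hn]

lemma sum_norm_integral_partition_le {A : ℝ → V} {a b : ℝ} (hab : a ≤ b)
    (hA : IntervalIntegrable A volume a b) {n : ℕ} (hn : 0 < n) :
    ∑ k ∈ Finset.range n,
      ‖∫ t in (partitionPoint a b n k)..(partitionPoint a b n (k + 1)), A t‖ ≤
      ∫ t in a..b, ‖A t‖ := by
  rw [← sum_integral_partition hab hA.norm hn]
  exact Finset.sum_le_sum fun k _ =>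
    intervalIntegral.norm_integral_le_integral_norm (partitionPoint_le_succ hab n k)

/-- The total mass of an integrable function is the supremum of the sums of the norms of its
integrals over the intervals of uniform partitions. -/
theorem integral_norm_le_of_partition_sums_le [CompleteSpace V] {A : ℝ → V} {a b C : ℝ}
    (hab : a ≤ b) (hA : IntervalIntegrable A volume a b)
    (h : ∀ n : ℕ, 0 < n → ∑ k ∈ Finset.range n,
      ‖∫ t in (partitionPoint a b n k)..(partitionPoint a b n (k + 1)), A t‖ ≤ C) :
    ∫ t in a..b, ‖A t‖ ≤ C := by
  refine le_of_forall_pos_le_add fun ε hε => ?_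
  have hAi : Integrable (indicator (Ioc a b) A) := by
    rw [integrable_indicator_iff measurableSet_Ioc]
    exact (intervalIntegrable_iff_integrableOn_Ioc_of_le hab).1 hA
  -- The losses add up to `ε`: `2η` for passing from `A` to `φ` and back, and `2η(b - a)` for the
  -- oscillation of `φ` on the pieces.
  set η : ℝ := ε / (2 * (b - a) + 2) with hη
  have hηpos : 0 < η := by
    have : 0 ≤ b - a := by linarith
    positivity
  -- For a continuous `φ` the claim is visible: where `φ` varies by at most `η`, the numbers `∫ |φ|`
  -- and `|∫ φ|` differ by at most `2η` times the length. Density in `L¹` reduces to this case.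
  obtain ⟨φ, -, hφ, hφc, hφi⟩ := hAi.exists_hasCompactSupport_integral_sub_le hηpos
  have hφI : ∀ c d : ℝ, IntervalIntegrable φ volume c d := fun c d => hφc.intervalIntegrable c d
  have hdist : ∫ t in a..b, ‖A t - φ t‖ ≤ η := by
    refine le_trans ?_ hφ
    rw [intervalIntegral.integral_of_le hab]
    calc ∫ t in Ioc a b, ‖A t - φ t‖ = ∫ t in Ioc a b, ‖indicator (Ioc a b) A t - φ t‖ := by
          refine setIntegral_congr_fun measurableSet_Ioc fun t ht => ?_
          simp [indicator_of_mem ht]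
      _ ≤ _ := setIntegral_le_integral (hAi.sub hφi).norm
          (Eventually.of_forall fun _ => norm_nonneg _)
  have hD : IntervalIntegrable (fun t => A t - φ t) volume a b := hA.sub (hφI a b)
  obtain ⟨n, hn, hosc⟩ := ((eventually_gt_atTop 0).and
    (eventually_oscillation_le hab hφc.continuousOn hηpos)).exists
  set p := partitionPoint a b n with hp
  have hpk : ∀ k, p k ≤ p (k + 1) := partitionPoint_le_succ hab n
  have hlen : ∀ k, p (k + 1) - p k = (b - a) / n := partitionPoint_succ_sub a b n
  have key : ∀ k ∈ Finset.range n, ∫ t in (p k)..(p (k + 1)), ‖φ t‖ ≤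
      ‖∫ t in (p k)..(p (k + 1)), A t‖ + ‖∫ t in (p k)..(p (k + 1)), (A t - φ t)‖ +
        2 * η * ((b - a) / n) := by
    intro k hk
    have hk' := Finset.mem_range.1 hk
    have hos := hosc k hk'
    have e1 : ∫ t in (p k)..(p (k + 1)), ‖φ t‖ ≤ (‖φ (p k)‖ + η) * ((b - a) / n) := by
      have : ∫ t in (p k)..(p (k + 1)), ‖φ t‖ ≤ ∫ t in (p k)..(p (k + 1)), (‖φ (p k)‖ + η) := by
        refine intervalIntegral.integral_mono_on (hpk k) (hφI _ _).norm (by simp) fun t ht => ?_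
        have := hos t ht
        rw [dist_eq_norm] at this
        calc ‖φ t‖ = ‖φ (p k) + (φ t - φ (p k))‖ := by congr 1; abel
          _ ≤ ‖φ (p k)‖ + η := (norm_add_le _ _).trans (by gcongr)
      refine this.trans_eq ?_
      rw [intervalIntegral.integral_const, smul_eq_mul, hlen, mul_comm]
    have e2 : ‖φ (p k)‖ * ((b - a) / n) ≤ ‖∫ t in (p k)..(p (k + 1)), φ t‖ + η * ((b - a) / n) := by
      have h1 : ∫ t in (p k)..(p (k + 1)), φ (p k) =
          (∫ t in (p k)..(p (k + 1)), φ t) - ∫ t in (p k)..(p (k + 1)), (φ t - φ (p k)) := by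
        rw [← intervalIntegral.integral_sub (hφI _ _) ((hφI _ _).sub (by simp))]
        simp
      have h2 : ‖∫ t in (p k)..(p (k + 1)), (φ t - φ (p k))‖ ≤ η * |p (k + 1) - p k| := by
        refine intervalIntegral.norm_integral_le_of_norm_le_const fun t ht => ?_
        rw [uIoc_of_le (hpk k)] at ht
        simpa [dist_eq_norm] using hos t (Ioc_subset_Icc_self ht)
      have h3 : ‖∫ t in (p k)..(p (k + 1)), φ (p k)‖ = ‖φ (p k)‖ * ((b - a) / n) := by
        rw [intervalIntegral.integral_const, norm_smul, hlen, mul_comm, Real.norm_of_nonneg]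
        exact div_nonneg (by linarith) (by positivity)
      rw [← h3, h1]
      refine (norm_sub_le _ _).trans ?_
      rw [hlen, abs_of_nonneg (div_nonneg (by linarith) (by positivity))] at h2
      gcongr
    have e3 : ‖∫ t in (p k)..(p (k + 1)), φ t‖ ≤ ‖∫ t in (p k)..(p (k + 1)), A t‖ +
        ‖∫ t in (p k)..(p (k + 1)), (A t - φ t)‖ := by
      have : ∫ t in (p k)..(p (k + 1)), φ t = (∫ t in (p k)..(p (k + 1)), A t) -
          ∫ t in (p k)..(p (k + 1)), (A t - φ t) := by
        rw [← intervalIntegral.integral_sub (hA.partition hab hk') (hD.partition hab hk')]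
        simp [hp]
      rw [this]
      exact norm_sub_le _ _
    linarith
  have hsum := Finset.sum_le_sum key
  rw [Finset.sum_add_distrib, Finset.sum_add_distrib, sum_integral_partition hab (hφI a b).norm hn]
    at hsum
  have s1 := h n hn
  have s2 := (sum_norm_integral_partition_le hab hD hn).trans hdist
  have s3 : ∑ _k ∈ Finset.range n, 2 * η * ((b - a) / n) = 2 * η * (b - a) := by
    have : (n : ℝ) ≠ 0 := by positivity
    simp only [Finset.sum_const, Finset.card_range, nsmul_eq_mul]
    field_simp
  have s4 : ∫ t in a..b, ‖A t‖ ≤ (∫ t in a..b, ‖φ t‖) + ∫ t in a..b, ‖A t - φ t‖ := by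
    rw [← intervalIntegral.integral_add (hφI a b).norm hD.norm]
    refine intervalIntegral.integral_mono_on hab hA.norm ((hφI a b).norm.add hD.norm) fun t _ => ?_
    calc ‖A t‖ = ‖φ t + (A t - φ t)‖ := by congr 1; abel
      _ ≤ _ := norm_add_le _ _
  have s5 : η * (2 * (b - a) + 2) = ε := by
    rw [hη]
    have : 0 ≤ b - a := by linarith
    field_simp
  rw [s3] at hsum
  linarith

end Partition

/-! ### Stability properties of the classes `𝒦_j` -/

section ModulusClass

variable {N : ℕ} {Θ : SuitableModuli} {a b : ℝ} {j : ℕ} {x : ℝ → Euc N}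

lemma modulusClass_mono_interval (hx : x ∈ modulusClass N Θ a b j) {c d : ℝ}
    (h : Icc c d ⊆ Icc a b) : x ∈ modulusClass N Θ c d j :=
  ⟨hx.1.mono h, hx.2.1.mono h Subset.rfl, fun s hs t ht => hx.2.2 s (h hs) t (h ht)⟩

/-- Constants are test paths whatever `Θ` is. This is what allows a path not yet known to lie in
`𝒦_j` to be frozen at partition points. -/
lemma const_mem_modulusClass (Θ : SuitableModuli) (a b : ℝ) {c : Euc N}
    (hc : c ∈ Metric.closedBall (0 : Euc N) j) : (fun _ => c) ∈ modulusClass N Θ a b j := by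
  refine ⟨continuousOn_const, fun _ _ => hc, fun s _ t _ => ?_⟩
  rw [sub_self, norm_zero, ← Θ.zero j]
  exact Θ.monotoneOn j (mem_Ici.2 le_rfl) (mem_Ici.2 (abs_nonneg _)) (abs_nonneg _)

/-- A translation in space leaves the increments alone and only enlarges the ball; `θ_j ≤ θ_{j+1}`
absorbs the change of index. -/
lemma add_const_mem_modulusClass (hx : x ∈ modulusClass N Θ a b j) {v : Euc N} (hv : ‖v‖ ≤ 1) :
    (fun t => x t + v) ∈ modulusClass N Θ a b (j + 1) := by
  refine ⟨hx.1.add continuousOn_const, fun t ht => ?_, fun s hs t ht => ?_⟩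
  · have := hx.2.1 ht
    rw [mem_closedBall_zero_iff] at this ⊢
    push_cast
    exact (norm_add_le _ _).trans (add_le_add this hv)
  · rw [add_sub_add_right_eq_sub]
    exact (hx.2.2 s hs t ht).trans (Θ.mono _ _ (Nat.le_succ j) _ (abs_nonneg _))

lemma modulusClass_mono_index (hx : x ∈ modulusClass N Θ a b j) {i : ℕ} (h : j ≤ i) :
    x ∈ modulusClass N Θ a b i :=
  ⟨hx.1, fun _ ht => Metric.closedBall_subset_closedBall (by exact_mod_cast h) (hx.2.1 ht),
    fun s hs t ht => (hx.2.2 s hs t ht).trans (Θ.mono _ _ h _ (abs_nonneg _))⟩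

lemma clampShift_add_right {u t : ℝ} (hu : u ∈ Icc a b) : clampShift a b t x (u + t) = x u := by
  simp [clampShift, hu.1, hu.2]

lemma clampShift_zero_apply {u : ℝ} (hu : u ∈ Icc a b) : clampShift a b 0 x u = x u := by
  simpa using clampShift_add_right (x := x) (t := 0) hu

lemma continuous_clampShift (hab : a ≤ b) (hx : ContinuousOn x (Icc a b)) (t : ℝ) :
    Continuous (clampShift a b t x) :=
  hx.comp_continuous (by fun_prop) fun u => clamp_mem hab (u - t)

end ModulusClass

/-! ### Almost everywhere equal functions along paths -/

section AgreeAlmostEverywhere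

variable {N : ℕ} {V : Type*} [NormedAddCommGroup V] [MeasurableSpace V]

lemma IsLC.ae_continuous {f : ℝ → Euc N → V} (hf : IsLC f) : ∀ᵐ t : ℝ, Continuous (f t) := by
  have h : ∀ n : ℕ, ∀ᵐ t : ℝ, ContinuousOn (f t) (Metric.closedBall 0 (n : ℝ)) := fun n => by
    obtain ⟨l, -, hl⟩ := hf.exists_lBound _ (isCompact_closedBall 0 (n : ℝ))
    filter_upwards [hl] with t ht
    refine LipschitzOnWith.continuousOn (K := Real.toNNReal (l t)) ?_
    refine LipschitzOnWith.of_dist_le_mul fun x hx y hy => ?_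
    rw [dist_eq_norm, dist_eq_norm]
    refine (ht x hx y hy).trans ?_
    gcongr
    exact Real.le_coe_toNNReal _
  filter_upwards [ae_all_iff.2 h] with t ht
  refine continuous_iff_continuousAt.2 fun x => ?_
  obtain ⟨n, hn⟩ := exists_nat_gt ‖x‖
  exact (ht n).continuousAt (Metric.closedBall_mem_nhds_of_mem (by simpa using hn))

/-- Lipschitz Carathéodory functions that agree almost everywhere agree, for almost every `t`,
at every `x`. -/
lemma IsLC.ae_eq_of_ae_eq {f g : ℝ → Euc N → V} (hf : IsLC f) (hg : IsLC g)
    (h : ∀ᵐ p : ℝ × Euc N, f p.1 p.2 = g p.1 p.2) : ∀ᵐ t : ℝ, f t = g t := by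
  have h' : ∀ᵐ t : ℝ, ∀ᵐ x : Euc N, f t x = g t x := Measure.ae_ae_of_ae_prod h
  filter_upwards [h', hf.ae_continuous, hg.ae_continuous] with t ht h1 h2
  exact Continuous.ae_eq_iff_eq volume h1 h2 |>.1 ht

variable [NormedSpace ℝ V]

/-- The graph of `x` is a null set, so almost everywhere equality says nothing about it directly.
The shear `(t, v) ↦ (t, x(t) + v)` preserves Lebesgue measure, so by Fubini `f` and `g` agree along
`x + v` for almost every `v`. Letting such `v` tend to `0` inside `𝒦_{j+1}` and using weak
continuity of both functions gives the equality along `x`. -/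
lemma IsWTC.integral_eq_of_ae_eq_rat {Θ : SuitableModuli} {f g : ℝ → Euc N → V} (hf : IsWTC Θ f)
    (hg : IsWTC Θ g) (h : ∀ᵐ p : ℝ × Euc N, f p.1 p.2 = g p.1 p.2) {j : ℕ} {a b : ℚ} (hab : a ≤ b)
    {x : ℝ → Euc N} (hx : x ∈ modulusClass N Θ a b j) :
    ∫ t in (a : ℝ)..b, f t (x t) = ∫ t in (a : ℝ)..b, g t (x t) := by
  have hab' : (a : ℝ) ≤ b := by exact_mod_cast hab
  -- The constant extension makes the path continuous on all of `ℝ`, so that the shear is defined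
  -- and measurable everywhere.
  set y := clampShift (a : ℝ) b 0 x with hy
  have hyc : Continuous y := continuous_clampShift hab' hx.1 0
  have hmp : MeasurePreserving (fun p : ℝ × Euc N => (p.1, y p.1 + p.2))
      (volume : Measure (ℝ × Euc N)) (volume : Measure (ℝ × Euc N)) := by
    refine (MeasurePreserving.id volume).skew_product (g := fun t v => y t + v) ?_ ?_
    · exact (by fun_prop : Continuous fun p : ℝ × Euc N => y p.1 + p.2).measurable
    · exact Eventually.of_forall fun t => map_add_left_eq_self volume (y t)
  have h1 : ∀ᵐ p : ℝ × Euc N, f p.1 (y p.1 + p.2) = g p.1 (y p.1 + p.2) :=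
    hmp.quasiMeasurePreserving.ae h
  have h2 : ∀ᵐ p : Euc N × ℝ, f p.2 (y p.2 + p.1) = g p.2 (y p.2 + p.1) :=
    (Measure.measurePreserving_swap (μ := (volume : Measure (Euc N)))
      (ν := (volume : Measure ℝ))).quasiMeasurePreserving.ae h1
  have h3 : ∀ᵐ v : Euc N, ∀ᵐ t : ℝ, f t (y t + v) = g t (y t + v) := Measure.ae_ae_of_ae_prod h2
  -- A set of full measure is dense, so it contains arbitrarily small vectors.
  have hd : Dense {v : Euc N | ∀ᵐ t : ℝ, f t (y t + v) = g t (y t + v)} :=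
    Measure.dense_of_ae h3
  have hv : ∀ n : ℕ, ∃ v : Euc N, (∀ᵐ t : ℝ, f t (y t + v) = g t (y t + v)) ∧
      ‖v‖ < 1 / ((n : ℝ) + 1) := fun n => by
    obtain ⟨v, hv, hv'⟩ := hd.exists_dist_lt 0 (Nat.one_div_pos_of_nat (n := n) (α := ℝ))
    exact ⟨v, hv, by simpa using hv'⟩
  choose v hv hv' using hv
  have hv1 : ∀ n, ‖v n‖ ≤ 1 := fun n => (hv' n).le.trans
    (by rw [div_le_one (by positivity)]; linarith [(Nat.cast_nonneg n : (0 : ℝ) ≤ n)])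
  have hvlim : Tendsto v atTop (𝓝 0) := by
    rw [tendsto_zero_iff_norm_tendsto_zero]
    exact squeeze_zero (fun _ => norm_nonneg _) (fun n => (hv' n).le)
      tendsto_one_div_add_atTop_nhds_zero_nat
  have hyK : y ∈ modulusClass N Θ a b j := clampShift_mem hab' 0 hx a b
  have hunif : TendstoUniformlyOn (fun n t => y t + v n) y atTop (Icc (a : ℝ) b) := by
    rw [Metric.tendstoUniformlyOn_iff]
    intro ε hε
    filter_upwards [Metric.tendsto_nhds.1 hvlim ε hε] with n hn t _
    simpa [dist_eq_norm] using hn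
  have lf := hf.tendsto_integral (j + 1) a b hab _ _
    (fun n => add_const_mem_modulusClass hyK (hv1 n))
    (modulusClass_mono_index hyK (Nat.le_succ j)) hunif
  have lg := hg.tendsto_integral (j + 1) a b hab _ _
    (fun n => add_const_mem_modulusClass hyK (hv1 n))
    (modulusClass_mono_index hyK (Nat.le_succ j)) hunif
  have heq : ∀ n, ∫ t in (a : ℝ)..b, f t (y t + v n) = ∫ t in (a : ℝ)..b, g t (y t + v n) :=
    fun n => intervalIntegral.integral_congr_ae ((hv n).mono fun t ht _ => ht)
  simp only [heq] at lf
  have := tendsto_nhds_unique lf lg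
  have hxy : ∀ F : ℝ → Euc N → V, ∫ t in (a : ℝ)..b, F t (y t) = ∫ t in (a : ℝ)..b, F t (x t) :=
    fun F => intervalIntegral.integral_congr fun t ht => by
      rw [uIcc_of_le hab'] at ht
      simp only [hy, clampShift_zero_apply ht]
  rwa [hxy, hxy] at this

end AgreeAlmostEverywhere

/-! ### Integrals of Carathéodory functions along paths -/

section Caratheodory

variable {N : ℕ} {V : Type*} [NormedAddCommGroup V] [MeasurableSpace V] [BorelSpace V]
  [SecondCountableTopology V]

lemma IsCaratheodory.intervalIntegrable_continuousOn {f : ℝ → Euc N → V} (hf : IsCaratheodory f)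
    {x : ℝ → Euc N} {a b : ℝ} (hx : ContinuousOn x (uIcc a b)) :
    IntervalIntegrable (fun t => f t (x t)) volume a b := by
  wlog hab : a ≤ b generalizing a b
  · exact (this (by rwa [uIcc_comm]) (le_of_not_ge hab)).symm
  rw [uIcc_of_le hab] at hx
  obtain ⟨C, hC⟩ := isCompact_Icc.exists_bound_of_continuousOn hx
  obtain ⟨j, hj⟩ := exists_nat_ge C
  obtain ⟨m, hm⟩ := hf.exists_mBound _ (isCompact_closedBall 0 (j : ℝ))
  exact hf.intervalIntegrable hm hab hx fun t ht =>
    mem_closedBall_zero_iff.2 ((hC t ht).trans hj)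

lemma IsCaratheodory.intervalIntegrable_modulusClass {f : ℝ → Euc N → V} (hf : IsCaratheodory f)
    {Θ : SuitableModuli} {x : ℝ → Euc N} {a b : ℝ} (hab : a ≤ b) {j : ℕ}
    (hx : x ∈ modulusClass N Θ a b j) :
    IntervalIntegrable (fun t => f t (x t)) volume a b :=
  hf.intervalIntegrable_continuousOn (by rw [uIcc_of_le hab]; exact hx.1)

variable [NormedSpace ℝ V]

/-- The error is kept as the mass along the path itself, not as the integral of an `m`-bound: only
the mass is controlled uniformly on a hull. -/
lemma norm_integral_translate_sub_clampShift_le {Θ : SuitableModuli} {f : ℝ → Euc N → V}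
    (hf : IsCaratheodory f) {j : ℕ} {a b t p q : ℝ} (hab : a ≤ b)
    (hp : p ≤ a + t) (hq : b + t ≤ q) {x : ℝ → Euc N} (hx : x ∈ modulusClass N Θ a b j) :
    ‖(∫ s in a..b, timeTranslate t f s (x s)) - ∫ u in p..q, f u (clampShift a b t x u)‖ ≤
      (∫ u in p..(a + t), ‖f u (clampShift a b t x u)‖) +
        ∫ u in (b + t)..q, ‖f u (clampShift a b t x u)‖ := by
  have hc := continuous_clampShift hab hx.1 t
  have hii : ∀ c d : ℝ,
      IntervalIntegrable (fun u => f u (clampShift a b t x u)) volume c d := fun c d =>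
    hf.intervalIntegrable_continuousOn hc.continuousOn
  have e1 : (∫ s in a..b, timeTranslate t f s (x s)) =
      ∫ u in (a + t)..(b + t), f u (clampShift a b t x u) := by
    rw [← intervalIntegral.integral_comp_add_right (fun u => f u (clampShift a b t x u)) t]
    refine intervalIntegral.integral_congr fun s hs => ?_
    rw [uIcc_of_le hab] at hs
    simp only [timeTranslate, clampShift_add_right hs]
  have e2 : (∫ u in p..q, f u (clampShift a b t x u)) =
      (∫ u in p..(a + t), f u (clampShift a b t x u)) +
      (∫ u in (a + t)..(b + t), f u (clampShift a b t x u)) +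
      ∫ u in (b + t)..q, f u (clampShift a b t x u) := by
    rw [intervalIntegral.integral_add_adjacent_intervals (hii _ _) (hii _ _),
      intervalIntegral.integral_add_adjacent_intervals (hii _ _) (hii _ _)]
  rw [e1, e2]
  have : ∀ A B C : V, ‖B - (A + B + C)‖ ≤ ‖A‖ + ‖C‖ := fun A B C => by
    have : B - (A + B + C) = -(A + C) := by abel
    rw [this, norm_neg]
    exact norm_add_le _ _
  exact (this _ _ _).trans (add_le_add (intervalIntegral.norm_integral_le_integral_norm hp)
    (intervalIntegral.norm_integral_le_integral_norm hq))

lemma norm_integral_sub_clamp_le {Θ : SuitableModuli} {f : ℝ → Euc N → V}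
    (hf : IsCaratheodory f) {j : ℕ} {a b p q : ℝ} (hab : a ≤ b)
    (hp : p ≤ a) (hq : b ≤ q) {x : ℝ → Euc N} (hx : x ∈ modulusClass N Θ a b j) :
    ‖(∫ s in a..b, f s (x s)) - ∫ u in p..q, f u (clampShift a b 0 x u)‖ ≤
      (∫ u in p..a, ‖f u (clampShift a b 0 x u)‖) +
        ∫ u in b..q, ‖f u (clampShift a b 0 x u)‖ := by
  have := norm_integral_translate_sub_clampShift_le hf (t := 0) (p := p) (q := q) hab
    (by simpa using hp) (by simpa using hq) hx
  simpa [timeTranslate] using this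

/-- Lipschitz Carathéodory functions are weak `Θ`-Carathéodory. -/
lemma IsLC.isWTC {f : ℝ → Euc N → V} (hf : IsLC f) (Θ : SuitableModuli) : IsWTC Θ f where
  toIsCaratheodory := hf.toIsCaratheodory
  tendsto_integral j a b hab x y hx hy hxy := by
    have hab' : (a : ℝ) ≤ b := by exact_mod_cast hab
    obtain ⟨m, hm⟩ := hf.exists_mBound _ (isCompact_closedBall 0 (j : ℝ))
    obtain ⟨l, -, hl⟩ := hf.exists_lBound _ (isCompact_closedBall 0 (j : ℝ))
    refine intervalIntegral.tendsto_integral_filter_of_dominated_convergence m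
      (Eventually.of_forall fun n => ?_) (Eventually.of_forall fun n => ?_) (hm.1 a b) ?_
    · exact (hf.intervalIntegrable_modulusClass hab' (hx n)).def'.aestronglyMeasurable
    · filter_upwards [hm.2] with t ht hmem
      rw [uIoc_of_le hab'] at hmem
      exact ht _ ((hx n).2.1 (Ioc_subset_Icc_self hmem))
    · filter_upwards [hl] with t ht hmem
      rw [uIoc_of_le hab'] at hmem
      have hmem' := Ioc_subset_Icc_self hmem
      have h1 := (hxy.tendsto_at hmem')
      rw [tendsto_iff_norm_sub_tendsto_zero] at h1 ⊢
      refine squeeze_zero (fun n => norm_nonneg _)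
        (fun n => ht _ ((hx n).2.1 hmem') _ (hy.2.1 hmem')) ?_
      simpa using h1.const_mul (l t)

/-- Weak `Θ`-Carathéodory functions that agree almost everywhere agree almost everywhere along
the functions of the classes `𝒦_j`. -/
lemma IsWTC.ae_eq_along [CompleteSpace V] {Θ : SuitableModuli} {f g : ℝ → Euc N → V}
    (hf : IsWTC Θ f) (hg : IsWTC Θ g) (h : ∀ᵐ p : ℝ × Euc N, f p.1 p.2 = g p.1 p.2) {j : ℕ}
    {a b : ℝ} (hab : a ≤ b) {x : ℝ → Euc N} (hx : x ∈ modulusClass N Θ a b j) :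
    ∀ᵐ t : ℝ, t ∈ Icc a b → f t (x t) = g t (x t) := by
  obtain ⟨p, hp⟩ := exists_rat_lt a
  obtain ⟨q, hq⟩ := exists_rat_gt b
  have hpq : (p : ℝ) ≤ q := by linarith
  set y := clampShift a b 0 x
  have hy : ∀ c d, y ∈ modulusClass N Θ c d j := clampShift_mem hab 0 hx
  have hfi := hf.intervalIntegrable_modulusClass hpq (hy p q)
  have hgi := hg.intervalIntegrable_modulusClass hpq (hy p q)
  -- Partitions of a rational interval have rational endpoints, so `f` and `g` have equal integrals
  -- on every piece. All partition sums of `f - g` vanish, and with them its mass.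
  have h0 : ∫ t in (p : ℝ)..q, ‖f t (y t) - g t (y t)‖ ≤ 0 := by
    refine integral_norm_le_of_partition_sums_le hpq (hfi.sub hgi) fun n hn => ?_
    refine (Finset.sum_eq_zero fun k hk => ?_).le
    have hk := Finset.mem_range.1 hk
    rw [intervalIntegral.integral_sub (hfi.partition hpq hk) (hgi.partition hpq hk), norm_eq_zero,
      sub_eq_zero, partitionPoint_ratCast, partitionPoint_ratCast]
    refine hf.integral_eq_of_ae_eq_rat hg h ?_ (hy _ _)
    have := partitionPoint_le_succ hpq n k
    rw [partitionPoint_ratCast, partitionPoint_ratCast] at this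
    exact_mod_cast this
  have h1 : ∫ t in (p : ℝ)..q, ‖f t (y t) - g t (y t)‖ = 0 :=
    le_antisymm h0 (intervalIntegral.integral_nonneg hpq fun _ _ => norm_nonneg _)
  rw [intervalIntegral.integral_eq_zero_iff_of_le_of_nonneg_ae hpq
    (Eventually.of_forall fun _ => norm_nonneg _) (hfi.sub hgi).norm] at h1
  rw [EventuallyEq, ae_restrict_iff' measurableSet_Ioc] at h1
  filter_upwards [h1] with t ht hmem
  have := ht ⟨by linarith [hmem.1], by linarith [hmem.2]⟩
  simp only [Pi.zero_apply, norm_eq_zero, sub_eq_zero] at this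
  rwa [show y t = x t from clampShift_zero_apply hmem] at this

lemma IsWTC.integral_eq_of_ae_eq [CompleteSpace V] {Θ : SuitableModuli} {f g : ℝ → Euc N → V}
    (hf : IsWTC Θ f) (hg : IsWTC Θ g) (h : ∀ᵐ p : ℝ × Euc N, f p.1 p.2 = g p.1 p.2) {j : ℕ}
    {a b : ℝ} (hab : a ≤ b) {x : ℝ → Euc N} (hx : x ∈ modulusClass N Θ a b j) :
    ∫ t in a..b, f t (x t) = ∫ t in a..b, g t (x t) := by
  refine intervalIntegral.integral_congr_ae ?_
  filter_upwards [hf.ae_eq_along hg h hab hx] with t ht hmem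
  rw [uIoc_of_le hab] at hmem
  exact ht (Ioc_subset_Icc_self hmem)

end Caratheodory

/-! ### Compactness of `𝒦_j^I` and uniform continuity of the integrals -/

section Compactness

variable {N : ℕ} {V : Type*} [NormedAddCommGroup V] [NormedSpace ℝ V] [MeasurableSpace V]

lemma SuitableModuli.exists_le (Θ : SuitableModuli) (j : ℕ) {ε : ℝ} (hε : 0 < ε) :
    ∃ δ > 0, ∀ s, 0 ≤ s → s < δ → Θ.toFun j s ≤ ε := by
  have h := Θ.continuousOn j 0 (mem_Ici.2 le_rfl)
  rw [Metric.continuousWithinAt_iff] at h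
  obtain ⟨δ, hδ, h⟩ := h ε hε
  refine ⟨δ, hδ, fun s hs hsδ => ?_⟩
  have := h (mem_Ici.2 hs) (by rwa [Real.dist_eq, sub_zero, abs_of_nonneg hs])
  rw [Θ.zero, Real.dist_eq, sub_zero] at this
  exact (le_abs_self _).trans this.le

/-- Sequential compactness of `𝒦_j^I` for uniform convergence. -/
lemma exists_subseq_tendstoUniformlyOn {Θ : SuitableModuli} {a b : ℝ} (hab : a ≤ b) {j : ℕ}
    {x : ℕ → ℝ → Euc N} (hx : ∀ n, x n ∈ modulusClass N Θ a b j) :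
    ∃ (φ : ℕ → ℕ) (y : ℝ → Euc N), StrictMono φ ∧ y ∈ modulusClass N Θ a b j ∧
      TendstoUniformlyOn (fun n => x (φ n)) y atTop (Icc a b) := by
  let z : ℕ → BoundedContinuousFunction (Icc a b) (Euc N) := fun n =>
    BoundedContinuousFunction.mkOfCompact ⟨fun t => x n t,
      continuousOn_iff_continuous_domRestrict.1 (hx n).1⟩
  have hz : ∀ n (t : Icc a b), z n t = x n t := fun n t => rfl
  have hcomp : IsCompact (closure (range z)) := by
    refine BoundedContinuousFunction.arzela_ascoli (Metric.closedBall (0 : Euc N) j)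
      (isCompact_closedBall _ _) _ ?_ ?_
    · rintro _ t ⟨n, rfl⟩
      exact (hx n).2.1 t.2
    · refine Metric.equicontinuous_of_continuity_modulus (fun r => Θ.toFun j |r|) ?_ _ ?_
      · rw [Metric.tendsto_nhds]
        intro ε hε
        obtain ⟨δ, hδ, h⟩ := Θ.exists_le j (half_pos hε)
        filter_upwards [Metric.ball_mem_nhds (0 : ℝ) hδ] with r hr
        rw [Metric.mem_ball, dist_zero_right, Real.norm_eq_abs] at hr
        have h0 : 0 ≤ Θ.toFun j |r| := by
          rw [← Θ.zero j]
          exact Θ.monotoneOn j (mem_Ici.2 le_rfl) (mem_Ici.2 (abs_nonneg _)) (abs_nonneg _)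
        rw [dist_zero_right, Real.norm_of_nonneg h0]
        linarith [h _ (abs_nonneg r) hr]
      · rintro s t ⟨_, n, rfl⟩
        rw [dist_eq_norm, abs_of_nonneg dist_nonneg, Subtype.dist_eq, Real.dist_eq]
        exact (hx n).2.2 s s.2 t t.2
  obtain ⟨ψ, -, φ, hφ, hlim⟩ := hcomp.tendsto_subseq (fun n => subset_closure (mem_range_self n))
  have hpt : ∀ t : Icc a b, Tendsto (fun n => x (φ n) t) atTop (𝓝 (ψ t)) := fun t =>
    ((continuous_eval_const t).tendsto ψ).comp hlim
  refine ⟨φ, fun t => ψ (projIcc a b hab t), hφ, ⟨?_, ?_, ?_⟩, ?_⟩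
  · exact (ψ.continuous.comp continuous_projIcc).continuousOn
  · intro t ht
    exact Metric.isClosed_closedBall.mem_of_tendsto (hpt _)
      (Eventually.of_forall fun n => (hx _).2.1 (projIcc a b hab t).2)
  · intro s hs t ht
    simp only [projIcc_of_mem hab hs, projIcc_of_mem hab ht]
    exact le_of_tendsto ((hpt ⟨s, hs⟩).sub (hpt ⟨t, ht⟩)).norm
      (Eventually.of_forall fun n => (hx _).2.2 s hs t ht)
  · rw [Metric.tendstoUniformlyOn_iff]
    intro ε hε
    filter_upwards [Metric.tendsto_nhds.1 hlim ε hε] with n hn t ht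
    rw [projIcc_of_mem hab ht, dist_comm]
    exact (BoundedContinuousFunction.dist_coe_le_dist (f := z (φ n)) (g := ψ) ⟨t, ht⟩).trans_lt hn

/-- Sequential continuity on a compact set is uniform: bad pairs at distance `1/(n+1)` would have
subsequences with a common limit in `𝒦_j^I`, and their integrals would have the same limit. -/
lemma IsWTC.exists_integral_sub_le_rat {Θ : SuitableModuli} {f : ℝ → Euc N → V} (hf : IsWTC Θ f)
    (j : ℕ) {a b : ℚ} (hab : a ≤ b) {ε : ℝ} (hε : 0 < ε) :
    ∃ η > 0, ∀ x ∈ modulusClass N Θ a b j, ∀ y ∈ modulusClass N Θ a b j,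
      (∀ t ∈ Icc (a : ℝ) b, ‖x t - y t‖ ≤ η) →
      ‖(∫ t in (a : ℝ)..b, f t (x t)) - ∫ t in (a : ℝ)..b, f t (y t)‖ ≤ ε := by
  by_contra! hcon
  have hab' : (a : ℝ) ≤ b := by exact_mod_cast hab
  choose x hx y hy hxy hbig using fun n : ℕ =>
    hcon (1 / ((n : ℝ) + 1)) (Nat.one_div_pos_of_nat (n := n))
  obtain ⟨φ, z, hφ, hz, hlim⟩ := exists_subseq_tendstoUniformlyOn hab' hx
  have hlim' : TendstoUniformlyOn (fun n => y (φ n)) z atTop (Icc (a : ℝ) b) := by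
    rw [Metric.tendstoUniformlyOn_iff] at hlim ⊢
    intro δ hδ
    have h1 : Tendsto (fun n : ℕ => 1 / ((φ n : ℝ) + 1)) atTop (𝓝 0) :=
      tendsto_one_div_add_atTop_nhds_zero_nat.comp hφ.tendsto_atTop
    filter_upwards [hlim (δ / 2) (by positivity), h1.eventually (gt_mem_nhds (half_pos hδ))]
      with n h2 h3 t ht
    have h4 := hxy (φ n) t ht
    rw [← dist_eq_norm] at h4
    linarith [dist_triangle (z t) (x (φ n) t) (y (φ n) t), h2 t ht]
  have l1 := hf.tendsto_integral j a b hab _ _ (fun n => hx (φ n)) hz hlim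
  have l2 := hf.tendsto_integral j a b hab _ _ (fun n => hy (φ n)) hz hlim'
  have l3 := (l1.sub l2).norm
  rw [sub_self, norm_zero] at l3
  have := ge_of_tendsto l3 (Eventually.of_forall fun n => (hbig (φ n)).le)
  linarith

/-- Uniform continuity on `𝒦_j^I` of `x ↦ ∫_I f(t, x(t)) dt`. -/
lemma IsWTC.exists_integral_sub_le [BorelSpace V] [SecondCountableTopology V]
    {Θ : SuitableModuli} {f : ℝ → Euc N → V} (hf : IsWTC Θ f)
    (j : ℕ) {a b : ℝ} (hab : a ≤ b) {ε : ℝ} (hε : 0 < ε) :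
    ∃ η > 0, ∀ x ∈ modulusClass N Θ a b j, ∀ y ∈ modulusClass N Θ a b j,
      (∀ t ∈ Icc a b, ‖x t - y t‖ ≤ η) →
      ‖(∫ t in a..b, f t (x t)) - ∫ t in a..b, f t (y t)‖ ≤ ε := by
  obtain ⟨m, hm⟩ := hf.exists_mBound _ (isCompact_closedBall 0 (j : ℝ))
  have hc : ∀ c : ℝ, Continuous fun p : ℝ => ∫ u in c..p, m u :=
    fun c => intervalIntegral.continuous_primitive hm.1 _
  -- Enlarging `[a, b]` to a rational interval costs `ε/8` at each end, hence `ε/4` for each of the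
  -- two paths; the other `ε/2` goes to the rational interval.
  obtain ⟨δ₁, hδ₁, h₁⟩ := Metric.continuous_iff.1 (hc a) a (ε / 8) (by positivity)
  obtain ⟨δ₂, hδ₂, h₂⟩ := Metric.continuous_iff.1 (hc b) b (ε / 8) (by positivity)
  obtain ⟨p, hp, hp'⟩ := exists_rat_btwn (show a - δ₁ < a by linarith)
  obtain ⟨q, hq, hq'⟩ := exists_rat_btwn (show b < b + δ₂ by linarith)
  have b₁ : ∫ u in (p : ℝ)..a, m u < ε / 8 := by
    have := h₁ p (by rw [Real.dist_eq, abs_lt]; constructor <;> linarith)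
    rw [Real.dist_eq, intervalIntegral.integral_same, sub_zero, intervalIntegral.integral_symm,
      abs_neg] at this
    exact (le_abs_self _).trans_lt this
  have b₂ : ∫ u in b..(q : ℝ), m u < ε / 8 := by
    have := h₂ q (by rw [Real.dist_eq, abs_lt]; constructor <;> linarith)
    rw [Real.dist_eq, intervalIntegral.integral_same, sub_zero] at this
    exact (le_abs_self _).trans_lt this
  have hpq : p ≤ q := by
    have : (p : ℝ) ≤ q := by linarith
    exact_mod_cast this
  obtain ⟨η, hη, h⟩ := hf.exists_integral_sub_le_rat j hpq (half_pos hε)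
  refine ⟨η, hη, fun x hx y hy hxy => ?_⟩
  have hb : ∀ x ∈ modulusClass N Θ a b j,
      ‖(∫ t in a..b, f t (x t)) - ∫ t in (p : ℝ)..q, f t (clampShift a b 0 x t)‖ ≤ ε / 4 := by
    intro x hx
    have := norm_integral_sub_clampShift_le hf.toIsCaratheodory hm (t := 0) (p := p) (q := q) hab
      (by simpa using hp'.le) (by simpa using hq.le) hx
    simp only [timeTranslate, add_zero] at this
    linarith
  have h3 := h _ (clampShift_mem hab 0 hx p q) _ (clampShift_mem hab 0 hy p q)
    fun t _ => hxy _ (clamp_mem hab _)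
  have : ∀ A B C D : V, ‖A - B‖ ≤ ‖A - C‖ + ‖C - D‖ + ‖B - D‖ := fun A B C D => by
    have : A - B = (A - C) + (C - D) - (B - D) := by abel
    rw [this]
    exact (norm_sub_le _ _).trans (by gcongr; exact norm_add_le _ _)
  refine (this _ _ _ _).trans ((add_le_add (add_le_add (hb x hx) h3) (hb y hy)).trans ?_)
  linarith

end Compactness

/-! ### Representatives and translation of classes -/

section Representatives

variable {N : ℕ} {V : Type*} {Θ : SuitableModuli} {P : (ℝ → Euc N → V) → Prop}

/-- A representative of a class. -/
noncomputable def CSpace.rep (c : CSpace Θ P) : ℝ → Euc N → V :=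
  (Quotient.out (s := CFun.instSetoid Θ P) c).toFun

lemma CSpace.rep_prop (c : CSpace Θ P) : P c.rep :=
  (Quotient.out (s := CFun.instSetoid Θ P) c).prop

lemma CSpace.mk_rep (c : CSpace Θ P) : CSpace.mk Θ c.rep c.rep_prop = c :=
  Quotient.out_eq (s := CFun.instSetoid Θ P) c

lemma CSpace.represents_rep (c : CSpace Θ P) : CSpace.Represents c.rep c := ⟨c.rep_prop, c.mk_rep⟩

lemma CSpace.mk_eq_iff {f g : ℝ → Euc N → V} {hf : P f} {hg : P g} :
    CSpace.mk Θ f hf = CSpace.mk Θ g hg ↔ ∀ᵐ p : ℝ × Euc N, f p.1 p.2 = g p.1 p.2 :=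
  Quotient.eq (r := CFun.instSetoid Θ P)

lemma CSpace.Represents.ae_eq {f g : ℝ → Euc N → V} {c : CSpace Θ P}
    (hf : CSpace.Represents f c) (hg : CSpace.Represents g c) :
    ∀ᵐ p : ℝ × Euc N, f p.1 p.2 = g p.1 p.2 := by
  obtain ⟨hf, rfl⟩ := hf
  obtain ⟨hg, h⟩ := hg
  exact CSpace.mk_eq_iff.1 h.symm

lemma CSpace.translate_mk [hP : TranslationStable P] (t : ℝ) {f : ℝ → Euc N → V} (hf : P f) :
    CSpace.translate t (CSpace.mk Θ f hf) =
      CSpace.mk Θ (timeTranslate t f) (hP.timeTranslate t f hf) := rfl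

lemma CSpace.Represents.translate [hP : TranslationStable P] {f : ℝ → Euc N → V} {c : CSpace Θ P}
    (hf : CSpace.Represents f c) (t : ℝ) :
    CSpace.Represents (timeTranslate t f) (CSpace.translate t c) := by
  obtain ⟨hf, rfl⟩ := hf
  exact ⟨hP.timeTranslate t f hf, rfl⟩

lemma CSpace.translate_zero [TranslationStable P] (c : CSpace Θ P) : CSpace.translate 0 c = c := by
  obtain ⟨f, hf, rfl⟩ : ∃ f, CSpace.Represents f c := ⟨_, c.represents_rep⟩
  rw [CSpace.translate_mk, CSpace.mk_eq_iff]
  simp [timeTranslate]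

lemma CSpace.translate_add [TranslationStable P] (s t : ℝ) (c : CSpace Θ P) :
    CSpace.translate (s + t) c = CSpace.translate s (CSpace.translate t c) := by
  obtain ⟨f, hf, rfl⟩ : ∃ f, CSpace.Represents f c := ⟨_, c.represents_rep⟩
  rw [CSpace.translate_mk, CSpace.translate_mk, CSpace.translate_mk, CSpace.mk_eq_iff]
  simp [timeTranslate, add_assoc]

end Representatives

/-! ### Convergence in `σ_Θ` -/

section Topology

/-- The members of `P` are weak `Θ`-Carathéodory functions. -/
class WeakCaratheodoryClass {N : ℕ} {V : Type*} [NormedAddCommGroup V] [NormedSpace ℝ V]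
    [MeasurableSpace V] (Θ : SuitableModuli) (P : (ℝ → Euc N → V) → Prop) : Prop where
  isWTC : ∀ f, P f → IsWTC Θ f

variable {N : ℕ} {V : Type*} [NormedAddCommGroup V] [NormedSpace ℝ V] [MeasurableSpace V]
  {Θ : SuitableModuli}

instance : WeakCaratheodoryClass Θ (IsWTC Θ : (ℝ → Euc N → V) → Prop) := ⟨fun _ h => h⟩

instance [BorelSpace V] [SecondCountableTopology V] :
    WeakCaratheodoryClass Θ (IsLC : (ℝ → Euc N → V) → Prop) := ⟨fun _ h => h.isWTC Θ⟩

variable {P : (ℝ → Euc N → V) → Prop}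

lemma CFun.isWTC [hP : WeakCaratheodoryClass Θ P] (f : CFun Θ P) : IsWTC Θ f.toFun :=
  hP.isWTC _ f.prop

variable [BorelSpace V] [SecondCountableTopology V]

lemma pSeminorm_sub {f g : ℝ → Euc N → V} (hf : IsWTC Θ f) (hg : IsWTC Θ g) {a b : ℚ}
    (hab : a ≤ b) (j : ℕ) : pSeminorm Θ a b j (f - g) =
      ⨆ x ∈ modulusClass N Θ a b j,
        ‖(∫ t in (a : ℝ)..b, f t (x t)) - ∫ t in (a : ℝ)..b, g t (x t)‖ₑ := by
  have hab' : (a : ℝ) ≤ b := by exact_mod_cast hab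
  refine iSup_congr fun x => iSup_congr fun hx => ?_
  rw [← intervalIntegral.integral_sub (hf.intervalIntegrable_modulusClass hab' hx)
    (hg.intervalIntegrable_modulusClass hab' hx)]
  rfl

variable [WeakCaratheodoryClass Θ P]

lemma CFun.tendsto_iff {ι : Type*} {l : Filter ι} {F : ι → CFun Θ P} {f : CFun Θ P} :
    Tendsto F l (𝓝 f) ↔ ∀ (a b : ℚ) (j : ℕ), a ≤ b → ∀ ε > 0, ∀ᶠ i in l,
      ∀ x ∈ modulusClass N Θ a b j,
        ‖(∫ t in (a : ℝ)..b, (F i).toFun t (x t)) - ∫ t in (a : ℝ)..b, f.toFun t (x t)‖ ≤ ε := by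
  constructor
  · intro h a b j hab ε hε
    have := h (IsOpen.mem_nhds (TopologicalSpace.isOpen_generateFrom_of_mem
      (⟨f, a, b, j, ENNReal.ofReal ε, hab, by simpa using hε, rfl⟩)) ?_)
    · filter_upwards [this] with i hi x hx
      have hi : pSeminorm Θ a b j ((F i).toFun - f.toFun) < ENNReal.ofReal ε := hi
      rw [pSeminorm_sub (F i).isWTC f.isWTC hab] at hi
      have := (le_iSup₂ (f := fun x (_ : x ∈ modulusClass N Θ a b j) =>
        ‖(∫ t in (a : ℝ)..b, (F i).toFun t (x t)) - ∫ t in (a : ℝ)..b, f.toFun t (x t)‖ₑ) x hx).trans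
        hi.le
      rwa [← ofReal_norm, ENNReal.ofReal_le_ofReal_iff hε.le] at this
    · change pSeminorm Θ a b j (f.toFun - f.toFun) < ENNReal.ofReal ε
      rw [pSeminorm_sub f.isWTC f.isWTC hab]
      simpa using hε
  · intro h
    rw [TopologicalSpace.tendsto_nhds_generateFrom_iff]
    rintro _ ⟨f', a, b, j, ε, hab, hε, rfl⟩ hf
    have hf : pSeminorm Θ a b j (f.toFun - f'.toFun) < ε := hf
    -- The generating balls have arbitrary centres `f'`; the room between the seminorm of `f - f'`
    -- and the radius is the tolerance for `F i - f`.
    obtain ⟨η, hη, hη'⟩ := ENNReal.lt_iff_exists_add_pos_lt.1 hf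
    filter_upwards [h a b j hab η (by exact_mod_cast hη)] with i hi
    change pSeminorm Θ a b j ((F i).toFun - f'.toFun) < ε
    refine lt_of_le_of_lt ?_ hη'
    rw [pSeminorm_sub (F i).isWTC f'.isWTC hab, pSeminorm_sub f.isWTC f'.isWTC hab]
    refine iSup₂_le fun x hx => ?_
    have h1 := hi x hx
    calc ‖(∫ t in (a : ℝ)..b, (F i).toFun t (x t)) - ∫ t in (a : ℝ)..b, f'.toFun t (x t)‖ₑ
        = ‖((∫ t in (a : ℝ)..b, f.toFun t (x t)) - ∫ t in (a : ℝ)..b, f'.toFun t (x t)) +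
          ((∫ t in (a : ℝ)..b, (F i).toFun t (x t)) - ∫ t in (a : ℝ)..b, f.toFun t (x t))‖ₑ := by
          congr 1; abel
      _ ≤ _ := (enorm_add_le _ _).trans (add_le_add
          (le_iSup₂ (f := fun x (_ : x ∈ modulusClass N Θ a b j) =>
            ‖(∫ t in (a : ℝ)..b, f.toFun t (x t)) - ∫ t in (a : ℝ)..b, f'.toFun t (x t)‖ₑ) x hx) ?_)
    rw [← ofReal_norm]
    exact ENNReal.ofReal_le_of_le_toReal (by simpa using h1)

/-- The seminorms cannot separate equivalent functions, because their integrals along every test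
path coincide. -/
lemma CFun.specializes_of_equiv {f g : CFun Θ P}
    (h : ∀ᵐ p : ℝ × Euc N, f.toFun p.1 p.2 = g.toFun p.1 p.2) : f ⤳ g := by
  rw [specializes_iff_pure, ← tendsto_id', CFun.tendsto_iff]
  intro a b j hab ε hε
  rw [eventually_pure]
  intro x hx
  rw [id, f.isWTC.integral_eq_of_ae_eq_rat g.isWTC h hab hx, sub_self, norm_zero]
  exact hε.le

/-- Equivalent functions are topologically indistinguishable, so every open set is already
saturated. The quotient therefore loses no open set, and convergence of classes may be tested on
chosen representatives. -/
lemma CSpace.isInducing_mk :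
    IsInducing (Quotient.mk (CFun.instSetoid Θ P) : CFun Θ P → CSpace Θ P) := by
  refine ⟨le_antisymm continuous_quotient_mk'.le_induced fun U hU => ?_⟩
  refine isOpen_induced_iff.2 ⟨Quotient.mk (CFun.instSetoid Θ P) '' U, ?_, ?_⟩
  all_goals
    have hsat : Quotient.mk (CFun.instSetoid Θ P) ⁻¹' (Quotient.mk (CFun.instSetoid Θ P) '' U) = U := by
      refine Subset.antisymm ?_ (subset_preimage_image _ _)
      rintro g ⟨f, hf, hfg⟩
      have : ∀ᵐ p : ℝ × Euc N, f.toFun p.1 p.2 = g.toFun p.1 p.2 := Quotient.exact hfg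
      exact (CFun.specializes_of_equiv (this.mono fun _ h => h.symm)).mem_open hU hf
  · change IsOpen (Quotient.mk (CFun.instSetoid Θ P) ⁻¹' _)
    rwa [hsat]
  · exact hsat

lemma CSpace.tendsto_iff {ι : Type*} {l : Filter ι} {F : ι → CSpace Θ P} {c : CSpace Θ P} :
    Tendsto F l (𝓝 c) ↔ ∀ (a b : ℚ) (j : ℕ), a ≤ b → ∀ ε > 0, ∀ᶠ i in l,
      ∀ x ∈ modulusClass N Θ a b j,
        ‖(∫ t in (a : ℝ)..b, (F i).rep t (x t)) - ∫ t in (a : ℝ)..b, c.rep t (x t)‖ ≤ ε := by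
  have h := (CSpace.isInducing_mk (Θ := Θ) (P := P)).tendsto_nhds_iff
    (f := fun i => (⟨(F i).rep, (F i).rep_prop⟩ : CFun Θ P)) (l := l) (y := ⟨c.rep, c.rep_prop⟩)
  rw [CFun.tendsto_iff] at h
  have e : (Quotient.mk (CFun.instSetoid Θ P) ∘
      fun i => (⟨(F i).rep, (F i).rep_prop⟩ : CFun Θ P)) = F := funext fun i => (F i).mk_rep
  have e' : Quotient.mk (CFun.instSetoid Θ P) ⟨c.rep, c.rep_prop⟩ = c := c.mk_rep
  rw [e, e'] at h
  exact h.symm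

end Topology

lemma norm_sub_le_of_approx {V : Type*} [NormedAddCommGroup V] (A B C D : V) :
    ‖A - B‖ ≤ ‖A - C‖ + ‖C - D‖ + ‖B - D‖ := by
  have : A - B = (A - C) + (C - D) - (B - D) := by abel
  rw [this]
  exact (norm_sub_le _ _).trans (by gcongr; exact norm_add_le _ _)

/-! ### Equibounded sets: closure, uniform convergence, translation -/

section EquiBounded

variable {N : ℕ} {V : Type*} [NormedAddCommGroup V] [NormedSpace ℝ V] [MeasurableSpace V]
  {Θ : SuitableModuli} {P : (ℝ → Euc N → V) → Prop}

/-- The integrals of `|c(t, x(t))|` over short intervals are small, uniformly in `c ∈ A` and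
`x ∈ 𝒦_j`. -/
def EquiBounded (A : Set (CSpace Θ P)) : Prop :=
  ∀ j : ℕ, ∀ ε > 0, ∃ δ > 0, ∀ c ∈ A, ∀ a b : ℝ, a ≤ b → b - a < δ →
    ∀ x ∈ modulusClass N Θ a b j, ∫ t in a..b, ‖c.rep t (x t)‖ ≤ ε

lemma CSpace.isWTC_rep [hP : WeakCaratheodoryClass Θ P] (c : CSpace Θ P) : IsWTC Θ c.rep :=
  hP.isWTC _ c.rep_prop

lemma CSpace.Represents.isWTC [hP : WeakCaratheodoryClass Θ P] {f : ℝ → Euc N → V}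
    {c : CSpace Θ P} (h : CSpace.Represents f c) : IsWTC Θ f :=
  hP.isWTC _ h.1

variable [BorelSpace V] [SecondCountableTopology V] [WeakCaratheodoryClass Θ P]

/-- Cut the interval into pieces shorter than the `δ` that belongs to `ε = 1`; each piece carries
mass at most `1`. -/
lemma EquiBounded.exists_integral_le {A : Set (CSpace Θ P)} (hA : EquiBounded A) (j : ℕ)
    {a b : ℝ} (hab : a ≤ b) : ∃ C : ℝ, ∀ c ∈ A, ∀ x ∈ modulusClass N Θ a b j,
      ∫ t in a..b, ‖c.rep t (x t)‖ ≤ C := by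
  obtain ⟨δ, hδ, h⟩ := hA j 1 one_pos
  obtain ⟨n, hn, hn'⟩ := (eventually_mesh_lt a b hδ).exists
  refine ⟨n, fun c hc x hx => ?_⟩
  rw [← sum_integral_partition hab (c.isWTC_rep.intervalIntegrable_modulusClass hab hx).norm hn]
  refine (Finset.sum_le_sum (g := fun _ => (1 : ℝ)) fun k hk => ?_).trans (by simp)
  refine h c hc _ _ (partitionPoint_le_succ hab n k) ?_ x
    (modulusClass_mono_interval hx (partitionPoint_subset hab (Finset.mem_range.1 hk)))
  rwa [partitionPoint_succ_sub]

/-- On an equibounded set, convergence in `σ_Θ` is convergence of the integrals, uniformly with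
respect to the function in `𝒦_j` and to the subintervals of a compact interval. -/
lemma EquiBounded.eventually_integral_sub_le {A : Set (CSpace Θ P)} (hA : EquiBounded A)
    {c₀ : CSpace Θ P} (hc₀ : c₀ ∈ A) (j : ℕ) (a b : ℝ) {ε : ℝ} (hε : 0 < ε) :
    ∀ᶠ c in 𝓝[A] c₀, ∀ s t : ℝ, a ≤ s → s ≤ t → t ≤ b → ∀ x ∈ modulusClass N Θ s t j,
      ‖(∫ u in s..t, c.rep u (x u)) - ∫ u in s..t, c₀.rep u (x u)‖ ≤ ε := by
  -- Five errors: two end pieces for `c`, two for `c₀`, and the comparison of `c` with `c₀` on a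
  -- rational interval.
  obtain ⟨δ, hδ, h⟩ := hA j (ε / 5) (by positivity)
  have key : ∀ᶠ c : CSpace Θ P in 𝓝[A] c₀, ∀ z ∈ Icc a b ×ˢ Icc a b, z.1 ≤ z.2 →
      ∀ x ∈ modulusClass N Θ z.1 z.2 j,
      ‖(∫ u in z.1..z.2, c.rep u (x u)) - ∫ u in z.1..z.2, c₀.rep u (x u)‖ ≤ ε := by
    -- Compactness of the set of endpoint pairs: near `(s₀, t₀)` a single rational interval `[p, q]`
    -- serves all pairs, so finitely many seminorms suffice.
    refine (isCompact_Icc.prod isCompact_Icc).induction_on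
      (p := fun S : Set (ℝ × ℝ) => ∀ᶠ c : CSpace Θ P in 𝓝[A] c₀, ∀ z ∈ S, z.1 ≤ z.2 →
        ∀ x ∈ modulusClass N Θ z.1 z.2 j,
      ‖(∫ u in z.1..z.2, c.rep u (x u)) - ∫ u in z.1..z.2, c₀.rep u (x u)‖ ≤ ε) (by simp)
      (fun S T hST hT => hT.mono fun c hc z hz => hc z (hST hz))
      (fun S T hS hT => (hS.and hT).mono fun c hc z hz => hz.elim (hc.1 z) (hc.2 z)) ?_
    rintro ⟨s₀, t₀⟩ -
    obtain ⟨p, hp, hp'⟩ := exists_rat_btwn (show s₀ - δ / 2 < s₀ by linarith)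
    obtain ⟨q, hq, hq'⟩ := exists_rat_btwn (show t₀ < t₀ + δ / 2 by linarith)
    refine ⟨Ioo (p : ℝ) (s₀ + δ / 2) ×ˢ Ioo (t₀ - δ / 2) (q : ℝ), mem_nhdsWithin_of_mem_nhds
      (prod_mem_nhds (Ioo_mem_nhds hp' (by linarith)) (Ioo_mem_nhds (by linarith) hq)), ?_⟩
    by_cases hpq : p ≤ q
    swap
    -- If `q < p`, the neighbourhood contains no pair with `s ≤ t`.
    · refine Eventually.of_forall fun c z hz hle => absurd ?_ hpq
      have : (p : ℝ) ≤ q := by linarith [hz.1.1, hz.2.2]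
      exact_mod_cast this
    have hev := CSpace.tendsto_iff.1
      (tendsto_id.mono_left nhdsWithin_le_nhds : Tendsto id (𝓝[A] c₀) (𝓝 c₀)) p q j hpq (ε / 5)
      (by positivity)
    filter_upwards [hev, self_mem_nhdsWithin] with c hc hcA z hz hle x hx
    have hy := clampShift_mem hle 0 hx
    have bd : ∀ c ∈ A, ‖(∫ u in z.1..z.2, c.rep u (x u)) -
        ∫ u in (p : ℝ)..q, c.rep u (clampShift z.1 z.2 0 x u)‖ ≤ ε / 5 + ε / 5 := fun c hc =>
      (norm_integral_sub_clamp_le c.isWTC_rep.toIsCaratheodory hle hz.1.1.le hz.2.2.le hx).trans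
        (add_le_add
          (h c hc _ _ hz.1.1.le (by linarith [hz.1.2]) _ (hy _ _))
          (h c hc _ _ hz.2.2.le (by linarith [hz.2.1]) _ (hy _ _)))
    refine (norm_sub_le_of_approx _ _ _ _).trans
      ((add_le_add (add_le_add (bd c hcA) (hc _ (hy _ _))) (bd c₀ hc₀)).trans ?_)
    linarith
  filter_upwards [key] with c hc s t has hst htb x hx
  exact hc (s, t) ⟨⟨has, hst.trans htb⟩, ⟨has.trans hst, htb⟩⟩ hst x hx

variable [CompleteSpace V]

lemma CSpace.Represents.ae_eq_along {f g : ℝ → Euc N → V} {c : CSpace Θ P}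
    (hf : CSpace.Represents f c) (hg : CSpace.Represents g c) {j : ℕ}
    {a b : ℝ} (hab : a ≤ b) {x : ℝ → Euc N} (hx : x ∈ modulusClass N Θ a b j) :
    ∀ᵐ t : ℝ, t ∈ Icc a b → f t (x t) = g t (x t) :=
  hf.isWTC.ae_eq_along hg.isWTC (hf.ae_eq hg) hab hx

lemma CSpace.Represents.integral_eq {f g : ℝ → Euc N → V} {c : CSpace Θ P}
    (hf : CSpace.Represents f c) (hg : CSpace.Represents g c) {j : ℕ}
    {a b : ℝ} (hab : a ≤ b) {x : ℝ → Euc N} (hx : x ∈ modulusClass N Θ a b j) :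
    ∫ t in a..b, f t (x t) = ∫ t in a..b, g t (x t) :=
  hf.isWTC.integral_eq_of_ae_eq hg.isWTC (hf.ae_eq hg) hab hx

lemma CSpace.Represents.integral_norm_eq {f g : ℝ → Euc N → V} {c : CSpace Θ P}
    (hf : CSpace.Represents f c) (hg : CSpace.Represents g c) {j : ℕ}
    {a b : ℝ} (hab : a ≤ b) {x : ℝ → Euc N} (hx : x ∈ modulusClass N Θ a b j) :
    ∫ t in a..b, ‖f t (x t)‖ = ∫ t in a..b, ‖g t (x t)‖ := by
  refine intervalIntegral.integral_congr_ae ?_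
  filter_upwards [hf.ae_eq_along hg hab hx] with t ht hmem
  rw [uIoc_of_le hab] at hmem
  rw [ht (Ioc_subset_Icc_self hmem)]

/-- The orbit of a function with `L¹_loc`-equicontinuous `m`-bounds is equibounded. -/
lemma equiBounded_orbit [TranslationStable P] {f : ℝ → Euc N → V} (hf : P f)
    (hm : HasEquicontMBounds f) :
    EquiBounded (range fun t : ℝ => CSpace.translate t (CSpace.mk Θ f hf)) := by
  intro j ε hε
  obtain ⟨S, -, hS, hS'⟩ := hm j
  obtain ⟨δ, hδ, h⟩ := hS' 1 one_pos ε hε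
  refine ⟨min δ 1, lt_min hδ one_pos, ?_⟩
  rintro _ ⟨τ, rfl⟩ a b hab hbaδ x hx
  have hrep : CSpace.Represents (timeTranslate τ f) (CSpace.translate τ (CSpace.mk Θ f hf)) :=
    CSpace.Represents.translate ⟨hf, rfl⟩ τ
  rw [(CSpace.represents_rep _).integral_norm_eq hrep hab hx]
  -- Using the translate by `a + τ` moves `[a, b]` to `[0, b - a] ⊆ [-1, 1]`. The equicontinuity for
  -- `r = 1` thus gives a `δ` that does not depend on the position of the interval.
  obtain ⟨m, hmS, hmb⟩ := hS _ ⟨a + τ, rfl⟩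
  have h1 := h 0 (b - a) (by norm_num) (by linarith) (hbaδ.le.trans (min_le_right _ _))
    (by simpa using hbaδ.trans_le (min_le_left _ _)) m hmS
  refine le_trans ?_ h1.le
  have e : ∫ t in a..b, ‖timeTranslate τ f t (x t)‖ =
      ∫ t in (0 : ℝ)..(b - a), ‖timeTranslate (a + τ) f t (x (t + a))‖ := by
    have := intervalIntegral.integral_comp_add_right (a := 0) (b := b - a)
      (fun t => ‖timeTranslate τ f t (x t)‖) a
    simp only [zero_add, sub_add_cancel] at this
    rw [← this]
    simp only [timeTranslate, add_assoc]
  rw [e]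
  have hxc : ContinuousOn (fun t => x (t + a)) (uIcc 0 (b - a)) := by
    rw [uIcc_of_le (by linarith)]
    exact hx.1.comp (by fun_prop) fun t ht => ⟨by linarith [ht.1], by linarith [ht.2]⟩
  have hgi : IntervalIntegrable (fun t => timeTranslate (a + τ) f t (x (t + a))) volume 0 (b - a) := by
    have := (hrep.isWTC.toIsCaratheodory.timeTranslate a).intervalIntegrable_continuousOn hxc
    simpa only [timeTranslate, add_assoc] using this
  refine intervalIntegral.integral_mono_ae_restrict (by linarith) hgi.norm (hmb.1 _ _) ?_
  filter_upwards [ae_restrict_of_ae hmb.2, ae_restrict_mem measurableSet_Icc] with t ht hmem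
  exact ht _ (hx.2.1 ⟨by linarith [hmem.1], by linarith [hmem.2]⟩)

/-- Equiboundedness passes to the closure. -/
lemma EquiBounded.closure {A : Set (CSpace Θ P)} (hA : EquiBounded A) :
    EquiBounded (closure A) := by
  intro j ε hε
  obtain ⟨δ, hδ, h⟩ := hA j ε hε
  refine ⟨δ, hδ, fun c hc => ?_⟩
  have hrat : ∀ p q : ℚ, (p : ℝ) ≤ q → (q : ℝ) - p < δ → ∀ x ∈ modulusClass N Θ p q j,
      ∫ t in (p : ℝ)..q, ‖c.rep t (x t)‖ ≤ ε := by
    intro p q hpq hδ' x hx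
    have hi : ∀ c : CSpace Θ P, IntervalIntegrable (fun t => c.rep t (x t)) volume p q :=
      fun c => c.isWTC_rep.intervalIntegrable_modulusClass hpq hx
    -- Lower semicontinuity of the mass: each partition sum at `c` is a limit of partition sums at
    -- elements of `A`, and those are bounded by their masses.
    refine integral_norm_le_of_partition_sums_le hpq (hi c) fun n hn => ?_
    have hne : (𝓝[A] c).NeBot := mem_closure_iff_nhdsWithin_neBot.1 hc
    have hlim : Tendsto (fun c' : CSpace Θ P => ∑ k ∈ Finset.range n,
        ‖∫ t in (partitionPoint p q n k)..(partitionPoint p q n (k + 1)), c'.rep t (x t)‖) (𝓝[A] c)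
        (𝓝 (∑ k ∈ Finset.range n,
        ‖∫ t in (partitionPoint p q n k)..(partitionPoint p q n (k + 1)), c.rep t (x t)‖)) := by
      refine tendsto_finsetSum _ fun k hk => Tendsto.norm ?_
      have hk := Finset.mem_range.1 hk
      have hle := partitionPoint_le_succ hpq n k
      have hxk := modulusClass_mono_interval hx (partitionPoint_subset hpq hk)
      rw [partitionPoint_ratCast, partitionPoint_ratCast] at hle hxk ⊢
      have := CSpace.tendsto_iff.1 (tendsto_id.mono_left nhdsWithin_le_nhds : Tendsto id (𝓝[A] c) (𝓝 c))
        _ _ j (by exact_mod_cast hle)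
      rw [Metric.tendsto_nhds]
      intro η hη
      filter_upwards [this (η / 2) (by positivity)] with c' hc'
      rw [dist_eq_norm]
      exact (hc' x hxk).trans_lt (by linarith)
    refine le_of_tendsto hlim ?_
    filter_upwards [self_mem_nhdsWithin] with c' hc'
    exact (sum_norm_integral_partition_le hpq (hi c') hn).trans (h c' hc' _ _ hpq hδ' x hx)
  intro a b hab hd x hx
  -- Half of the slack `δ - (b - a)` on each side leaves room for a rational interval that is still
  -- shorter than `δ`.
  obtain ⟨p, hp, hp'⟩ := exists_rat_btwn (show a - (δ - (b - a)) / 2 < a by linarith)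
  obtain ⟨q, hq, hq'⟩ := exists_rat_btwn (show b < b + (δ - (b - a)) / 2 by linarith)
  have hy := clampShift_mem hab 0 hx p q
  refine le_trans ?_ (hrat p q (by linarith) (by linarith) _ hy)
  have e : ∫ t in a..b, ‖c.rep t (x t)‖ = ∫ t in a..b, ‖c.rep t (clampShift a b 0 x t)‖ :=
    intervalIntegral.integral_congr fun t ht => by
      rw [uIcc_of_le hab] at ht
      simp only [clampShift_zero_apply ht]
  rw [e]
  exact intervalIntegral.integral_mono_interval hp'.le hab hq.le
    (Eventually.of_forall fun _ => norm_nonneg _)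
    (c.isWTC_rep.intervalIntegrable_modulusClass (by linarith) hy).norm

/-- Time translation is jointly continuous on equibounded sets. -/
lemma EquiBounded.continuousOn_translate [TranslationStable P] {A : Set (CSpace Θ P)}
    (hA : EquiBounded A) :
    ContinuousOn (fun z : ℝ × CSpace Θ P => CSpace.translate z.1 z.2) (univ ×ˢ A) := by
  rintro ⟨t₀, c₀⟩ ⟨-, hc₀⟩
  rw [ContinuousWithinAt, nhdsWithin_prod_eq, nhdsWithin_univ, CSpace.tendsto_iff]
  intro a b j hab ε hε
  have hab' : (a : ℝ) ≤ b := by exact_mod_cast hab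
  obtain ⟨δ, hδ, h⟩ := hA j (ε / 8) (by positivity)
  obtain ⟨p, hp, hp'⟩ := exists_rat_btwn (show (a : ℝ) + t₀ - δ / 2 < a + t₀ by linarith)
  obtain ⟨q, hq, hq'⟩ := exists_rat_btwn (show (b : ℝ) + t₀ < b + t₀ + δ / 2 by linarith)
  have hpq : p ≤ q := by
    have : (p : ℝ) ≤ q := by linarith
    exact_mod_cast this
  -- Replacing the shift `t` by `t₀` moves the path by at most `θ_j(|t - t₀|)`, uniformly over
  -- `𝒦_j`. Uniform continuity of the integral of `c₀` then absorbs the change.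
  obtain ⟨η, hη, hunif⟩ := c₀.isWTC_rep.exists_integral_sub_le_rat j hpq
    (show 0 < ε / 8 by positivity)
  obtain ⟨ρ, hρ, hΘ⟩ := Θ.exists_le j hη
  have hev := CSpace.tendsto_iff.1
    (tendsto_id.mono_left nhdsWithin_le_nhds : Tendsto id (𝓝[A] c₀) (𝓝 c₀)) p q j hpq (ε / 8)
    (by positivity)
  have hnear : ∀ᶠ t : ℝ in 𝓝 t₀, (|t - t₀| < ρ ∧ |t - t₀| < δ / 2) ∧ p < a + t ∧ b + t < q := by
    refine Eventually.and (Eventually.and ?_ ?_) (Eventually.and ?_ ?_)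
    · exact Metric.ball_mem_nhds t₀ hρ
    · exact Metric.ball_mem_nhds t₀ (half_pos hδ)
    · filter_upwards [lt_mem_nhds (show (p : ℝ) - a < t₀ by linarith)] with t ht
      linarith
    · filter_upwards [gt_mem_nhds (show t₀ < (q : ℝ) - b by linarith)] with t ht
      linarith
  have hnear₀ := hnear.self_of_nhds
  filter_upwards [hnear.prod_mk (hev.and self_mem_nhdsWithin)]
  rintro ⟨t, c⟩ ⟨ht, hc, hcA⟩ x hx
  have hy : ∀ t p q, clampShift (a : ℝ) b t x ∈ modulusClass N Θ p q j :=
    fun t => clampShift_mem hab' t hx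
  have bd : ∀ c ∈ A, ∀ t : ℝ,
      (|t - t₀| < ρ ∧ |t - t₀| < δ / 2) ∧ p < a + t ∧ b + t < q →
      ‖(∫ s in (a : ℝ)..b, (CSpace.translate t c).rep s (x s)) -
        ∫ u in (p : ℝ)..q, c.rep u (clampShift a b t x u)‖ ≤ ε / 8 + ε / 8 := by
    intro c hc t ht
    have hd := abs_lt.1 ht.1.2
    rw [(CSpace.represents_rep _).integral_eq (c.represents_rep.translate t) hab' hx]
    refine (norm_integral_translate_sub_clampShift_le c.isWTC_rep.toIsCaratheodory hab'
      ht.2.1.le ht.2.2.le hx).trans (add_le_add ?_ ?_)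
    · exact h c hc _ _ ht.2.1.le (by linarith) _ (hy t _ _)
    · exact h c hc _ _ ht.2.2.le (by linarith) _ (hy t _ _)
  have h2 := hunif _ (hy t p q) _ (hy t₀ p q) fun u _ => by
    refine (hx.2.2 _ (clamp_mem hab' _) _ (clamp_mem hab' _)).trans ?_
    refine hΘ _ (abs_nonneg _) (lt_of_le_of_lt (abs_clamp_sub_le _ _ _ _) ?_)
    rw [show u - t - (u - t₀) = -(t - t₀) by ring, abs_neg]
    exact ht.1.1
  have h3 : ‖(∫ u in (p : ℝ)..q, c.rep u (clampShift a b t x u)) -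
      ∫ u in (p : ℝ)..q, c₀.rep u (clampShift a b t₀ x u)‖ ≤ ε / 8 + ε / 8 := by
    refine (norm_sub_le_norm_sub_add_norm_sub _ _ _).trans (add_le_add (hc _ (hy t p q)) h2)
  refine (norm_sub_le_of_approx _ _ _ _).trans
    ((add_le_add (add_le_add (bd c hcA t ht) h3) (bd c₀ hc₀ t₀ hnear₀)).trans ?_)
  linarith

end EquiBounded

/-! ### The translation flow on a hull -/

section HullFlow

variable {Ω : Type*} [TopologicalSpace Ω] {τ : ℝ → Ω → Ω} {ω : Ω}

lemma map_mem_hull (hadd : ∀ s t x, τ (s + t) x = τ s (τ t x))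
    (hc : ContinuousOn (fun z : ℝ × Ω => τ z.1 z.2) (univ ×ˢ hull τ ω)) (t : ℝ) {g : Ω}
    (hg : g ∈ hull τ ω) : τ t g ∈ hull τ ω := by
  have hcont : ContinuousWithinAt (τ t) (range fun t : ℝ => τ t ω) g := by
    have h1 : ContinuousOn (fun g => τ t g) (hull τ ω) :=
      hc.comp (f := fun g : Ω => (t, g)) (by fun_prop) fun g hg => ⟨mem_univ _, hg⟩
    exact (h1 g hg).mono subset_closure
  refine hcont.mem_closure hg ?_
  rintro _ ⟨s, rfl⟩
  exact ⟨t + s, hadd t s ω⟩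

/-- The flow given by translation on a hull on which translation is continuous. -/
def hullFlow (hzero : ∀ x, τ 0 x = x) (hadd : ∀ s t x, τ (s + t) x = τ s (τ t x))
    (hc : ContinuousOn (fun z : ℝ × Ω => τ z.1 z.2) (univ ×ˢ hull τ ω)) :
    Flow ℝ (hull τ ω) where
  toFun t g := ⟨τ t g, map_mem_hull hadd hc t g.2⟩
  cont' := by
    refine Continuous.subtype_mk ?_ _
    exact hc.comp_continuous (f := fun z : ℝ × hull τ ω => (z.1, (z.2 : Ω))) (by fun_prop)
      fun z => ⟨mem_univ _, z.2.2⟩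
  map_add' s t g := Subtype.ext (hadd s t g)
  map_zero' g := Subtype.ext (hzero g)

end HullFlow

/-! ### Gronwall's inequality and a continuity argument -/

section Gronwall

/-- Induction on the number of pieces of kernel mass `1/2`. On the last piece evaluate at a maximum
point `r` of `z`: that piece contributes at most `z(r)/2`, which is absorbed in the left-hand side,
and the earlier pieces are bounded by induction. -/
lemma gronwall_forward (n : ℕ) {α z : ℝ → ℝ} {C b : ℝ} (hb : 0 ≤ b) (hC : 0 ≤ C)
    (hα : ∀ t, 0 ≤ α t) (hαi : IntervalIntegrable α volume 0 b) (hz : ContinuousOn z (Icc 0 b))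
    (hz0 : ∀ t ∈ Icc 0 b, 0 ≤ z t)
    (h : ∀ t ∈ Icc 0 b, z t ≤ C + ∫ s in (0 : ℝ)..t, α s * z s)
    (hn : ∫ s in (0 : ℝ)..b, α s ≤ n / 2) : ∀ t ∈ Icc 0 b, z t ≤ (n + 1).factorial * C := by
  have hsub : ∀ {c d : ℝ}, 0 ≤ c → c ≤ d → d ≤ b → IntervalIntegrable α volume c d := by
    intro c d hc hcd hd
    refine hαi.mono_set ?_
    rw [uIcc_of_le hcd, uIcc_of_le hb]
    exact Icc_subset_Icc hc hd
  have hmul : ∀ {c d : ℝ}, 0 ≤ c → c ≤ d → d ≤ b →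
      IntervalIntegrable (fun s => α s * z s) volume c d := by
    intro c d hc hcd hd
    refine (hsub hc hcd hd).mul_continuousOn (hz.mono ?_)
    rw [uIcc_of_le hcd]
    exact Icc_subset_Icc hc hd
  have hbd : ∀ {c d M : ℝ}, 0 ≤ c → c ≤ d → d ≤ b → (∀ t ∈ Icc c d, z t ≤ M) →
      ∫ s in c..d, α s * z s ≤ (∫ s in c..d, α s) * M := by
    intro c d M hc hcd hd hM
    rw [← intervalIntegral.integral_mul_const]
    exact intervalIntegral.integral_mono_on hcd (hmul hc hcd hd) ((hsub hc hcd hd).mul_const M)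
      fun t ht => mul_le_mul_of_nonneg_left (hM t ht) (hα t)
  induction n generalizing b with
  | zero =>
    intro t ht
    obtain ⟨r, hr, hmax⟩ := isCompact_Icc.exists_isMaxOn ⟨t, ht⟩ hz
    have h1 := h r hr
    have h2 := hbd le_rfl hr.1 hr.2 (M := z r)
      fun s hs => hmax ⟨hs.1, hs.2.trans hr.2⟩
    have h3 : ∫ s in (0 : ℝ)..r, α s ≤ 0 := by
      refine le_trans ?_ (hn.trans (by simp))
      exact intervalIntegral.integral_mono_interval le_rfl hr.1 hr.2
        (Eventually.of_forall hα) hαi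
    have h4 : (∫ s in (0 : ℝ)..r, α s) * z r ≤ 0 := mul_nonpos_of_nonpos_of_nonneg h3 (hz0 r hr)
    have h5 : z t ≤ z r := hmax ht
    simp
    linarith
  | succ n ih =>
    have hfac : ((n + 1 + 1).factorial : ℝ) = (n + 2) * (n + 1).factorial := by
      rw [Nat.factorial_succ]; push_cast; ring
    have hf1 : (1 : ℝ) ≤ (n + 1).factorial := by
      exact_mod_cast Nat.one_le_iff_ne_zero.2 (Nat.factorial_ne_zero _)
    have hn0 : (0 : ℝ) ≤ n := Nat.cast_nonneg n
    have hFC : C ≤ (n + 1).factorial * C := le_mul_of_one_le_left hC hf1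
    have hmono : ((n + 1).factorial : ℝ) * C ≤ (n + 1 + 1).factorial * C := by
      rw [hfac]
      nlinarith
    by_cases hsmall : ∫ s in (0 : ℝ)..b, α s ≤ n / 2
    · exact fun t ht => (ih hb hαi hz hz0 h hsmall hsub hmul hbd t ht).trans hmono
    have hcont : ContinuousOn (fun t => ∫ s in (0 : ℝ)..t, α s) (Icc 0 b) := by
      have := intervalIntegral.continuousOn_primitive_interval' hαi left_mem_uIcc
      rwa [uIcc_of_le hb] at this
    -- `t₁` is a time at which the kernel has used the mass `n/2`; at most `1/2` remains after it.
    obtain ⟨t₁, ht₁, hα₁⟩ := intermediate_value_Icc hb hcont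
      (show (n : ℝ) / 2 ∈ Icc _ _ from ⟨by simp; positivity, (not_le.1 hsmall).le⟩)
    simp only at hα₁
    have hsub₁ : Icc 0 t₁ ⊆ Icc 0 b := Icc_subset_Icc le_rfl ht₁.2
    have h₁ : ∀ t ∈ Icc 0 t₁, z t ≤ (n + 1).factorial * C :=
      ih ht₁.1 (hsub le_rfl ht₁.1 ht₁.2) (hz.mono hsub₁) (fun t ht => hz0 t (hsub₁ ht))
        (fun t ht => h t (hsub₁ ht)) hα₁.le (fun a b c => hsub a b (c.trans ht₁.2))
        (fun a b c => hmul a b (c.trans ht₁.2)) (fun a b c => hbd a b (c.trans ht₁.2))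
    intro t ht
    rcases le_total t t₁ with htt | htt
    · exact (h₁ t ⟨ht.1, htt⟩).trans hmono
    have hsub₂ : Icc t₁ b ⊆ Icc 0 b := Icc_subset_Icc ht₁.1 le_rfl
    obtain ⟨r, hr, hmax⟩ := isCompact_Icc.exists_isMaxOn ⟨t, ⟨htt, ht.2⟩⟩ (hz.mono hsub₂)
    have e1 := h r (hsub₂ hr)
    rw [← intervalIntegral.integral_add_adjacent_intervals (hmul le_rfl ht₁.1 ht₁.2)
      (hmul ht₁.1 hr.1 hr.2)] at e1
    have e2 := hbd le_rfl ht₁.1 ht₁.2 h₁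
    have e3 := hbd ht₁.1 hr.1 hr.2 (M := z r) fun s hs => hmax ⟨hs.1, hs.2.trans hr.2⟩
    have e4 : ∫ s in t₁..r, α s ≤ 1 / 2 := by
      have i1 := intervalIntegral.integral_add_adjacent_intervals (hsub le_rfl ht₁.1 ht₁.2)
        (hsub ht₁.1 hr.1 hr.2)
      have i2 : ∫ s in (0 : ℝ)..r, α s ≤ ∫ s in (0 : ℝ)..b, α s :=
        intervalIntegral.integral_mono_interval le_rfl (ht₁.1.trans hr.1) hr.2
          (Eventually.of_forall hα) hαi
      push_cast at hn
      linarith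
    have e5 : (∫ s in t₁..r, α s) * z r ≤ 1 / 2 * z r :=
      mul_le_mul_of_nonneg_right e4 (hz0 r (hsub₂ hr))
    rw [hα₁] at e2
    have e6 : z t ≤ z r := hmax ⟨htt, ht.2⟩
    -- Absorption gives `z(r) ≤ 2C + n (n+1)! C`, which is at most `(n+2) (n+1)! C`. This is where
    -- the factorial comes from.
    rw [hfac]
    nlinarith

/-- Gronwall's inequality for integrable kernels; the constant depends only on a bound for the
integral of the kernel. -/
lemma exists_gronwall_const (R : ℝ) : ∃ K : ℝ, 0 < K ∧ ∀ (α z : ℝ → ℝ) (C b : ℝ), 0 ≤ C →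
    (∀ t, 0 ≤ α t) → IntervalIntegrable α volume 0 b → ContinuousOn z (uIcc 0 b) →
    (∀ t, 0 ≤ z t) → (∀ t ∈ uIcc 0 b, z t ≤ C + |∫ s in (0 : ℝ)..t, α s * z s|) →
    |∫ s in (0 : ℝ)..b, α s| ≤ R → ∀ t ∈ uIcc 0 b, z t ≤ K * C := by
  obtain ⟨n, hn⟩ := exists_nat_ge (2 * R)
  refine ⟨(n + 1).factorial, by positivity, fun α z C b hC hα hαi hz hz0 h hR => ?_⟩
  rcases le_total 0 b with hb | hb
  · rw [uIcc_of_le hb] at *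
    refine gronwall_forward n hb hC hα hαi hz (fun t _ => hz0 t) (fun t ht => ?_)
      (by linarith [le_abs_self (∫ s in (0 : ℝ)..b, α s)])
    have := h t ht
    rwa [abs_of_nonneg] at this
    exact intervalIntegral.integral_nonneg ht.1 fun s _ => mul_nonneg (hα s) (hz0 s)
  -- Negative times are reduced to positive ones by reflection.
  · rw [uIcc_of_ge hb] at *
    have hneg : ∀ t ∈ Icc 0 (-b), -t ∈ Icc b 0 := fun t ht => ⟨by linarith [ht.2], by linarith [ht.1]⟩
    have hi : IntervalIntegrable (fun t => α (-t)) volume 0 (-b) := by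
      have := (IntervalIntegrable.iff_comp_neg (f := α) (a := 0) (b := b)).1 hαi
      simpa using this
    have key := gronwall_forward n (α := fun t => α (-t)) (z := fun t => z (-t)) (C := C)
      (neg_nonneg.2 hb) hC (fun t => hα _) hi (hz.comp (by fun_prop) hneg)
      (fun t _ => hz0 _) (fun t ht => ?_) ?_
    · intro t ht
      simpa using key (-t) ⟨by linarith [ht.2], by linarith [ht.1]⟩
    · have := h (-t) (hneg t ht)
      rw [intervalIntegral.integral_comp_neg (fun s => α s * z s)]
      rwa [intervalIntegral.integral_symm, abs_neg, abs_of_nonneg, ← neg_zero (G := ℝ)] at this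
      exact intervalIntegral.integral_nonneg (by linarith [ht.1]) fun s _ =>
        mul_nonneg (hα s) (hz0 s)
    · rw [intervalIntegral.integral_comp_neg α]
      rw [intervalIntegral.integral_symm, abs_neg] at hR
      simp only [neg_neg, neg_zero]
      linarith [le_abs_self (∫ s in b..0, α s)]

/-- A continuity argument: a function that is at most `1 / 2` as long as it is at most `1` is at
most `1 / 2`. -/
lemma le_half_of_bootstrap {w : ℝ → ℝ} {b : ℝ} (hw : ContinuousOn w (uIcc 0 b)) (h0 : w 0 < 1)
    (h : ∀ t ∈ uIcc 0 b, (∀ r ∈ uIcc 0 t, w r ≤ 1) → w t ≤ 1 / 2) :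
    ∀ t ∈ uIcc 0 b, w t ≤ 1 / 2 := by
  have hmul : ∀ r ∈ Icc (0 : ℝ) 1, r * b ∈ uIcc 0 b := by
    intro r hr
    rcases le_total 0 b with hb | hb
    · rw [uIcc_of_le hb]
      exact ⟨mul_nonneg hr.1 hb, mul_le_of_le_one_left hb hr.2⟩
    · rw [uIcc_of_ge hb]
      exact ⟨by nlinarith [hr.2], mul_nonpos_of_nonneg_of_nonpos hr.1 hb⟩
  have hsurj : ∀ r ∈ Icc (0 : ℝ) 1, ∀ t ∈ uIcc 0 (r * b), ∃ r' ∈ Icc 0 r, t = r' * b := by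
    intro r hr t ht
    have him : (fun r' : ℝ => r' * b) '' uIcc 0 r = uIcc (0 * b) (r * b) := image_mul_const_uIcc b 0 r
    rw [zero_mul] at him
    rw [← him, uIcc_of_le hr.1] at ht
    obtain ⟨r', hr', rfl⟩ := ht
    exact ⟨r', hr', rfl⟩
  -- The parameter `r ∈ [0, 1]` along the segment from `0` to `b` treats both signs of `b` together.
  set v : ℝ → ℝ := fun r => w (r * b) with hv
  have hvc : ContinuousOn v (Icc 0 1) := hw.comp (by fun_prop) hmul
  have hlt : ∀ r ∈ Icc (0 : ℝ) 1, v r < 1 := by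
    by_contra! hcon
    obtain ⟨r₀, hr₀, hr₀'⟩ := hcon
    have hivt : ∀ r ∈ Icc (0 : ℝ) 1, 1 ≤ v r → ∃ r' ∈ Icc 0 r, v r' = 1 := by
      intro r hr h1
      obtain ⟨r', hr', he⟩ := intermediate_value_Icc hr.1
        (hvc.mono (Icc_subset_Icc le_rfl hr.2))
        (show (1 : ℝ) ∈ Icc _ _ from ⟨by simpa [hv] using h0.le, h1⟩)
      exact ⟨r', hr', he⟩
    have hcl : IsCompact (Icc (0 : ℝ) 1 ∩ v ⁻¹' {1}) :=
      isCompact_Icc.of_isClosed_subset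
        (hvc.preimage_isClosed_of_isClosed isClosed_Icc isClosed_singleton) inter_subset_left
    obtain ⟨r', hr', he⟩ := hivt r₀ hr₀ hr₀'
    -- At the first parameter where the value `1` is reached, the function has been at most `1` so
    -- far, so the hypothesis forces `1 ≤ 1/2`.
    obtain ⟨m, ⟨hm, hm1⟩, hleast⟩ := hcl.exists_isLeast ⟨r', ⟨hr'.1, hr'.2.trans hr₀.2⟩, he⟩
    have hm1 : v m = 1 := hm1
    have := h (m * b) (hmul m hm) fun t ht => by
      obtain ⟨r, hr, rfl⟩ := hsurj m hm t ht
      by_contra! hgt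
      have hr1 : r ∈ Icc (0 : ℝ) 1 := ⟨hr.1, hr.2.trans hm.2⟩
      obtain ⟨r'', hr'', he''⟩ := hivt r hr1 hgt.le
      have h2 : m ≤ r'' := hleast ⟨⟨hr''.1, hr''.2.trans hr1.2⟩, he''⟩
      have : r = m := le_antisymm hr.2 (h2.trans hr''.2)
      rw [this] at hgt
      exact absurd hm1 hgt.ne'
    rw [show w (m * b) = 1 from hm1] at this
    norm_num at this
  intro t ht
  refine h t ht fun r hr => ?_
  obtain ⟨r', hr', rfl⟩ := hsurj 1 ⟨zero_le_one, le_rfl⟩ r (by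
    rw [one_mul]
    exact uIcc_subset_uIcc left_mem_uIcc ht hr)
  exact (hlt r' hr').le

end Gronwall

/-! ### Carathéodory solutions: uniqueness, gluing, local existence -/

section Solutions

variable {N : ℕ} {g : ℝ → Euc N → Euc N} {x₀ : Euc N} {J : Set ℝ} {x : ℝ → Euc N}

/-- `J` may be open, closed or neither. A relative neighbourhood of `t` in `J` lies in a compact
interval with endpoints in `J`, and there the primitive is known to be continuous. -/
lemma continuousOn_primitive_of_integrable {V : Type*} [NormedAddCommGroup V] [NormedSpace ℝ V]
    {φ : ℝ → V} {s₀ : ℝ} (hs₀ : s₀ ∈ J)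
    (h : ∀ t ∈ J, IntervalIntegrable φ volume s₀ t) :
    ContinuousOn (fun t => ∫ s in s₀..t, φ s) J := by
  intro t ht
  obtain ⟨a, haJ, ha⟩ : ∃ a ∈ J, ∀ᶠ u in 𝓝[J] t, a ≤ u := by
    by_cases hex : ∃ a ∈ J, a < t
    · obtain ⟨a, haJ, hat⟩ := hex
      exact ⟨a, haJ,
        eventually_nhdsWithin_of_eventually_nhds ((lt_mem_nhds hat).mono fun _ => le_of_lt)⟩
    · push Not at hex
      exact ⟨t, ht, by filter_upwards [self_mem_nhdsWithin] with u hu using hex u hu⟩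
  obtain ⟨b, hbJ, hb⟩ : ∃ b ∈ J, ∀ᶠ u in 𝓝[J] t, u ≤ b := by
    by_cases hex : ∃ b ∈ J, t < b
    · obtain ⟨b, hbJ, hbt⟩ := hex
      exact ⟨b, hbJ,
        eventually_nhdsWithin_of_eventually_nhds ((gt_mem_nhds hbt).mono fun _ => le_of_lt)⟩
    · push Not at hex
      exact ⟨t, ht, by filter_upwards [self_mem_nhdsWithin] with u hu using hex u hu⟩
  have ha' : min a s₀ ∈ J := by rcases min_choice a s₀ with h | h <;> rwa [h]
  have hb' : max b s₀ ∈ J := by rcases max_choice b s₀ with h | h <;> rwa [h]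
  have hle : min a s₀ ≤ max b s₀ := (min_le_right _ _).trans (le_max_right _ _)
  have hgi : IntervalIntegrable φ volume (min a s₀) (max b s₀) := (h _ ha').symm.trans (h _ hb')
  have hc := intervalIntegral.continuousOn_primitive_interval' hgi (a := s₀)
    (by rw [uIcc_of_le hle]; exact ⟨min_le_right _ _, le_max_right _ _⟩)
  rw [uIcc_of_le hle] at hc
  have hmem : Icc (min a s₀) (max b s₀) ∈ 𝓝[J] t := by
    filter_upwards [ha, hb] with u h1 h2
    exact ⟨(min_le_left _ _).trans h1, h2.trans (le_max_left _ _)⟩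
  exact (hc t (mem_of_mem_nhdsWithin ht hmem)).mono_of_mem_nhdsWithin hmem

/-- Continuity is a consequence of the integral equation, so it never has to be checked for a newly
built solution. -/
lemma IsSolution.of_integral_eq (hJ : J.OrdConnected) (h0 : (0 : ℝ) ∈ J)
    (hi : ∀ t ∈ J, IntervalIntegrable (fun s => g s (x s)) volume 0 t)
    (he : ∀ t ∈ J, x t = x₀ + ∫ s in (0 : ℝ)..t, g s (x s)) : IsSolution g x₀ J x where
  ordConnected := hJ
  zero_mem := h0
  continuousOn := (continuousOn_const.add (continuousOn_primitive_of_integrable h0 hi)).congr he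
  integrable := hi
  eq := he

lemma IsSolution.apply_zero (h : IsSolution g x₀ J x) : x 0 = x₀ := by
  simpa using h.eq 0 h.zero_mem

lemma IsSolution.intervalIntegrable (h : IsSolution g x₀ J x) {s t : ℝ} (hs : s ∈ J) (ht : t ∈ J) :
    IntervalIntegrable (fun u => g u (x u)) volume s t :=
  (h.integrable s hs).symm.trans (h.integrable t ht)

lemma IsSolution.sub_eq (h : IsSolution g x₀ J x) {s t : ℝ} (hs : s ∈ J) (ht : t ∈ J) :
    x t - x s = ∫ u in s..t, g u (x u) := by
  rw [h.eq t ht, h.eq s hs, add_sub_add_left_eq_sub,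
    intervalIntegral.integral_interval_sub_left (h.integrable t ht) (h.integrable s hs)]

lemma IsSolution.mono (h : IsSolution g x₀ J x) {J' : Set ℝ} (hJ' : J'.OrdConnected)
    (h0 : (0 : ℝ) ∈ J') (hsub : J' ⊆ J) : IsSolution g x₀ J' x :=
  .of_integral_eq hJ' h0 (fun t ht => h.integrable t (hsub ht)) fun t ht => h.eq t (hsub ht)

lemma IsSolution.congr (h : IsSolution g x₀ J x) {y : ℝ → Euc N} (hy : EqOn y x J) :
    IsSolution g x₀ J y := by
  have hu : ∀ t ∈ J, EqOn (fun s => g s (x s)) (fun s => g s (y s)) (uIcc 0 t) := fun t ht s hs => by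
    simp only [hy (h.ordConnected.uIcc_subset h.zero_mem ht hs)]
  refine .of_integral_eq h.ordConnected h.zero_mem (fun t ht => ?_) fun t ht => ?_
  · exact (h.integrable t ht).congr ((hu t ht).mono uIoc_subset_uIcc)
  · rw [hy ht, h.eq t ht, intervalIntegral.integral_congr (hu t ht)]

/-- Solutions do not depend on the representative of the vector field. -/
lemma IsSolution.congr_ae (h : IsSolution g x₀ J x) {g' : ℝ → Euc N → Euc N}
    (hg : ∀ᵐ t : ℝ, g t = g' t) : IsSolution g' x₀ J x := by
  have hae : (fun s => g s (x s)) =ᵐ[volume] fun s => g' s (x s) := by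
    filter_upwards [hg] with s hs
    rw [hs]
  refine .of_integral_eq h.ordConnected h.zero_mem (fun t ht => ?_) fun t ht => ?_
  · exact (h.integrable t ht).congr_ae (ae_restrict_of_ae hae)
  · rw [h.eq t ht, intervalIntegral.integral_congr_ae (hae.mono fun s hs _ => hs)]

/-- The time translation of a solution. -/
lemma IsSolution.translate (h : IsSolution g x₀ J x) {s : ℝ} (hs : s ∈ J) :
    IsSolution (timeTranslate s g) (x s) ((fun u => u + s) ⁻¹' J) (fun u => x (u + s)) := by
  refine .of_integral_eq ⟨fun u hu v hv w hw => ?_⟩ (by simpa using hs) (fun t ht => ?_) fun t ht => ?_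
  · exact h.ordConnected.out hu hv ⟨by linarith [hw.1], by linarith [hw.2]⟩
  · have := (h.intervalIntegrable hs ht).comp_add_right s
    simpa [timeTranslate] using this
  · have := intervalIntegral.integral_comp_add_right (a := 0) (b := t) (fun u => g u (x u)) s
    rw [zero_add] at this
    simp only [timeTranslate]
    rw [this, ← h.sub_eq hs ht]
    abel

lemma exists_nat_bound {s t : ℝ} (hx : ContinuousOn x (uIcc s t)) :
    ∃ j : ℕ, ∀ u ∈ uIcc s t, ‖x u‖ ≤ j := by
  obtain ⟨C, hC⟩ := isCompact_uIcc.exists_bound_of_continuousOn hx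
  obtain ⟨j, hj⟩ := exists_nat_ge C
  exact ⟨j, fun u hu => (hC u hu).trans hj⟩

lemma eqOn_zero_of_le_integral {l z : ℝ → ℝ} {t : ℝ} (hl : IsL1loc l) (hl0 : ∀ s, 0 ≤ l s)
    (hz : ContinuousOn z (uIcc 0 t)) (hz0 : ∀ s, 0 ≤ z s)
    (h : ∀ r ∈ uIcc 0 t, z r ≤ |∫ s in (0 : ℝ)..r, l s * z s|) : z t = 0 := by
  obtain ⟨K, -, hK⟩ := exists_gronwall_const |∫ s in (0 : ℝ)..t, l s|
  have := hK l z 0 t le_rfl hl0 (hl 0 t) hz hz0 (by simpa using h) le_rfl t right_mem_uIcc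
  exact le_antisymm (by simpa using this) (hz0 t)

/-- Uniqueness of solutions. -/
lemma IsSolution.eqOn (hg : IsLC g) (h : IsSolution g x₀ J x) {J' : Set ℝ} {x' : ℝ → Euc N}
    (h' : IsSolution g x₀ J' x') : EqOn x x' (J ∩ J') := by
  rintro t ⟨ht, ht'⟩
  have hJ := h.ordConnected.uIcc_subset h.zero_mem ht
  have hJ' := h'.ordConnected.uIcc_subset h'.zero_mem ht'
  obtain ⟨i, hi⟩ := exists_nat_bound (h.continuousOn.mono hJ)
  obtain ⟨i', hi'⟩ := exists_nat_bound (h'.continuousOn.mono hJ')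
  obtain ⟨l, hl, hlb⟩ := hg.exists_lBound _ (isCompact_closedBall 0 ((max i i' : ℕ) : ℝ))
  have hc : ContinuousOn (fun s => ‖x s - x' s‖) (uIcc 0 t) :=
    ((h.continuousOn.mono hJ).sub (h'.continuousOn.mono hJ')).norm
  have habs : IsL1loc fun s => |l s| := fun a b => (hl a b).abs
  have := eqOn_zero_of_le_integral (l := fun s => |l s|) (z := fun s => ‖x s - x' s‖)
    habs (fun s => abs_nonneg _) hc
    (fun s => norm_nonneg _) fun r hr => by
      have hsub : uIcc 0 r ⊆ uIcc 0 t := uIcc_subset_uIcc left_mem_uIcc hr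
      rw [h.eq r (hJ hr), h'.eq r (hJ' hr), add_sub_add_left_eq_sub,
        ← intervalIntegral.integral_sub (h.integrable r (hJ hr)) (h'.integrable r (hJ' hr))]
      refine intervalIntegral.norm_integral_le_abs_of_norm_le ?_
        ((habs 0 r).mul_continuousOn (hc.mono hsub))
      filter_upwards [ae_restrict_of_ae hlb, ae_restrict_mem measurableSet_uIoc] with s hs hmem
      have hmem' := hsub (uIoc_subset_uIcc hmem)
      refine (hs _ ?_ _ ?_).trans (mul_le_mul_of_nonneg_right (le_abs_self _) (norm_nonneg _))
      · exact mem_closedBall_zero_iff.2 ((hi s hmem').trans (by exact_mod_cast le_max_left i i'))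
      · exact mem_closedBall_zero_iff.2 ((hi' s hmem').trans (by exact_mod_cast le_max_right i i'))
  exact sub_eq_zero.1 (norm_eq_zero.1 this)

/-- Two solutions glue to a solution on the union of their intervals. -/
lemma IsSolution.glue (hg : IsLC g) (h : IsSolution g x₀ J x) {s : ℝ} (hs : s ∈ J) {J₂ : Set ℝ}
    {x₂ : ℝ → Euc N} (h₂ : IsSolution (timeTranslate s g) (x s) J₂ x₂) :
    ∃ y, IsSolution g x₀ (J ∪ (fun u => u - s) ⁻¹' J₂) y := by
  classical
  let y : ℝ → Euc N := fun u => if u ∈ J then x u else x₂ (u - s)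
  have hy₁ : EqOn y x J := fun u hu => by simp [y, hu]
  -- On the overlap the two pieces agree by uniqueness for the equation translated by `s`.
  have hy₂ : ∀ u, u - s ∈ J₂ → y u = x₂ (u - s) := fun u hu => by
    by_cases huJ : u ∈ J
    · have hgs : IsLC (timeTranslate s g) := TranslationStable.timeTranslate s g hg
      have : x (u - s + s) = x₂ (u - s) :=
        (h.translate hs).eqOn hgs h₂ ⟨by simpa using huJ, hu⟩
      simp only [sub_add_cancel] at this
      rw [hy₁ huJ, this]
    · simp [y, huJ]
  have hJ₂ : OrdConnected ((fun u => u - s) ⁻¹' J₂) := ⟨fun u hu v hv w hw =>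
    h₂.ordConnected.out hu hv ⟨by linarith [hw.1], by linarith [hw.2]⟩⟩
  have hs₂ : s ∈ (fun u => u - s) ⁻¹' J₂ := by simpa using h₂.zero_mem
  have hy := h.congr hy₁
  have hi₂ : ∀ t, t - s ∈ J₂ → IntervalIntegrable (fun u => g u (y u)) volume s t ∧
      y t = x s + ∫ u in s..t, g u (y u) := by
    intro t ht
    have e : EqOn (fun u => timeTranslate s g (u - s) (x₂ (u - s))) (fun u => g u (y u)) (uIcc s t) := by
      intro u hu
      have hu' := hJ₂.uIcc_subset hs₂ ht hu
      simp only [timeTranslate, sub_add_cancel, hy₂ u hu']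
    have h1 := (h₂.integrable _ ht).comp_sub_right s
    simp only [zero_add, sub_add_cancel] at h1
    refine ⟨h1.congr (e.mono uIoc_subset_uIcc), ?_⟩
    have h3 := h₂.eq _ ht
    have h4 := intervalIntegral.integral_comp_sub_right (a := s) (b := t)
      (fun u => timeTranslate s g u (x₂ u)) s
    rw [sub_self] at h4
    rw [hy₂ t ht, h3, ← h4, intervalIntegral.integral_congr e]
  refine ⟨y, .of_integral_eq ?_ (Or.inl h.zero_mem) ?_ ?_⟩
  · exact (IsPreconnected.union s hs hs₂ h.ordConnected.isPreconnected
      hJ₂.isPreconnected).ordConnected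
  · rintro t (ht | ht)
    · exact hy.integrable t ht
    · exact (hy.integrable s hs).trans (hi₂ t ht).1
  · rintro t (ht | ht)
    · exact hy.eq t ht
    · rw [(hi₂ t ht).2, ← intervalIntegral.integral_add_adjacent_intervals (hy.integrable s hs)
        (hi₂ t ht).1, ← add_assoc, ← hy.eq s hs, hy₁ hs]

lemma abs_integral_le_of_mem {m : ℝ → ℝ} (hm : IsL1loc m) (hm0 : ∀ t, 0 ≤ m t) {δ t : ℝ}
    (ht : t ∈ Icc (-δ) δ) : |∫ s in (0 : ℝ)..t, m s| ≤ ∫ s in (-δ)..δ, m s := by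
  have hδ : -δ ≤ δ := ht.1.trans ht.2
  rw [← abs_of_nonneg (intervalIntegral.integral_nonneg hδ fun s _ => hm0 s)]
  refine intervalIntegral.abs_integral_mono_interval ?_ (Eventually.of_forall hm0) (hm _ _)
  rw [uIoc_of_le hδ, uIoc]
  exact Ioc_subset_Ioc (le_min (by linarith) ht.1) (max_le (by linarith) ht.2)

/-- Local existence by the contraction principle. -/
lemma IsLC.exists_isSolution_of_small (hg : IsLC g) {j : ℕ} {m l : ℝ → ℝ} (hm : IsL1loc m)
    (hm0 : ∀ t, 0 ≤ m t) (hmb : ∀ᵐ t : ℝ, ∀ x ∈ Metric.closedBall (0 : Euc N) (j + 1), ‖g t x‖ ≤ m t)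
    (hl : IsL1loc l) (hl0 : ∀ t, 0 ≤ l t)
    (hlb : ∀ᵐ t : ℝ, ∀ x ∈ Metric.closedBall (0 : Euc N) (j + 1),
      ∀ y ∈ Metric.closedBall (0 : Euc N) (j + 1), ‖g t x - g t y‖ ≤ l t * ‖x - y‖)
    {δ : ℝ} (hδ : 0 < δ) (hmδ : ∫ s in (-δ)..δ, m s ≤ 1) (hlδ : ∫ s in (-δ)..δ, l s ≤ 1 / 2)
    (hx₀ : ‖x₀‖ ≤ j) : ∃ x, IsSolution g x₀ (Icc (-δ) δ) x := by
  have hδ' : -δ ≤ δ := by linarith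
  let ext : C(Icc (-δ) δ, Euc N) → ℝ → Euc N := fun φ s => φ (projIcc (-δ) δ hδ' s)
  have hext : ∀ φ, Continuous (ext φ) := fun φ => φ.continuous.comp continuous_projIcc
  have hgi : ∀ φ (a b : ℝ), IntervalIntegrable (fun s => g s (ext φ s)) volume a b :=
    fun φ a b => hg.intervalIntegrable_continuousOn (hext φ).continuousOn
  -- The Picard operator acts on paths over `[-δ, δ]`, extended by constants so that interval
  -- integrals make sense without side conditions.
  let T : C(Icc (-δ) δ, Euc N) → C(Icc (-δ) δ, Euc N) := fun φ =>
    ⟨fun t => x₀ + ∫ s in (0 : ℝ)..t, g s (ext φ s), continuous_const.add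
      ((intervalIntegral.continuous_primitive (hgi φ) 0).comp continuous_subtype_val)⟩
  -- Mass at most `1` for `m` keeps paths that start in radius `j` within radius `j + 1`; mass at
  -- most `1/2` for `l` makes the operator contract.
  let S : Set C(Icc (-δ) δ, Euc N) := {φ | ∀ t, ‖φ t‖ ≤ j + 1}
  have hS : IsComplete S := by
    refine IsClosed.isComplete ?_
    have : S = ⋂ t, {φ | ‖φ t‖ ≤ j + 1} := by ext; simp [S]
    rw [this]
    exact isClosed_iInter fun t => isClosed_le (continuous_eval_const t).norm continuous_const
  have hmem : ∀ φ ∈ S, ∀ s, ext φ s ∈ Metric.closedBall (0 : Euc N) (j + 1) := fun φ hφ s =>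
    mem_closedBall_zero_iff.2 (hφ _)
  have hT : MapsTo T S S := by
    intro φ hφ t
    have h1 : ‖∫ s in (0 : ℝ)..t, g s (ext φ s)‖ ≤ |∫ s in (0 : ℝ)..t, m s| := by
      refine intervalIntegral.norm_integral_le_abs_of_norm_le ?_ (hm _ _)
      filter_upwards [ae_restrict_of_ae hmb] with s hs
      exact hs _ (hmem φ hφ s)
    have h2 := abs_integral_le_of_mem hm hm0 t.2
    calc ‖x₀ + ∫ s in (0 : ℝ)..t, g s (ext φ s)‖ ≤ ‖x₀‖ + ‖∫ s in (0 : ℝ)..t, g s (ext φ s)‖ :=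
          norm_add_le _ _
      _ ≤ j + 1 := by linarith
  have hcontr : ContractingWith (1 / 2) (hT.restrict T S S) := by
    refine ⟨by rw [← NNReal.coe_lt_coe]; norm_num, LipschitzWith.of_dist_le_mul ?_⟩
    rintro ⟨φ, hφ⟩ ⟨ψ, hψ⟩
    rw [Subtype.dist_eq, Subtype.dist_eq]
    simp only [MapsTo.val_restrict_apply]
    rw [ContinuousMap.dist_le (by positivity)]
    intro t
    change dist (x₀ + ∫ s in (0 : ℝ)..t, g s (ext φ s)) (x₀ + ∫ s in (0 : ℝ)..t, g s (ext ψ s)) ≤ _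
    rw [dist_add_left, dist_eq_norm, ← intervalIntegral.integral_sub (hgi _ _ _) (hgi _ _ _)]
    have h1 : ‖∫ s in (0 : ℝ)..t, (g s (ext φ s) - g s (ext ψ s))‖ ≤
        |∫ s in (0 : ℝ)..t, l s * dist φ ψ| := by
      refine intervalIntegral.norm_integral_le_abs_of_norm_le ?_ ((hl _ _).mul_const _)
      filter_upwards [ae_restrict_of_ae hlb] with s hs
      refine (hs _ (hmem φ hφ s) _ (hmem ψ hψ s)).trans (mul_le_mul_of_nonneg_left ?_ (hl0 s))
      rw [← dist_eq_norm]
      exact ContinuousMap.dist_apply_le_dist _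
    have h2 := abs_integral_le_of_mem hl hl0 t.2
    rw [intervalIntegral.integral_mul_const, abs_mul, abs_of_nonneg (dist_nonneg (x := φ))] at h1
    refine h1.trans ?_
    have : ((1 / 2 : NNReal) : ℝ) = 1 / 2 := by norm_num
    rw [this]
    exact mul_le_mul_of_nonneg_right (h2.trans hlδ) dist_nonneg
  obtain ⟨φ, hφ, hfix, -⟩ := hcontr.exists_fixedPoint' hS hT
    (x := ContinuousMap.const _ x₀) (fun t => by simpa using hx₀.trans (by linarith))
    (edist_ne_top _ _)
  refine ⟨ext φ, .of_integral_eq ordConnected_Icc ⟨by linarith, hδ.le⟩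
    (fun t _ => hgi φ 0 t) fun t ht => ?_⟩
  have h1 : T φ ⟨t, ht⟩ = φ ⟨t, ht⟩ := by rw [hfix]
  have h2 : ext φ t = φ ⟨t, ht⟩ := by simp only [ext, projIcc_of_mem hδ' ht]
  rw [h2, ← h1]
  rfl

lemma IsL1loc.exists_integral_le {m : ℝ → ℝ} (hm : IsL1loc m) (T : ℝ) {ε : ℝ} (hε : 0 < ε) :
    ∃ δ > 0, ∀ t, |t| ≤ T → ∀ r, 0 < r → r ≤ δ → ∫ s in (t - r)..(t + r), m s ≤ ε := by
  have hc : Continuous fun t => ∫ s in (0 : ℝ)..t, m s := intervalIntegral.continuous_primitive hm 0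
  obtain ⟨δ, hδ, h⟩ := Metric.uniformContinuousOn_iff.1
    ((isCompact_Icc (a := -T - 1) (b := T + 1)).uniformContinuousOn_of_continuous hc.continuousOn) ε hε
  refine ⟨min 1 (δ / 3), by positivity, fun t ht r hr hrδ => ?_⟩
  have h1 := hrδ.trans (min_le_left _ _)
  have h2 := hrδ.trans (min_le_right _ _)
  have ht' := abs_le.1 ht
  have := h (t + r) ⟨by linarith, by linarith⟩ (t - r) ⟨by linarith, by linarith⟩ (by
    rw [Real.dist_eq, show t + r - (t - r) = 2 * r by ring, abs_of_pos (by linarith)]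
    linarith)
  rw [Real.dist_eq, intervalIntegral.integral_interval_sub_left (hm _ _) (hm _ _)] at this
  exact (le_abs_self _).trans this.le

/-- Local existence, with a time of existence that is uniform on bounded sets. -/
lemma IsLC.exists_local_solution (hg : IsLC g) (j : ℕ) (T : ℝ) :
    ∃ δ > 0, ∀ t₀ : ℝ, |t₀| ≤ T → ∀ x₀ : Euc N, ‖x₀‖ ≤ j →
      ∃ x, IsSolution (timeTranslate t₀ g) x₀ (Icc (-δ) δ) x := by
  obtain ⟨m, hm, hmb⟩ := hg.exists_mBound _ (isCompact_closedBall (0 : Euc N) ((j : ℝ) + 1))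
  obtain ⟨l, hl, hlb⟩ := hg.exists_lBound _ (isCompact_closedBall (0 : Euc N) ((j : ℝ) + 1))
  have hm' : IsL1loc fun s => |m s| := fun a b => (hm a b).abs
  have hl' : IsL1loc fun s => |l s| := fun a b => (hl a b).abs
  -- Uniform continuity of the primitives of `|m|` and `|l|` yields one `δ` for all starting times
  -- in `[-T, T]`.
  obtain ⟨δ₁, hδ₁, h₁⟩ := hm'.exists_integral_le T one_pos
  obtain ⟨δ₂, hδ₂, h₂⟩ := hl'.exists_integral_le T one_half_pos
  have hshift : ∀ (φ : ℝ → ℝ) (t δ : ℝ),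
      ∫ s in (-δ)..δ, φ (s + t) = ∫ s in (t - δ)..(t + δ), φ s := fun φ t δ => by
    rw [intervalIntegral.integral_comp_add_right, add_comm (-δ), add_comm δ, sub_eq_add_neg]
  refine ⟨min δ₁ δ₂, lt_min hδ₁ hδ₂, fun t₀ ht₀ x₀ hx₀ => ?_⟩
  refine IsLC.exists_isSolution_of_small (TranslationStable.timeTranslate t₀ g hg)
    (m := fun s => |m (s + t₀)|) (l := fun s => |l (s + t₀)|) (hm'.comp_add_right t₀)
    (fun _ => abs_nonneg _) ?_ (hl'.comp_add_right t₀) (fun _ => abs_nonneg _) ?_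
    (lt_min hδ₁ hδ₂) ?_ ?_ hx₀
  · filter_upwards [ae_comp_add_right hmb t₀] with s hs x hx
    exact (hs x hx).trans (le_abs_self _)
  · filter_upwards [ae_comp_add_right hlb t₀] with s hs x hx y hy
    exact (hs x hx y hy).trans (mul_le_mul_of_nonneg_right (le_abs_self _) (norm_nonneg _))
  · rw [hshift (fun s => |m s|)]
    exact h₁ t₀ ht₀ _ (lt_min hδ₁ hδ₂) (min_le_left _ _)
  · rw [hshift (fun s => |l s|)]
    exact h₂ t₀ ht₀ _ (lt_min hδ₁ hδ₂) (min_le_right _ _)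

end Solutions

/-! ### Maximal solutions and continuation -/

section Maximal

variable {N : ℕ} {g : ℝ → Euc N → Euc N} {x₀ : Euc N}

/-- The maximal interval of existence. -/
def maximalInterval (g : ℝ → Euc N → Euc N) (x₀ : Euc N) : Set ℝ :=
  {t | ∃ J x, IsSolution g x₀ J x ∧ t ∈ J}

open Classical in
/-- The maximal solution. -/
noncomputable def maximalSolution (g : ℝ → Euc N → Euc N) (x₀ : Euc N) (t : ℝ) : Euc N :=
  -- Any solution reaching `t` may be chosen, since uniqueness makes the value independent of it;
  -- `0` is a default value off the interval.
  if h : t ∈ maximalInterval g x₀ then h.choose_spec.choose t else 0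

lemma maximalSolution_eq (hg : IsLC g) {J : Set ℝ} {x : ℝ → Euc N} (h : IsSolution g x₀ J x) :
    EqOn x (maximalSolution g x₀) J := by
  intro t ht
  have hmem : t ∈ maximalInterval g x₀ := ⟨J, x, h, ht⟩
  have hs := hmem.choose_spec.choose_spec
  simp only [maximalSolution, hmem, dif_pos]
  exact h.eqOn hg hs.1 ⟨ht, hs.2⟩

lemma isSolution_singleton (g : ℝ → Euc N → Euc N) (x₀ : Euc N) :
    IsSolution g x₀ {0} fun _ => x₀ :=
  .of_integral_eq ordConnected_singleton rfl (by rintro t rfl; simp) (by rintro t rfl; simp)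

lemma isSolution_maximalSolution (hg : IsLC g) (x₀ : Euc N) :
    IsSolution g x₀ (maximalInterval g x₀) (maximalSolution g x₀) := by
  refine .of_integral_eq ?_ ⟨_, _, isSolution_singleton g x₀, rfl⟩ ?_ ?_
  · have : maximalInterval g x₀ = ⋃₀ {J | ∃ x, IsSolution g x₀ J x} := by
      ext t
      simp only [maximalInterval, mem_ofPred_eq, mem_sUnion]
      exact ⟨fun ⟨J, x, h, ht⟩ => ⟨J, ⟨x, h⟩, ht⟩, fun ⟨J, ⟨x, h⟩, ht⟩ => ⟨J, x, h, ht⟩⟩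
    rw [this]
    refine (isPreconnected_sUnion 0 _ ?_ ?_).ordConnected
    · rintro J ⟨x, h⟩
      exact h.zero_mem
    · rintro J ⟨x, h⟩
      exact h.ordConnected.isPreconnected
  · rintro t ⟨J, x, h, ht⟩
    exact (h.congr (maximalSolution_eq hg h).symm).integrable t ht
  · rintro t ⟨J, x, h, ht⟩
    exact (h.congr (maximalSolution_eq hg h).symm).eq t ht

lemma isOpen_maximalInterval (hg : IsLC g) (x₀ : Euc N) : IsOpen (maximalInterval g x₀) := by
  rw [isOpen_iff_mem_nhds]
  intro t ht
  have hsol := isSolution_maximalSolution hg x₀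
  obtain ⟨j, hj⟩ := exists_nat_ge ‖maximalSolution g x₀ t‖
  obtain ⟨δ, hδ, h⟩ := hg.exists_local_solution j |t|
  obtain ⟨x, hx⟩ := h t le_rfl _ hj
  obtain ⟨y, hy⟩ := hsol.glue hg ht hx
  filter_upwards [Icc_mem_nhds (show t - δ < t by linarith) (show t < t + δ by linarith)] with u hu
  exact ⟨_, y, hy, Or.inr ⟨by linarith [hu.1], by linarith [hu.2]⟩⟩

/-- Existence of the maximal solution. -/
theorem isMaximalSolution_maximalSolution (hg : IsLC g) (x₀ : Euc N) :
    IsMaximalSolution g x₀ (maximalInterval g x₀) (maximalSolution g x₀) where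
  toIsSolution := isSolution_maximalSolution hg x₀
  isOpen := isOpen_maximalInterval hg x₀
  maximal J x h := ⟨fun _ ht => ⟨J, x, h, ht⟩, maximalSolution_eq hg h⟩

lemma IsMaximalSolution.congr_ae {J : Set ℝ} {x : ℝ → Euc N} (h : IsMaximalSolution g x₀ J x)
    {g' : ℝ → Euc N → Euc N} (hg : ∀ᵐ t : ℝ, g t = g' t) : IsMaximalSolution g' x₀ J x where
  toIsSolution := h.toIsSolution.congr_ae hg
  isOpen := h.isOpen
  maximal J' x' h' := h.maximal J' x' (h'.congr_ae (hg.mono fun _ => Eq.symm))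

variable {I : Set ℝ} {x : ℝ → Euc N}

/-- The time translation of a maximal solution. -/
lemma IsMaximalSolution.translate (hg : IsLC g) (h : IsMaximalSolution g x₀ I x) {s : ℝ}
    (hs : s ∈ I) :
    IsMaximalSolution (timeTranslate s g) (x s) ((fun u => u + s) ⁻¹' I) (fun u => x (u + s)) where
  toIsSolution := h.toIsSolution.translate hs
  isOpen := h.isOpen.preimage (by fun_prop)
  maximal J' x' h' := by
    obtain ⟨y, hy⟩ := h.toIsSolution.glue hg hs h'
    have hsub : J' ⊆ (fun u => u + s) ⁻¹' I := fun u hu =>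
      (h.maximal _ y hy).1 (Or.inr (by simpa using hu))
    have hgs : IsLC (timeTranslate s g) := TranslationStable.timeTranslate s g hg
    exact ⟨hsub, fun u hu => h'.eqOn hgs (h.toIsSolution.translate hs) ⟨hu, hsub hu⟩⟩

lemma IsMaximalSolution.unique {I' : Set ℝ} {x' : ℝ → Euc N} (h : IsMaximalSolution g x₀ I x)
    (h' : IsMaximalSolution g x₀ I' x') : I = I' ∧ EqOn x x' I :=
  ⟨Subset.antisymm (h'.maximal _ _ h.toIsSolution).1 (h.maximal _ _ h'.toIsSolution).1,
    (h'.maximal _ _ h.toIsSolution).2⟩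

/-- A maximal solution that is bounded up to `b` is defined at `b`. -/
lemma IsMaximalSolution.mem_of_bounded (hg : IsLC g) (h : IsMaximalSolution g x₀ I x) {b : ℝ}
    {j : ℕ} (hb : ∀ t ∈ uIcc 0 b, t ≠ b → t ∈ I ∧ ‖x t‖ ≤ j) : b ∈ I := by
  rcases eq_or_ne b 0 with rfl | hb0
  · exact h.zero_mem
  obtain ⟨δ, hδ, hloc⟩ := hg.exists_local_solution j |b|
  -- The solution is restarted at `(1 - η) b`, whose distance to `b` is `η |b| ≤ δ`, so the local
  -- solution from there reaches `b`.
  set η := min 1 (δ / |b|)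
  have hbpos : 0 < |b| := abs_pos.2 hb0
  have hη : 0 < η := lt_min one_pos (by positivity)
  have hη1 : η ≤ 1 := min_le_left _ _
  have hηδ : η * |b| ≤ δ := by
    rw [← le_div_iff₀ hbpos]
    exact min_le_right _ _
  have hmem : (1 - η) * b ∈ uIcc 0 b := by
    rcases le_total 0 b with h | h
    · rw [uIcc_of_le h]
      exact ⟨mul_nonneg (by linarith) h, by nlinarith⟩
    · rw [uIcc_of_ge h]
      exact ⟨by nlinarith, mul_nonpos_of_nonneg_of_nonpos (by linarith) h⟩
  have hne : (1 - η) * b ≠ b := by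
    intro he
    have : η * b = 0 := by linarith
    rcases mul_eq_zero.1 this with h | h
    · exact hη.ne' h
    · exact hb0 h
  obtain ⟨h1, h2⟩ := hb _ hmem hne
  obtain ⟨y, hy⟩ := hloc ((1 - η) * b) (by
    rw [abs_mul, abs_of_nonneg (by linarith)]
    nlinarith) _ h2
  obtain ⟨z, hz⟩ := h.toIsSolution.glue hg h1 hy
  refine (h.maximal _ z hz).1 (Or.inr ?_)
  have : b - (1 - η) * b = η * b := by ring
  rw [mem_preimage, this, mem_Icc, ← abs_le, abs_mul, abs_of_pos hη]
  exact hηδ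

/-- Continuation by an a priori bound. -/
lemma IsMaximalSolution.uIcc_subset_of_bound (hg : IsLC g) (h : IsMaximalSolution g x₀ I x) {b : ℝ}
    {j : ℕ} (hb : ∀ t ∈ uIcc 0 b, uIcc 0 t ⊆ I → ‖x t‖ ≤ j) : uIcc 0 b ⊆ I := by
  have hgood : ∀ t ∈ I, uIcc 0 t ⊆ I := fun t ht => h.ordConnected.uIcc_subset h.zero_mem ht
  have himg : ∀ r : ℝ, 0 ≤ r → (fun r' : ℝ => r' * b) '' Icc 0 r = uIcc 0 (r * b) := by
    intro r hr
    have him : (fun r' : ℝ => r' * b) '' uIcc 0 r = uIcc (0 * b) (r * b) :=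
      image_mul_const_uIcc b 0 r
    rwa [zero_mul, uIcc_of_le hr] at him
  have hsubset : ∀ r ∈ Icc (0 : ℝ) 1, uIcc 0 (r * b) ⊆ uIcc 0 b := by
    intro r hr
    rw [← himg r hr.1, ← one_mul b, ← himg 1 zero_le_one, one_mul]
    exact image_mono (Icc_subset_Icc le_rfl hr.2)
  -- Connectedness of `[0, 1]`: `S` is open because `I` is, and closed in `[0, 1]` because a bounded
  -- solution can be continued to the limit time.
  let S : Set ℝ := {r | r * b ∈ I}
  have hSopen : IsOpen S := h.isOpen.preimage (by fun_prop)
  have hScl : IsClosed (S ∩ Icc 0 1) := by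
    refine isClosed_of_closure_subset fun r hr => ?_
    have hr1 : r ∈ Icc (0 : ℝ) 1 :=
      closure_minimal inter_subset_right isClosed_Icc hr
    refine ⟨?_, hr1⟩
    refine h.mem_of_bounded hg (j := j) fun t ht hne => ?_
    rw [← himg r hr1.1] at ht
    obtain ⟨r', hr', rfl⟩ := ht
    have hlt : r' < r := lt_of_le_of_ne hr'.2 fun he => hne (by simp [he])
    obtain ⟨r'', hr'', hS, h01⟩ := mem_closure_iff_nhds.1 hr (Ioi r') (Ioi_mem_nhds hlt)
    have hmem : r' * b ∈ I := hgood _ hS (by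
      rw [← himg r'' h01.1]
      exact ⟨r', ⟨hr'.1, le_of_lt hr''⟩, rfl⟩)
    refine ⟨hmem, hb _ (hsubset r hr1 ?_) (hgood _ hmem)⟩
    rw [← himg r hr1.1]
    exact ⟨r', hr', rfl⟩
  have hall : Icc (0 : ℝ) 1 ⊆ S := by
    refine hScl.Icc_subset_of_forall_mem_nhdsWithin (by simpa [S] using h.zero_mem) fun r hr => ?_
    exact mem_nhdsWithin_of_mem_nhds (hSopen.mem_nhds hr.1)
  intro t ht
  rw [← one_mul b, ← himg 1 zero_le_one] at ht
  obtain ⟨r, hr, rfl⟩ := ht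
  exact hall hr

/-- The maximal solutions of an equation of linear growth are global. -/
lemma IsMaximalSolution.eq_univ_of_linear_growth (hg : IsLC g) (h : IsMaximalSolution g x₀ I x)
    {α β : ℝ → ℝ} (hα : IsL1loc α) (hα0 : ∀ t, 0 ≤ α t) (hβ : IsL1loc β) (hβ0 : ∀ t, 0 ≤ β t)
    (hgr : ∀ᵐ t : ℝ, ∀ y, ‖g t y‖ ≤ α t * ‖y‖ + β t) : I = univ := by
  refine eq_univ_of_forall fun b => ?_
  obtain ⟨K, hK0, hK⟩ := exists_gronwall_const |∫ s in (0 : ℝ)..b, α s|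
  obtain ⟨j, hj⟩ := exists_nat_ge (K * (‖x₀‖ + |∫ s in (0 : ℝ)..b, β s|))
  refine h.uIcc_subset_of_bound hg (b := b) (j := j) (fun t ht hsub => ?_) right_mem_uIcc
  refine le_trans ?_ hj
  have hmono : ∀ (γ : ℝ → ℝ), IsL1loc γ → (∀ t, 0 ≤ γ t) → ∀ r ∈ uIcc 0 b,
      |∫ s in (0 : ℝ)..r, γ s| ≤ |∫ s in (0 : ℝ)..b, γ s| := fun γ hγ hγ0 r hr =>
    intervalIntegral.abs_integral_mono_interval (uIoc_subset_uIoc_of_uIcc_subset_uIcc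
      (uIcc_subset_uIcc left_mem_uIcc hr)) (Eventually.of_forall hγ0) (hγ _ _)
  have hxc : ContinuousOn (fun s => ‖x s‖) (uIcc 0 t) := (h.continuousOn.mono hsub).norm
  refine hK α (fun s => ‖x s‖) (‖x₀‖ + |∫ s in (0 : ℝ)..b, β s|) t (by positivity) hα0 (hα 0 t)
    hxc (fun s => norm_nonneg _) (fun r hr => ?_) (hmono α hα hα0 t ht) t right_mem_uIcc
  have hrt : uIcc 0 r ⊆ uIcc 0 t := uIcc_subset_uIcc left_mem_uIcc hr
  have hrb : r ∈ uIcc 0 b := uIcc_subset_uIcc left_mem_uIcc ht hr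
  have hi1 : IntervalIntegrable (fun s => α s * ‖x s‖) volume 0 r :=
    (hα 0 r).mul_continuousOn (hxc.mono hrt)
  have h1 : ‖∫ s in (0 : ℝ)..r, g s (x s)‖ ≤ |∫ s in (0 : ℝ)..r, (α s * ‖x s‖ + β s)| := by
    refine intervalIntegral.norm_integral_le_abs_of_norm_le ?_ (hi1.add (hβ 0 r))
    filter_upwards [ae_restrict_of_ae hgr] with s hs
    exact hs _
  rw [intervalIntegral.integral_add hi1 (hβ 0 r)] at h1
  rw [h.eq r (hsub hr)]
  have h2 := norm_add_le x₀ (∫ s in (0 : ℝ)..r, g s (x s))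
  have h3 := abs_add_le (∫ s in (0 : ℝ)..r, α s * ‖x s‖) (∫ s in (0 : ℝ)..r, β s)
  have h4 := hmono β hβ hβ0 r hrb
  linarith

end Maximal

/-! ### Equations in the hull of `f` and continuous dependence -/

section Hull

variable {N : ℕ}

lemma IsLC.isMBound_optimalMBound {f : ℝ → Euc N → Euc N} (hf : IsLC f) (j : ℕ) :
    IsMBound f (Metric.closedBall 0 j) (optimalMBound f (Metric.closedBall 0 j)) := by
  refine ⟨hf.isL1loc_optimalMBound j, ?_⟩
  obtain ⟨m, hm⟩ := hf.exists_mBound _ (isCompact_closedBall 0 (j : ℝ))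
  filter_upwards [hm.2] with t ht x hx
  exact le_ciSup (f := fun y : Metric.closedBall (0 : Euc N) (j : ℝ) => ‖f t y‖)
    ⟨m t, by rintro _ ⟨y, rfl⟩; exact ht y y.2⟩ ⟨x, hx⟩

lemma equiBounded_hull {V : Type*} [NormedAddCommGroup V] [NormedSpace ℝ V] [MeasurableSpace V]
    [BorelSpace V] [SecondCountableTopology V] [CompleteSpace V] {Θ : SuitableModuli}
    {P : (ℝ → Euc N → V) → Prop} [WeakCaratheodoryClass Θ P] [TranslationStable P]
    {f : ℝ → Euc N → V} (hf : P f) (hm : HasEquicontMBounds f) :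
    EquiBounded (hull CSpace.translate (CSpace.mk Θ f hf)) :=
  (equiBounded_orbit hf hm).closure

variable {f : ℝ → Euc N → Euc N} {hf : IsLC f} {hfm : HasEquicontMBounds f}
  {Θ : SuitableModuli}

lemma integral_translate_optimalMBound_le (hΘ : Θ = moduliOf f hf hfm) (j : ℕ) {a b : ℝ}
    (hab : a ≤ b) (τ : ℝ) :
    ∫ u in a..b, optimalMBound f (Metric.closedBall 0 j) (u + τ) ≤
      Θ.toFun j (b - a) := by
  rw [hΘ, intervalIntegral.integral_comp_add_right]
  have h := le_ciSup (bddAbove_mBoundIntegral hf hfm j (sub_nonneg.2 hab)) (a + τ)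
  have e : mBoundIntegral f j (b - a) (a + τ) =
      ∫ u in (a + τ)..(b + τ), optimalMBound f (Metric.closedBall 0 j) u := by
    unfold mBoundIntegral
    rw [show a + τ + (b - a) = b + τ by ring]
  rw [e] at h
  exact h

/-- The elements `g` of the hull of `f` satisfy `|∫_a^b g(u, x(u)) du| ≤ θ_j(b - a)` for all
continuous `x : [a, b] → B_j`. -/
lemma norm_integral_le_of_mem_hull (hΘ : Θ = moduliOf f hf hfm) {c : LCSpace Θ N}
    (hc : c ∈ hull CSpace.translate (CSpace.mk Θ f hf)) {a b : ℝ} (hab : a ≤ b)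
    {j : ℕ} {x : ℝ → Euc N} (hx : ContinuousOn x (Icc a b))
    (hxj : MapsTo x (Icc a b) (Metric.closedBall 0 j)) :
    ‖∫ u in a..b, c.rep u (x u)‖ ≤ Θ.toFun j (b - a) := by
  have hxk : ∀ {n k : ℕ}, k < n → x (partitionPoint a b n k) ∈ Metric.closedBall (0 : Euc N) j :=
    fun hk => hxj (partitionPoint_mem hab (by omega) hk.le)
  have hEB := equiBounded_hull (Θ := Θ) hf hfm
  -- Frozen at partition points, the path becomes a constant on each piece, which `σ_Θ` can test
  -- even though `x` is not known to lie in `𝒦_j`. For translates of `f` the sum is at most the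
  -- integral of the optimal `m`-bound, hence at most `θ_j(b - a)`, and this passes to the limit.
  have hstep : ∀ n : ℕ, 0 < n → ∑ k ∈ Finset.range n,
      ‖∫ u in (partitionPoint a b n k)..(partitionPoint a b n (k + 1)),
        c.rep u (x (partitionPoint a b n k))‖ ≤ Θ.toFun j (b - a) := by
    intro n hn
    have hne : (𝓝[range fun t : ℝ => CSpace.translate t (CSpace.mk Θ f hf)] c).NeBot :=
      mem_closure_iff_nhdsWithin_neBot.1 hc
    have hlim : Tendsto (fun c' : LCSpace Θ N => ∑ k ∈ Finset.range n,
        ‖∫ u in (partitionPoint a b n k)..(partitionPoint a b n (k + 1)),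
          c'.rep u (x (partitionPoint a b n k))‖)
        (𝓝[range fun t : ℝ => CSpace.translate t (CSpace.mk Θ f hf)] c)
        (𝓝 (∑ k ∈ Finset.range n,
        ‖∫ u in (partitionPoint a b n k)..(partitionPoint a b n (k + 1)),
          c.rep u (x (partitionPoint a b n k))‖)) := by
      refine tendsto_finsetSum _ fun k hk => Tendsto.norm ?_
      rw [Metric.tendsto_nhds]
      intro ε hε
      have := hEB.eventually_integral_sub_le hc j a b (half_pos hε)
      filter_upwards [this.filter_mono (nhdsWithin_mono c subset_closure)] with c' hc'
      have hk := Finset.mem_range.1 hk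
      rw [dist_eq_norm]
      refine (hc' _ _ (partitionPoint_mem hab hn hk.le).1 (partitionPoint_le_succ hab n k)
        (partitionPoint_mem hab hn hk).2 _ (const_mem_modulusClass Θ _ _ (hxk hk))).trans_lt ?_
      linarith
    refine le_of_tendsto hlim ?_
    filter_upwards [self_mem_nhdsWithin]
    rintro _ ⟨τ, rfl⟩
    have hrep : CSpace.Represents (timeTranslate τ f) (CSpace.translate τ (CSpace.mk Θ f hf)) :=
      CSpace.Represents.translate ⟨hf, rfl⟩ τ
    have hmb := (hf.isMBound_optimalMBound j).timeTranslate τ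
    refine le_trans ?_ (integral_translate_optimalMBound_le hΘ j hab τ)
    rw [← sum_integral_partition hab (hmb.1 a b) hn]
    refine Finset.sum_le_sum fun k hk => ?_
    have hk := Finset.mem_range.1 hk
    rw [(CSpace.represents_rep _).integral_eq hrep (partitionPoint_le_succ hab n k)
      (const_mem_modulusClass Θ _ _ (hxk hk))]
    exact hmb.norm_integral_le (x := fun _ => x (partitionPoint a b n k))
      (partitionPoint_le_succ hab n k) fun _ _ => hxk hk
  -- Unfreezing uses the Lipschitz bound of the limit function only. With oscillation at most `ε /
  -- (L + 1)` on the pieces, the total error stays below `ε`.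
  obtain ⟨l, hl, hlb⟩ := c.rep_prop.exists_lBound _ (isCompact_closedBall 0 (j : ℝ))
  have hl' : IsL1loc fun s => |l s| := fun a b => (hl a b).abs
  set L := ∫ u in a..b, |l u|
  have hL : 0 ≤ L := intervalIntegral.integral_nonneg hab fun _ _ => abs_nonneg _
  refine le_of_forall_pos_le_add fun ε hε => ?_
  obtain ⟨n, hn, hosc⟩ := ((eventually_gt_atTop 0).and
    (eventually_oscillation_le hab hx (show 0 < ε / (L + 1) by positivity))).exists
  have hci : IntervalIntegrable (fun u => c.rep u (x u)) volume a b :=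
    c.rep_prop.intervalIntegrable_continuousOn (by rwa [uIcc_of_le hab])
  have hpiece : ∀ k ∈ Finset.range n,
      ‖∫ u in (partitionPoint a b n k)..(partitionPoint a b n (k + 1)), c.rep u (x u)‖ ≤
      ‖∫ u in (partitionPoint a b n k)..(partitionPoint a b n (k + 1)),
        c.rep u (x (partitionPoint a b n k))‖ +
      (∫ u in (partitionPoint a b n k)..(partitionPoint a b n (k + 1)), |l u|) * (ε / (L + 1)) := by
    intro k hk
    have hk := Finset.mem_range.1 hk
    have hle := partitionPoint_le_succ hab n k
    have hi2 : IntervalIntegrable (fun u => c.rep u (x (partitionPoint a b n k))) volume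
        (partitionPoint a b n k) (partitionPoint a b n (k + 1)) :=
      c.rep_prop.intervalIntegrable_continuousOn continuousOn_const
    have hd : ‖∫ u in (partitionPoint a b n k)..(partitionPoint a b n (k + 1)),
        (c.rep u (x u) - c.rep u (x (partitionPoint a b n k)))‖ ≤
        (∫ u in (partitionPoint a b n k)..(partitionPoint a b n (k + 1)), |l u|) *
          (ε / (L + 1)) := by
      rw [← intervalIntegral.integral_mul_const]
      refine intervalIntegral.norm_integral_le_of_norm_le hle ?_ ((hl' _ _).mul_const _)
      filter_upwards [hlb] with u hu hmem
      have hmem' := Ioc_subset_Icc_self hmem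
      refine (hu _ (hxj (partitionPoint_subset hab hk hmem')) _ (hxk hk)).trans ?_
      rw [← dist_eq_norm]
      exact mul_le_mul (le_abs_self _) (hosc k hk u hmem') dist_nonneg (abs_nonneg _)
    rw [intervalIntegral.integral_sub (hci.partition hab hk) hi2] at hd
    have := norm_add_le (∫ u in (partitionPoint a b n k)..(partitionPoint a b n (k + 1)),
        c.rep u (x (partitionPoint a b n k)))
      ((∫ u in (partitionPoint a b n k)..(partitionPoint a b n (k + 1)), c.rep u (x u)) -
        ∫ u in (partitionPoint a b n k)..(partitionPoint a b n (k + 1)),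
          c.rep u (x (partitionPoint a b n k)))
    rw [add_sub_cancel] at this
    linarith
  have hsum := Finset.sum_le_sum hpiece
  rw [Finset.sum_add_distrib, ← Finset.sum_mul, sum_integral_partition hab (hl' a b) hn] at hsum
  rw [← sum_integral_partition hab hci hn]
  refine (norm_sum_le _ _).trans (hsum.trans (add_le_add (hstep n hn) ?_))
  change L * (ε / (L + 1)) ≤ ε
  rw [mul_div_assoc', div_le_iff₀ (by positivity)]
  nlinarith

/-- Solutions of equations in the hull of `f` belong to the classes `𝒦_j`. -/
lemma IsSolution.mem_modulusClass (hΘ : Θ = moduliOf f hf hfm) {c : LCSpace Θ N}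
    (hc : c ∈ hull CSpace.translate (CSpace.mk Θ f hf)) {x₀ : Euc N} {J : Set ℝ}
    {x : ℝ → Euc N} (h : IsSolution c.rep x₀ J x) {a b : ℝ} (hJ : Icc a b ⊆ J) {j : ℕ}
    (hj : ∀ t ∈ Icc a b, ‖x t‖ ≤ j) : x ∈ modulusClass N Θ a b j := by
  have hcont := h.continuousOn.mono hJ
  have hmaps : MapsTo x (Icc a b) (Metric.closedBall 0 j) :=
    fun t ht => mem_closedBall_zero_iff.2 (hj t ht)
  refine ⟨hcont, hmaps, fun s hs t ht => ?_⟩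
  wlog hst : s ≤ t generalizing s t
  · rw [norm_sub_rev, abs_sub_comm]
    exact this t ht s hs (le_of_not_ge hst)
  have hsub : Icc s t ⊆ Icc a b := Icc_subset_Icc hs.1 ht.2
  rw [norm_sub_rev, h.sub_eq (hJ hs) (hJ ht), abs_sub_comm, abs_of_nonneg (sub_nonneg.2 hst)]
  exact norm_integral_le_of_mem_hull hΘ hc hst (hcont.mono hsub) (hmaps.mono hsub Subset.rfl)

/-- Continuous dependence of the maximal solutions. -/
lemma eventually_maximalSolution_sub_le (hΘ : Θ = moduliOf f hf hfm) {c₀ : LCSpace Θ N}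
    (hc₀ : c₀ ∈ hull CSpace.translate (CSpace.mk Θ f hf)) (x₀ : Euc N) {b : ℝ}
    (hb : uIcc 0 b ⊆ maximalInterval c₀.rep x₀) {ε : ℝ} (hε : 0 < ε) :
    ∀ᶠ z : LCSpace Θ N × Euc N in
      𝓝[hull CSpace.translate (CSpace.mk Θ f hf)] c₀ ×ˢ 𝓝 x₀,
      uIcc 0 b ⊆ maximalInterval z.1.rep z.2 ∧
      ∀ t ∈ uIcc 0 b, ‖maximalSolution z.1.rep z.2 t - maximalSolution c₀.rep x₀ t‖ ≤ ε := by
  have hs₀ := isMaximalSolution_maximalSolution c₀.rep_prop x₀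
  set x := maximalSolution c₀.rep x₀ with hx
  have hxc : ContinuousOn x (uIcc 0 b) := hs₀.continuousOn.mono hb
  obtain ⟨i, hi⟩ := exists_nat_bound hxc
  obtain ⟨l, hl, hlb⟩ := c₀.rep_prop.exists_lBound _ (isCompact_closedBall 0 ((i + 1 : ℕ) : ℝ))
  have hl' : IsL1loc fun s => |l s| := fun a b => (hl a b).abs
  -- `K` depends on `c₀` only. The radius `i + 1` leaves room for solutions within distance `1` of
  -- `x`.
  obtain ⟨K, hK0, hK⟩ := exists_gronwall_const |∫ s in (0 : ℝ)..b, (fun s => |l s|) s|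
  -- `η` is allotted twice, to the initial values and to the vector fields; Gronwall turns `2η` into
  -- at most `min ε (1/2)`, and `1/2` is what the continuity argument needs.
  set η := min (min ε (1 / 2) / (2 * K)) (1 / 2) with hη
  have hηpos : 0 < η := by positivity
  have hηK : K * (η + η) ≤ min ε (1 / 2) := by
    have : η ≤ min ε (1 / 2) / (2 * K) := min_le_left _ _
    rw [le_div_iff₀ (by positivity)] at this
    linarith
  have hev := (equiBounded_hull (Θ := Θ) hf hfm).eventually_integral_sub_le hc₀ (i + 1)
    (-|b|) |b| hηpos
  have hball : ∀ᶠ x₀' in 𝓝 x₀, ‖x₀' - x₀‖ < η := by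
    filter_upwards [Metric.ball_mem_nhds x₀ hηpos] with y hy
    rwa [← dist_eq_norm]
  filter_upwards [(hev.and self_mem_nhdsWithin).prod_mk hball]
  rintro ⟨c, x₀'⟩ ⟨⟨hc, hcH⟩, hx₀'⟩
  have hs := isMaximalSolution_maximalSolution c.rep_prop x₀'
  set x' := maximalSolution c.rep x₀' with hx'
  simp only at hx₀' hc ⊢
  have claim : ∀ t ∈ uIcc 0 b, uIcc 0 t ⊆ maximalInterval c.rep x₀' →
      (∀ r ∈ uIcc 0 t, ‖x' r - x r‖ ≤ 1) → ‖x' t - x t‖ ≤ min ε (1 / 2) := by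
    intro t ht hsub hone
    refine le_trans ?_ hηK
    have htb : uIcc 0 t ⊆ uIcc 0 b := uIcc_subset_uIcc left_mem_uIcc ht
    have hx'c : ContinuousOn x' (uIcc 0 t) := hs.continuousOn.mono hsub
    have hx'j : ∀ r ∈ uIcc 0 t, ‖x' r‖ ≤ (i + 1 : ℕ) := fun r hr => by
      have h1 := norm_add_le (x' r - x r) (x r)
      rw [sub_add_cancel] at h1
      push_cast
      linarith [hone r hr, hi r (htb hr)]
    have hzc : ContinuousOn (fun r => ‖x' r - x r‖) (uIcc 0 t) := (hx'c.sub (hxc.mono htb)).norm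
    refine hK (fun s => |l s|) (fun r => ‖x' r - x r‖) (η + η) t (by positivity)
      (fun _ => abs_nonneg _) (hl' _ _) hzc (fun _ => norm_nonneg _) (fun r hr => ?_) ?_ t
      right_mem_uIcc
    · have hrt : uIcc 0 r ⊆ uIcc 0 t := uIcc_subset_uIcc left_mem_uIcc hr
      have hmid : IntervalIntegrable (fun s => c₀.rep s (x' s)) volume 0 r :=
        c₀.rep_prop.intervalIntegrable_continuousOn (hx'c.mono hrt)
      -- The two fields are compared along `x'`, which is a test path because it solves an equation
      -- in the hull. Only `c₀` is compared at different points.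
      have e : x' r - x r = (x₀' - x₀) +
          ((∫ s in (0 : ℝ)..r, c.rep s (x' s)) - ∫ s in (0 : ℝ)..r, c₀.rep s (x' s)) +
          ∫ s in (0 : ℝ)..r, (c₀.rep s (x' s) - c₀.rep s (x s)) := by
        rw [intervalIntegral.integral_sub hmid (hs₀.integrable r (hb (htb hr))),
          hs.eq r (hsub hr), hs₀.eq r (hb (htb hr))]
        abel
      have h2 : ‖(∫ s in (0 : ℝ)..r, c.rep s (x' s)) - ∫ s in (0 : ℝ)..r, c₀.rep s (x' s)‖ ≤ η := by
        have hrb : |r| ≤ |b| := by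
          have := htb hr
          rcases le_total 0 b with h | h
          · rw [uIcc_of_le h] at this
            rw [abs_of_nonneg this.1, abs_of_nonneg h]
            exact this.2
          · rw [uIcc_of_ge h] at this
            rw [abs_of_nonpos this.2, abs_of_nonpos h]
            linarith [this.1]
        have hrb' := abs_le.1 hrb
        have hmemK : ∀ p q : ℝ, Icc p q = uIcc 0 r → x' ∈ modulusClass N Θ p q (i + 1) :=
          fun p q hpq => hs.toIsSolution.mem_modulusClass hΘ hcH
            (hpq ▸ (hrt.trans hsub)) (hpq ▸ fun s hs => hx'j s (hrt hs))
        rcases le_total 0 r with h | h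
        · exact hc 0 r (by linarith) h hrb'.2 x' (hmemK _ _ (uIcc_of_le h).symm)
        · rw [intervalIntegral.integral_symm r 0, intervalIntegral.integral_symm r 0,
            neg_sub_neg, norm_sub_rev]
          exact hc r 0 hrb'.1 h (by linarith [abs_nonneg b]) x' (hmemK _ _ (uIcc_of_ge h).symm)
      have h3 : ‖∫ s in (0 : ℝ)..r, (c₀.rep s (x' s) - c₀.rep s (x s))‖ ≤
          |∫ s in (0 : ℝ)..r, |l s| * ‖x' s - x s‖| := by
        refine intervalIntegral.norm_integral_le_abs_of_norm_le ?_
          ((hl' 0 r).mul_continuousOn (hzc.mono hrt))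
        filter_upwards [ae_restrict_of_ae hlb, ae_restrict_mem measurableSet_uIoc] with s hs hmem
        have hmem' := hrt (uIoc_subset_uIcc hmem)
        refine (hs _ ?_ _ ?_).trans (mul_le_mul_of_nonneg_right (le_abs_self _) (norm_nonneg _))
        · exact mem_closedBall_zero_iff.2 (hx'j s hmem')
        · refine mem_closedBall_zero_iff.2 ((hi s (htb hmem')).trans ?_)
          push_cast
          linarith
      change ‖x' r - x r‖ ≤ _
      rw [e]
      refine (norm_add_le _ _).trans (add_le_add ((norm_add_le _ _).trans ?_) h3)
      exact add_le_add hx₀'.le h2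
    · exact intervalIntegral.abs_integral_mono_interval (uIoc_subset_uIoc_of_uIcc_subset_uIcc htb)
        (Eventually.of_forall fun _ => abs_nonneg _) (hl' _ _)
  have hw0 : ‖x' 0 - x 0‖ < 1 := by
    rw [hs.toIsSolution.apply_zero, hs₀.toIsSolution.apply_zero]
    exact hx₀'.trans ((min_le_right _ _).trans_lt (by norm_num))
  -- The standing assumption that `x'` is within `1` of `x` improves itself to `1/2`, hence always
  -- holds. The resulting bound `i + 1` continues `x'` up to `b`.
  have hboot : ∀ t ∈ uIcc 0 b, uIcc 0 t ⊆ maximalInterval c.rep x₀' →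
      ∀ r ∈ uIcc 0 t, ‖x' r - x r‖ ≤ 1 / 2 := by
    intro t ht hsub
    have htb : uIcc 0 t ⊆ uIcc 0 b := uIcc_subset_uIcc left_mem_uIcc ht
    refine le_half_of_bootstrap ((hs.continuousOn.mono hsub).sub (hxc.mono htb)).norm hw0
      fun r hr hone => ?_
    exact (claim r (htb hr) ((uIcc_subset_uIcc left_mem_uIcc hr).trans hsub) hone).trans
      (min_le_right _ _)
  have hsub : uIcc 0 b ⊆ maximalInterval c.rep x₀' := by
    refine hs.uIcc_subset_of_bound c.rep_prop (j := i + 1) fun t ht hsub => ?_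
    have h1 := norm_add_le (x' t - x t) (x t)
    rw [sub_add_cancel] at h1
    push_cast
    linarith [hboot t ht hsub t right_mem_uIcc, hi t ht]
  refine ⟨hsub, fun t ht => ?_⟩
  have htb : uIcc 0 t ⊆ uIcc 0 b := uIcc_subset_uIcc left_mem_uIcc ht
  exact (claim t ht (htb.trans hsub) fun r hr =>
    (hboot b right_mem_uIcc hsub r (htb hr)).trans (by norm_num)).trans (min_le_left _ _)

end Hull

/-! ### Integrability of operator-valued functions applied to paths -/

section ClmApply

variable {E F : Type*} [NormedAddCommGroup E] [NormedSpace ℝ E] [NormedAddCommGroup F]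
  [NormedSpace ℝ F]

lemma IntervalIntegrable.clm_apply_continuousOn {A : ℝ → E →L[ℝ] F} {y : ℝ → E} {a b : ℝ}
    (hA : IntervalIntegrable A volume a b) (hy : ContinuousOn y (uIcc a b)) :
    IntervalIntegrable (fun t => A t (y t)) volume a b := by
  obtain ⟨C, hC⟩ := isCompact_uIcc.exists_bound_of_continuousOn hy
  rw [intervalIntegrable_iff] at hA ⊢
  refine Integrable.mono' (hA.norm.mul_const C) ?_ ?_
  · exact (ContinuousLinearMap.id ℝ (E →L[ℝ] F)).aestronglyMeasurable_comp₂ hA.aestronglyMeasurable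
      ((hy.mono uIoc_subset_uIcc).aestronglyMeasurable measurableSet_uIoc)
  · filter_upwards [ae_restrict_mem measurableSet_uIoc] with t ht
    exact ((A t).le_opNorm _).trans
      (mul_le_mul_of_nonneg_left (hC t (uIoc_subset_uIcc ht)) (norm_nonneg _))

end ClmApply

/-! ### The linear equation along a fixed path -/

section LinearField

variable {N : ℕ}

/-- The right-hand side of `ẏ = G(t, ξ(t)) y + k(t, ξ(t))`. -/
def linearField (G : ℝ → Euc N → (Euc N →L[ℝ] Euc N)) (k : ℝ → Euc N → Euc N) (ξ : ℝ → Euc N) :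
    ℝ → Euc N → Euc N := fun t y => G t (ξ t) y + k t (ξ t)

variable {G : ℝ → Euc N → (Euc N →L[ℝ] Euc N)} {k : ℝ → Euc N → Euc N}

lemma IsCaratheodory.isL1loc_norm {V : Type*} [NormedAddCommGroup V] [MeasurableSpace V]
    [BorelSpace V] [SecondCountableTopology V] {f : ℝ → Euc N → V} (hf : IsCaratheodory f)
    {ξ : ℝ → Euc N} (hξ : Continuous ξ) : IsL1loc fun t => ‖f t (ξ t)‖ := fun _ _ =>
  (hf.intervalIntegrable_continuousOn hξ.continuousOn).norm

/-- Along a fixed path the field is affine in `y`, so `|G(t, ξ(t))|` is a Lipschitz bound although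
`G` and `k` need not be Lipschitz in `x`. The theory of Lipschitz Carathéodory equations thus
applies. -/
lemma isLC_linearField (hG : IsCaratheodory G) (hk : IsCaratheodory k) {ξ : ℝ → Euc N}
    (hξ : Continuous ξ) : IsLC (linearField G k ξ) where
  measurable := by
    have h1 : Measurable fun p : ℝ × Euc N => G p.1 (ξ p.1) :=
      hG.measurable.comp (measurable_fst.prodMk (hξ.measurable.comp measurable_fst))
    have h2 : Measurable fun p : ℝ × Euc N => k p.1 (ξ p.1) :=
      hk.measurable.comp (measurable_fst.prodMk (hξ.measurable.comp measurable_fst))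
    have h3 : Measurable fun p : ℝ × Euc N => G p.1 (ξ p.1) p.2 :=
      (isBoundedBilinearMap_apply (𝕜 := ℝ) (E := Euc N) (F := Euc N)).continuous.measurable.comp
        (h1.prodMk measurable_snd)
    exact h3.add h2
  exists_mBound K hK := by
    obtain ⟨C, hC⟩ := hK.isBounded.exists_norm_le
    refine ⟨fun t => ‖G t (ξ t)‖ * C + ‖k t (ξ t)‖, fun a b =>
      ((hG.isL1loc_norm hξ a b).mul_const C).add (hk.isL1loc_norm hξ a b),
      Eventually.of_forall fun t y hy => ?_⟩
    refine (norm_add_le _ _).trans (add_le_add (((G t (ξ t)).le_opNorm y).trans ?_) le_rfl)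
    exact mul_le_mul_of_nonneg_left (hC y hy) (norm_nonneg _)
  exists_lBound K _ := by
    refine ⟨fun t => ‖G t (ξ t)‖, hG.isL1loc_norm hξ, Eventually.of_forall fun t y _ z _ => ?_⟩
    rw [linearField, linearField, add_sub_add_right_eq_sub, ← map_sub]
    exact (G t (ξ t)).le_opNorm _

lemma maximalInterval_linearField (hG : IsCaratheodory G) (hk : IsCaratheodory k) {ξ : ℝ → Euc N}
    (hξ : Continuous ξ) (y₀ : Euc N) : maximalInterval (linearField G k ξ) y₀ = univ := by
  have hLC := isLC_linearField hG hk hξ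
  refine (isMaximalSolution_maximalSolution hLC y₀).eq_univ_of_linear_growth hLC
    (hG.isL1loc_norm hξ) (fun _ => norm_nonneg _) (hk.isL1loc_norm hξ) (fun _ => norm_nonneg _)
    (Eventually.of_forall fun t y => ?_)
  exact (norm_add_le _ _).trans (add_le_add ((G t (ξ t)).le_opNorm y) le_rfl)

lemma IsSolution.congr_field {g g' : ℝ → Euc N → Euc N} {x₀ : Euc N} {J : Set ℝ} {x : ℝ → Euc N}
    (h : IsSolution g x₀ J x)
    (hg : ∀ t ∈ J, ∀ᵐ s : ℝ, s ∈ uIcc 0 t → g s (x s) = g' s (x s)) : IsSolution g' x₀ J x := by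
  refine .of_integral_eq h.ordConnected h.zero_mem (fun t ht => ?_) fun t ht => ?_
  · refine (h.integrable t ht).congr_ae ?_
    filter_upwards [ae_restrict_of_ae (hg t ht), ae_restrict_mem measurableSet_uIoc] with s hs hmem
    exact hs (uIoc_subset_uIcc hmem)
  · rw [h.eq t ht]
    congr 1
    refine intervalIntegral.integral_congr_ae ?_
    filter_upwards [hg t ht] with s hs hmem
    exact hs (uIoc_subset_uIcc hmem)

lemma IsSolution.congr_path {ξ ξ' : ℝ → Euc N} {y₀ : Euc N} {J : Set ℝ} {y : ℝ → Euc N}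
    (h : IsSolution (linearField G k ξ) y₀ J y) (hξ : EqOn ξ ξ' J) :
    IsSolution (linearField G k ξ') y₀ J y :=
  h.congr_field fun t ht => Eventually.of_forall fun s hs => by
    rw [linearField, linearField, hξ (h.ordConnected.uIcc_subset h.zero_mem ht hs)]

/-- Uniqueness for the linear equation. -/
lemma IsSolution.eqOn_linear (hG : IsCaratheodory G) (hk : IsCaratheodory k) {ξ : ℝ → Euc N}
    {y₀ : Euc N} {J : Set ℝ} {y y' : ℝ → Euc N} (hξ : ContinuousOn ξ J)
    (h : IsSolution (linearField G k ξ) y₀ J y) (h' : IsSolution (linearField G k ξ) y₀ J y') :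
    EqOn y y' J := by
  intro t ht
  have hsub : uIcc 0 t ⊆ J := h.ordConnected.uIcc_subset h.zero_mem ht
  have hle : min 0 t ≤ max 0 t := min_le_max
  -- `ξ` is continuous on `J` only; freezing it outside the segment from `0` to `t` gives a globally
  -- continuous path without changing the equation on the segment.
  have hc : Continuous (clampShift (min 0 t) (max 0 t) 0 ξ) :=
    continuous_clampShift hle (hξ.mono hsub) 0
  have heq : EqOn ξ (clampShift (min 0 t) (max 0 t) 0 ξ) (uIcc 0 t) := fun s hs =>
    (clampShift_zero_apply hs).symm
  have h1 := (h.mono ordConnected_uIcc left_mem_uIcc hsub).congr_path heq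
  have h2 := (h'.mono ordConnected_uIcc left_mem_uIcc hsub).congr_path heq
  exact h1.eqOn (isLC_linearField hG hk hc) h2 ⟨right_mem_uIcc, right_mem_uIcc⟩

/-- The solution of `ẏ = G(t, ξ(t)) y + k(t, ξ(t))`, `y(0) = y₀`, for `ξ` continuous between `0`
and `t`. -/
noncomputable def linearSolution (G : ℝ → Euc N → (Euc N →L[ℝ] Euc N)) (k : ℝ → Euc N → Euc N)
    (ξ : ℝ → Euc N) (y₀ : Euc N) (t : ℝ) : Euc N :=
  -- Each `t` has its own auxiliary equation, whose path is frozen outside the segment from `0` to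
  -- `t` and whose solutions are global.
  maximalSolution (linearField G k (clampShift (min 0 t) (max 0 t) 0 ξ)) y₀ t

/-- For two times in `J`, one of whose segments contains the other, the auxiliary equations coincide
on the smaller segment. Uniqueness therefore makes the separately defined values into one solution.
-/
lemma isSolution_linearSolution (hG : IsCaratheodory G) (hk : IsCaratheodory k) {ξ : ℝ → Euc N}
    (y₀ : Euc N) {J : Set ℝ} (hJ : J.OrdConnected) (h0 : (0 : ℝ) ∈ J) (hξ : ContinuousOn ξ J) :
    IsSolution (linearField G k ξ) y₀ J (linearSolution G k ξ y₀) := by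
  have hex : ∀ t ∈ J, IsSolution (linearField G k ξ) y₀ (uIcc 0 t)
      (maximalSolution (linearField G k (clampShift (min 0 t) (max 0 t) 0 ξ)) y₀) := by
    intro t ht
    have hsub : uIcc 0 t ⊆ J := hJ.uIcc_subset h0 ht
    have hc : Continuous (clampShift (min 0 t) (max 0 t) 0 ξ) :=
      continuous_clampShift min_le_max (hξ.mono hsub) 0
    have heq : EqOn (clampShift (min 0 t) (max 0 t) 0 ξ) ξ (uIcc 0 t) := fun s hs =>
      clampShift_zero_apply hs
    exact ((isSolution_maximalSolution (isLC_linearField hG hk hc) y₀).mono ordConnected_uIcc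
      left_mem_uIcc (by rw [maximalInterval_linearField hG hk hc]; exact subset_univ _)).congr_path
      heq
  have hsol : ∀ t ∈ J, IsSolution (linearField G k ξ) y₀ (uIcc 0 t) (linearSolution G k ξ y₀) := by
    intro t ht
    refine (hex t ht).congr fun s hs => ?_
    have hsJ : s ∈ J := hJ.uIcc_subset h0 ht hs
    refine (hex s hsJ).eqOn_linear hG hk (hξ.mono (hJ.uIcc_subset h0 hsJ))
      ((hex t ht).mono ordConnected_uIcc left_mem_uIcc ?_) right_mem_uIcc
    exact uIcc_subset_uIcc left_mem_uIcc hs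
  exact .of_integral_eq hJ h0 (fun t ht => (hsol t ht).integrable t right_mem_uIcc)
    fun t ht => (hsol t ht).eq t right_mem_uIcc

lemma isTriangularSolution_iff {g : ℝ → Euc N → Euc N} {x₀ y₀ : Euc N} {J : Set ℝ}
    {x y : ℝ → Euc N} : IsTriangularSolution g G k x₀ y₀ J x y ↔
      IsSolution g x₀ J x ∧ IsSolution (linearField G k x) y₀ J y :=
  ⟨fun h => ⟨h.toIsSolution, ⟨h.ordConnected, h.zero_mem, h.continuousOn_snd, h.integrable_snd,
    h.eq_snd⟩⟩, fun ⟨h, h'⟩ => ⟨h, h'.continuousOn, h'.integrable, h'.eq⟩⟩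

/-- The first component of any competitor is a restriction of `x`, so its second component solves
the same linear equation and uniqueness applies. The linear part never shortens the interval. -/
lemma IsMaximalSolution.triangular (hG : IsCaratheodory G) (hk : IsCaratheodory k)
    {g : ℝ → Euc N → Euc N} {x₀ y₀ : Euc N} {I : Set ℝ} {x y : ℝ → Euc N}
    (hx : IsMaximalSolution g x₀ I x) (hy : IsSolution (linearField G k x) y₀ I y) :
    IsMaximalTriangularSolution g G k x₀ y₀ I x y where
  toIsTriangularSolution := isTriangularSolution_iff.2 ⟨hx.toIsSolution, hy⟩
  isOpen := hx.isOpen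
  maximal J' x' y' h' := by
    obtain ⟨h1, h2⟩ := isTriangularSolution_iff.1 h'
    obtain ⟨hsub, heq⟩ := hx.maximal J' x' h1
    refine ⟨hsub, heq, ?_⟩
    exact (h2.congr_path heq).eqOn_linear hG hk (hx.continuousOn.mono hsub)
      (hy.mono h1.ordConnected h1.zero_mem hsub)

end LinearField

/-! ### Continuous dependence for linear equations with weakly converging coefficients -/

section LinearDependence

variable {ι : Type*} {l : Filter ι}

/-- Pointwise convergence to zero of equicontinuous functions on a compact set is uniform. -/
lemma eventually_forall_norm_le {F : Type*} [NormedAddCommGroup F] {e : ι → ℝ → F} {K : Set ℝ}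
    (hK : IsCompact K) (hpt : ∀ t ∈ K, Tendsto (fun i => e i t) l (𝓝 0))
    (heq : ∀ ε > 0, ∃ δ > 0, ∀ᶠ i in l, ∀ s ∈ K, ∀ t ∈ K, |s - t| < δ → ‖e i s - e i t‖ ≤ ε)
    {ε : ℝ} (hε : 0 < ε) : ∀ᶠ i in l, ∀ t ∈ K, ‖e i t‖ ≤ ε := by
  refine hK.induction_on (p := fun S => ∀ᶠ i in l, ∀ t ∈ S, ‖e i t‖ ≤ ε) (by simp)
    (fun S T hST hT => hT.mono fun i hi t ht => hi t (hST ht))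
    (fun S T hS hT => (hS.and hT).mono fun i hi t ht => ht.elim (hi.1 t) (hi.2 t)) fun t ht => ?_
  obtain ⟨δ, hδ, h⟩ := heq (ε / 2) (half_pos hε)
  refine ⟨Metric.ball t δ ∩ K, inter_mem (mem_nhdsWithin_of_mem_nhds (Metric.ball_mem_nhds t hδ))
    self_mem_nhdsWithin, ?_⟩
  filter_upwards [h, Metric.tendsto_nhds.1 (hpt t ht) (ε / 2) (half_pos hε)] with i hi hi' s hs
  rw [dist_zero_right] at hi'
  have h1 := hi s hs.2 t ht hs.1
  have h2 := norm_add_le (e i s - e i t) (e i t)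
  rw [sub_add_cancel] at h2
  linarith

/-- Convergence to zero of the integrals over all subintervals, with bounded total mass, implies
convergence to zero against continuous functions. -/
lemma tendsto_integral_clm_apply {E F : Type*} [NormedAddCommGroup E] [NormedSpace ℝ E]
    [NormedAddCommGroup F] [NormedSpace ℝ F] [CompleteSpace F] {B : ι → ℝ → E →L[ℝ] F} {y : ℝ → E}
    {s t C : ℝ} (hst : s ≤ t) (hy : ContinuousOn y (Icc s t))
    (hB : ∀ᶠ i in l, IntervalIntegrable (B i) volume s t ∧ ∫ u in s..t, ‖B i u‖ ≤ C)
    (hlim : ∀ c d, s ≤ c → c ≤ d → d ≤ t → Tendsto (fun i => ∫ u in c..d, B i u) l (𝓝 0)) :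
    Tendsto (fun i => ∫ u in s..t, B i u (y u)) l (𝓝 0) := by
  rw [Metric.tendsto_nhds]
  intro ε hε
  -- Freezing `y` at partition points costs this oscillation times the mass, at most `ε/2`. What
  -- remains is a finite sum of integrals of `B i` applied to fixed vectors, which tends to `0`.
  have hρ : 0 < ε / (2 * (|C| + 1)) := by positivity
  obtain ⟨n, hn, hosc⟩ := ((eventually_gt_atTop 0).and
    (eventually_oscillation_le hst hy hρ)).exists
  set p := partitionPoint s t n with hp
  have hpk : ∀ k, p k ≤ p (k + 1) := partitionPoint_le_succ hst n
  have hfin : Tendsto (fun i => ∑ k ∈ Finset.range n, ‖(∫ u in (p k)..(p (k + 1)), B i u) (y (p k))‖)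
      l (𝓝 0) := by
    rw [show (0 : ℝ) = ∑ k ∈ Finset.range n, ‖(0 : E →L[ℝ] F) (y (p k))‖ by simp]
    refine tendsto_finsetSum _ fun k hk => Tendsto.norm ?_
    have hk := Finset.mem_range.1 hk
    exact ((ContinuousLinearMap.apply ℝ F (y (p k))).continuous.tendsto 0).comp
      (hlim _ _ (partitionPoint_mem hst hn hk.le).1 (hpk k) (partitionPoint_mem hst hn hk).2)
  filter_upwards [hB, hfin.eventually (gt_mem_nhds (half_pos hε))] with i hi hsmall
  obtain ⟨hgi, hmass⟩ := hi
  have hBy : IntervalIntegrable (fun u => B i u (y u)) volume s t :=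
    hgi.clm_apply_continuousOn (by rwa [uIcc_of_le hst])
  rw [dist_zero_right, ← sum_integral_partition hst hBy hn]
  have hpiece : ∀ k ∈ Finset.range n, ‖∫ u in (p k)..(p (k + 1)), B i u (y u)‖ ≤
      ‖(∫ u in (p k)..(p (k + 1)), B i u) (y (p k))‖ +
        (∫ u in (p k)..(p (k + 1)), ‖B i u‖) * (ε / (2 * (|C| + 1))) := by
    intro k hk
    have hk := Finset.mem_range.1 hk
    have hi1 := hgi.partition hst hk
    have hi2 := hBy.partition hst hk
    have hi3 : IntervalIntegrable (fun u => B i u (y (p k))) volume (p k) (p (k + 1)) :=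
      hi1.clm_apply_continuousOn continuousOn_const
    rw [ContinuousLinearMap.intervalIntegral_apply hi1]
    have hd : ‖∫ u in (p k)..(p (k + 1)), (B i u (y u) - B i u (y (p k)))‖ ≤
        (∫ u in (p k)..(p (k + 1)), ‖B i u‖) * (ε / (2 * (|C| + 1))) := by
      rw [← intervalIntegral.integral_mul_const]
      refine intervalIntegral.norm_integral_le_of_norm_le (hpk k)
        (Eventually.of_forall fun u hu => ?_) (hi1.norm.mul_const _)
      rw [← map_sub]
      refine ((B i u).le_opNorm _).trans (mul_le_mul_of_nonneg_left ?_ (norm_nonneg _))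
      rw [← dist_eq_norm]
      exact hosc k hk u (Ioc_subset_Icc_self hu)
    rw [intervalIntegral.integral_sub hi2 hi3] at hd
    have := norm_add_le (∫ u in (p k)..(p (k + 1)), B i u (y (p k)))
      ((∫ u in (p k)..(p (k + 1)), B i u (y u)) - ∫ u in (p k)..(p (k + 1)), B i u (y (p k)))
    rw [add_sub_cancel] at this
    linarith
  refine (norm_sum_le _ _).trans_lt ((Finset.sum_le_sum hpiece).trans_lt ?_)
  rw [Finset.sum_add_distrib, ← Finset.sum_mul, sum_integral_partition hst hgi.norm hn]
  have h1 : (∫ u in s..t, ‖B i u‖) * (ε / (2 * (|C| + 1))) ≤ ε / 2 := by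
    have : ∫ u in s..t, ‖B i u‖ ≤ |C| + 1 := hmass.trans ((le_abs_self C).trans (by linarith))
    refine (mul_le_mul_of_nonneg_right this hρ.le).trans (le_of_eq ?_)
    field_simp
  linarith

variable {N : ℕ} {Θ : SuitableModuli}

/-- Convergence of integrals along converging paths in `𝒦_j`. -/
lemma EquiBounded.tendsto_integral_along {V : Type*} [NormedAddCommGroup V] [NormedSpace ℝ V]
    [MeasurableSpace V] [BorelSpace V] [SecondCountableTopology V]
    {P : (ℝ → Euc N → V) → Prop} [WeakCaratheodoryClass Θ P] {A : Set (CSpace Θ P)}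
    (hA : EquiBounded A) {c : ι → CSpace Θ P} {c₀ : CSpace Θ P} (hc₀ : c₀ ∈ A)
    (hc : Tendsto c l (𝓝[A] c₀)) {j : ℕ} {s t : ℝ} (hst : s ≤ t) {x : ι → ℝ → Euc N}
    {ξ : ℝ → Euc N} (hx : ∀ᶠ i in l, x i ∈ modulusClass N Θ s t j)
    (hξ : ξ ∈ modulusClass N Θ s t j)
    (hlim : ∀ η > 0, ∀ᶠ i in l, ∀ u ∈ Icc s t, ‖x i u - ξ u‖ ≤ η) :
    Tendsto (fun i => ∫ u in s..t, ((c i).rep u (x i u) - c₀.rep u (ξ u))) l (𝓝 0) := by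
  rw [Metric.tendsto_nhds]
  intro ε hε
  -- The function is exchanged first, along `x i`, where convergence is uniform over `𝒦_j`; then the
  -- path is exchanged in the fixed `c₀`.
  obtain ⟨η, hη, hunif⟩ := c₀.isWTC_rep.exists_integral_sub_le j hst (show 0 < ε / 4 by positivity)
  filter_upwards [hc.eventually (hA.eventually_integral_sub_le hc₀ j s t
    (show 0 < ε / 4 by positivity)), hx, hlim η hη] with i h1 h2 h3
  rw [dist_zero_right, intervalIntegral.integral_sub
    ((c i).isWTC_rep.intervalIntegrable_modulusClass hst h2)
    (c₀.isWTC_rep.intervalIntegrable_modulusClass hst hξ)]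
  have e1 := h1 s t le_rfl hst le_rfl _ h2
  have e2 := hunif _ h2 _ hξ h3
  have := norm_sub_le_norm_sub_add_norm_sub (∫ u in s..t, (c i).rep u (x i u))
    (∫ u in s..t, c₀.rep u (x i u)) (∫ u in s..t, c₀.rep u (ξ u))
  linarith

/-- Continuous dependence for the linear equation. -/
lemma eventually_linear_sub_le {A : Set (WTCSpace Θ N (Euc N →L[ℝ] Euc N))} (hA : EquiBounded A)
    {B : Set (WTCSpace Θ N (Euc N))} (hB : EquiBounded B)
    {G : ι → WTCSpace Θ N (Euc N →L[ℝ] Euc N)} {G₀ : WTCSpace Θ N (Euc N →L[ℝ] Euc N)}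
    {k : ι → WTCSpace Θ N (Euc N)} {k₀ : WTCSpace Θ N (Euc N)} (hG₀ : G₀ ∈ A) (hk₀ : k₀ ∈ B)
    (hG : Tendsto G l (𝓝[A] G₀)) (hk : Tendsto k l (𝓝[B] k₀)) {j : ℕ} {p q : ℝ} (hp : p ≤ 0)
    (hq : 0 ≤ q) {x : ι → ℝ → Euc N} {ξ : ℝ → Euc N}
    (hx : ∀ᶠ i in l, x i ∈ modulusClass N Θ p q j) (hξ : ξ ∈ modulusClass N Θ p q j)
    (hlim : ∀ η > 0, ∀ᶠ i in l, ∀ u ∈ Icc p q, ‖x i u - ξ u‖ ≤ η)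
    {y : ι → ℝ → Euc N} {υ : ℝ → Euc N} {y₀ : ι → Euc N} {υ₀ : Euc N}
    (hy : ∀ᶠ i in l, IsSolution (linearField (G i).rep (k i).rep (x i)) (y₀ i) (Icc p q) (y i))
    (hυ : IsSolution (linearField G₀.rep k₀.rep ξ) υ₀ (Icc p q) υ)
    (hy₀ : Tendsto y₀ l (𝓝 υ₀)) {ε : ℝ} (hε : 0 < ε) :
    ∀ᶠ i in l, ∀ t ∈ Icc p q, ‖y i t - υ t‖ ≤ ε := by
  have hpq : p ≤ q := hp.trans hq
  have hsubK : ∀ {s t : ℝ} {z : ℝ → Euc N}, z ∈ modulusClass N Θ p q j → p ≤ s → t ≤ q →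
      z ∈ modulusClass N Θ s t j := fun hz hs ht =>
    modulusClass_mono_interval hz (Icc_subset_Icc hs ht)
  obtain ⟨C, hC⟩ := hA.exists_integral_le j hpq
  obtain ⟨M, hM⟩ := isCompact_Icc.exists_bound_of_continuousOn hυ.continuousOn
  have hM0 : 0 ≤ M := (norm_nonneg _).trans (hM 0 ⟨hp, hq⟩)
  have hGA : ∀ᶠ i in l, G i ∈ A := hG.eventually self_mem_nhdsWithin
  have hkB : ∀ᶠ i in l, k i ∈ B := hk.eventually self_mem_nhdsWithin
  have hGi : ∀ {c : WTCSpace Θ N (Euc N →L[ℝ] Euc N)} {z : ℝ → Euc N} {s t : ℝ},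
      z ∈ modulusClass N Θ p q j → p ≤ s → s ≤ t → t ≤ q →
      IntervalIntegrable (fun u => c.rep u (z u)) volume s t := fun hz hs hst ht =>
    CSpace.isWTC_rep _ |>.intervalIntegrable_modulusClass hst (hsubK hz hs ht)
  have hki : ∀ {c : WTCSpace Θ N (Euc N)} {z : ℝ → Euc N} {s t : ℝ},
      z ∈ modulusClass N Θ p q j → p ≤ s → s ≤ t → t ≤ q →
      IntervalIntegrable (fun u => c.rep u (z u)) volume s t := fun hz hs hst ht =>
    CSpace.isWTC_rep _ |>.intervalIntegrable_modulusClass hst (hsubK hz hs ht)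
  -- `D i` is the defect of the limit solution `υ` in the `i`-th equation. It need not tend to `0`
  -- pointwise, but its primitive tends to `0` uniformly, and the Gronwall argument needs no more.
  let D : ι → ℝ → Euc N := fun i u =>
    ((G i).rep u (x i u) - G₀.rep u (ξ u)) (υ u) + ((k i).rep u (x i u) - k₀.rep u (ξ u))
  have hDi : ∀ᶠ i in l, IntervalIntegrable (D i) volume p q := by
    filter_upwards [hx] with i hxi
    exact (((hGi hxi le_rfl hpq le_rfl).sub (hGi hξ le_rfl hpq le_rfl)).clm_apply_continuousOn
      (by rw [uIcc_of_le hpq]; exact hυ.continuousOn)).add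
      ((hki hxi le_rfl hpq le_rfl).sub (hki hξ le_rfl hpq le_rfl))
  have hDlim : ∀ s t, p ≤ s → s ≤ t → t ≤ q → Tendsto (fun i => ∫ u in s..t, D i u) l (𝓝 0) := by
    intro s t hs hst ht
    have hυst : ContinuousOn υ (Icc s t) := hυ.continuousOn.mono (Icc_subset_Icc hs ht)
    have l1 : Tendsto (fun i => ∫ u in s..t, ((G i).rep u (x i u) - G₀.rep u (ξ u)) (υ u)) l (𝓝 0) := by
      refine tendsto_integral_clm_apply (C := C + C) hst hυst ?_ fun c d hc hcd hd => ?_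
      · filter_upwards [hGA, hx] with i hi hxi
        refine ⟨(hGi hxi hs hst ht).sub (hGi hξ hs hst ht), ?_⟩
        have m1 : ∀ {c : WTCSpace Θ N (Euc N →L[ℝ] Euc N)} {z : ℝ → Euc N}, c ∈ A →
            z ∈ modulusClass N Θ p q j → ∫ u in s..t, ‖c.rep u (z u)‖ ≤ C := fun hc hz =>
          (intervalIntegral.integral_mono_interval hs hst ht
            (Eventually.of_forall fun _ => norm_nonneg _) (hGi hz le_rfl hpq le_rfl).norm).trans
            (hC _ hc _ hz)
        refine le_trans ?_ (add_le_add (m1 hi hxi) (m1 hG₀ hξ))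
        rw [← intervalIntegral.integral_add (hGi hxi hs hst ht).norm (hGi hξ hs hst ht).norm]
        exact intervalIntegral.integral_mono_on hst
          ((hGi hxi hs hst ht).sub (hGi hξ hs hst ht)).norm
          ((hGi hxi hs hst ht).norm.add (hGi hξ hs hst ht).norm) fun u _ => norm_sub_le _ _
      · exact hA.tendsto_integral_along hG₀ hG hcd
          (hx.mono fun i hxi => hsubK hxi (hs.trans hc) (hd.trans ht))
          (hsubK hξ (hs.trans hc) (hd.trans ht))
          fun η hη => (hlim η hη).mono fun i hi u hu =>
            hi u ⟨(hs.trans hc).trans hu.1, hu.2.trans (hd.trans ht)⟩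
    have l2 := hB.tendsto_integral_along hk₀ hk hst (hx.mono fun i hxi => hsubK hxi hs ht)
      (hsubK hξ hs ht) fun η hη => (hlim η hη).mono fun i hi u hu =>
        hi u ⟨hs.trans hu.1, hu.2.trans ht⟩
    have l3 := l1.add l2
    rw [add_zero] at l3
    refine l3.congr' ?_
    filter_upwards [hx] with i hxi
    rw [← intervalIntegral.integral_add]
    · exact ((hGi hxi hs hst ht).sub (hGi hξ hs hst ht)).clm_apply_continuousOn
        (by rwa [uIcc_of_le hst])
    · exact (hki hxi hs hst ht).sub (hki hξ hs hst ht)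
  have hunif : ∀ η > 0, ∀ᶠ i in l, ∀ t ∈ Icc p q, ‖∫ u in (0 : ℝ)..t, D i u‖ ≤ η := by
    intro η hη
    refine eventually_forall_norm_le isCompact_Icc (fun t ht => ?_) (fun ρ hρ => ?_) hη
    · rcases le_total 0 t with h | h
      · exact hDlim 0 t hp h ht.2
      · have := (hDlim t 0 ht.1 h hq).neg
        rw [neg_zero] at this
        refine this.congr fun i => ?_
        rw [intervalIntegral.integral_symm, neg_neg]
    · obtain ⟨δ₁, hδ₁, h₁⟩ := hA j (ρ / (4 * (M + 1))) (by positivity)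
      obtain ⟨δ₂, hδ₂, h₂⟩ := hB j (ρ / 4) (by positivity)
      -- The two `G`-terms, multiplied by `M`, contribute at most `ρ/2`, and the two `k`-terms
      -- contribute `ρ/4` each.
      refine ⟨min δ₁ δ₂, lt_min hδ₁ hδ₂, ?_⟩
      filter_upwards [hGA, hkB, hx, hDi] with i hi hki' hxi hDi s hs t ht hst
      have h0 : ∀ r ∈ Icc p q, IntervalIntegrable (D i) volume 0 r := fun r hr => by
        refine hDi.mono_set ?_
        rw [uIcc_of_le hpq]
        exact ordConnected_Icc.uIcc_subset ⟨hp, hq⟩ hr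
      wlog hle : s ≤ t generalizing s t
      · rw [norm_sub_rev]
        exact this t ht s hs (by rwa [abs_sub_comm]) (le_of_not_ge hle)
      rw [abs_sub_comm, abs_of_nonneg (sub_nonneg.2 hle)] at hst
      rw [norm_sub_rev, intervalIntegral.integral_interval_sub_left (h0 t ht) (h0 s hs)]
      have g1 := hGi (c := G i) hxi hs.1 hle ht.2
      have g2 := hGi (c := G₀) hξ hs.1 hle ht.2
      have g3 := hki (c := k i) hxi hs.1 hle ht.2
      have g4 := hki (c := k₀) hξ hs.1 hle ht.2
      have hbound : ‖∫ u in s..t, D i u‖ ≤ ∫ u in s..t,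
          ((‖(G i).rep u (x i u)‖ + ‖G₀.rep u (ξ u)‖) * M +
            (‖(k i).rep u (x i u)‖ + ‖k₀.rep u (ξ u)‖)) := by
        refine intervalIntegral.norm_integral_le_of_norm_le hle
          (Eventually.of_forall fun u hu => ?_)
          (((g1.norm.add g2.norm).mul_const M).add (g3.norm.add g4.norm))
        refine (norm_add_le _ _).trans (add_le_add ?_ (norm_sub_le _ _))
        refine (ContinuousLinearMap.le_opNorm _ _).trans ?_
        exact mul_le_mul (norm_sub_le _ _) (hM u ⟨hs.1.trans hu.1.le, hu.2.trans ht.2⟩)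
          (norm_nonneg _) (by positivity)
      rw [intervalIntegral.integral_add ((g1.norm.add g2.norm).mul_const M) (g3.norm.add g4.norm),
        intervalIntegral.integral_mul_const, intervalIntegral.integral_add g1.norm g2.norm,
        intervalIntegral.integral_add g3.norm g4.norm] at hbound
      have b1 := h₁ _ hi s t hle (hst.trans_le (min_le_left _ _)) _ (hsubK hxi hs.1 ht.2)
      have b2 := h₁ _ hG₀ s t hle (hst.trans_le (min_le_left _ _)) _ (hsubK hξ hs.1 ht.2)
      have b3 := h₂ _ hki' s t hle (hst.trans_le (min_le_right _ _)) _ (hsubK hxi hs.1 ht.2)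
      have b4 := h₂ _ hk₀ s t hle (hst.trans_le (min_le_right _ _)) _ (hsubK hξ hs.1 ht.2)
      have b5 : ((∫ u in s..t, ‖(G i).rep u (x i u)‖) + ∫ u in s..t, ‖G₀.rep u (ξ u)‖) * M ≤
          ρ / 2 := by
        have : ρ / (4 * (M + 1)) * (4 * (M + 1)) = ρ := by field_simp
        have h3 : 0 < ρ / (4 * (M + 1)) := by positivity
        refine (mul_le_mul_of_nonneg_right (add_le_add b1 b2) hM0).trans ?_
        nlinarith
      linarith
  -- `C` bounds the mass of `G i` along `x i` for all members of `A`, so one Gronwall constant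
  -- serves every `i`.
  obtain ⟨K, hK0, hK⟩ := exists_gronwall_const C
  have hηpos : 0 < ε / (2 * K) := by positivity
  have hclose : ∀ᶠ i in l, ‖y₀ i - υ₀‖ < ε / (2 * K) := by
    filter_upwards [Metric.tendsto_nhds.1 hy₀ _ hηpos] with i hi
    rwa [← dist_eq_norm]
  filter_upwards [hGA, hx, hDi, hunif _ hηpos, hclose, hy] with i hi hxi hDi hDu hcl hyi t ht
  have h0t : uIcc 0 t ⊆ Icc p q := ordConnected_Icc.uIcc_subset ⟨hp, hq⟩ ht
  have hAi : IntervalIntegrable (fun u => (G i).rep u (x i u)) volume p q :=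
    hGi hxi le_rfl hpq le_rfl
  have hmono : ∀ {r : ℝ}, r ∈ Icc p q → uIcc 0 r ⊆ uIcc p q := fun hr => by
    rw [uIcc_of_le hpq]
    exact ordConnected_Icc.uIcc_subset ⟨hp, hq⟩ hr
  have hzc : ContinuousOn (fun u => y i u - υ u) (Icc p q) := hyi.continuousOn.sub hυ.continuousOn
  have key := hK (fun u => ‖(G i).rep u (x i u)‖) (fun u => ‖y i u - υ u‖)
    (ε / (2 * K) + ε / (2 * K)) t (by positivity) (fun _ => norm_nonneg _)
    (hAi.mono_set (hmono ht)).norm (hzc.mono h0t).norm (fun _ => norm_nonneg _) (fun r hr => ?_) ?_ t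
    right_mem_uIcc
  · refine key.trans (le_of_eq ?_)
    field_simp
    ring
  · have hr' := h0t hr
    have h0r := hmono hr'
    have hzr : ContinuousOn (fun u => y i u - υ u) (uIcc 0 r) :=
      hzc.mono (ordConnected_Icc.uIcc_subset ⟨hp, hq⟩ hr')
    have hAz : IntervalIntegrable (fun u => (G i).rep u (x i u) (y i u - υ u)) volume 0 r :=
      (hAi.mono_set h0r).clm_apply_continuousOn hzr
    have e : y i r - υ r = (y₀ i - υ₀) + (∫ u in (0 : ℝ)..r, D i u) +
        ∫ u in (0 : ℝ)..r, (G i).rep u (x i u) (y i u - υ u) := by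
      rw [hyi.eq r hr', hυ.eq r hr', add_sub_add_comm,
        ← intervalIntegral.integral_sub (hyi.integrable r hr') (hυ.integrable r hr'), add_assoc,
        ← intervalIntegral.integral_add (hDi.mono_set h0r) hAz]
      congr 1
      refine intervalIntegral.integral_congr fun u _ => ?_
      simp only [linearField, D, map_sub, sub_apply]
      abel
    have h3 : ‖∫ u in (0 : ℝ)..r, (G i).rep u (x i u) (y i u - υ u)‖ ≤
        |∫ u in (0 : ℝ)..r, ‖(G i).rep u (x i u)‖ * ‖y i u - υ u‖| :=
      intervalIntegral.norm_integral_le_abs_of_norm_le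
        (Eventually.of_forall fun u => ContinuousLinearMap.le_opNorm _ _)
        ((hAi.mono_set h0r).norm.mul_continuousOn hzr.norm)
    change ‖y i r - υ r‖ ≤ _
    rw [e]
    refine (norm_add_le _ _).trans (add_le_add ((norm_add_le _ _).trans ?_) h3)
    exact add_le_add hcl.le (hDu r hr')
  · refine le_trans ?_ (hC _ hi _ hxi)
    rw [← abs_of_nonneg (intervalIntegral.integral_nonneg hpq fun u _ =>
      norm_nonneg ((G i).rep u (x i u)))]
    exact intervalIntegral.abs_integral_mono_interval
      (uIoc_subset_uIoc_of_uIcc_subset_uIcc (hmono ht))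
      (Eventually.of_forall fun _ => norm_nonneg _) hAi.norm

end LinearDependence

/-! ### Cocycle property and joint continuity for systems in the hull -/

section LimitSystems

variable {N : ℕ} {Θ : SuitableModuli}

lemma CSpace.isMaximalSolution_of_represents (c : LCSpace Θ N) (x₀ : Euc N)
    {g : ℝ → Euc N → Euc N} (hg : CSpace.Represents g c) :
    IsMaximalSolution g x₀ (maximalInterval c.rep x₀) (maximalSolution c.rep x₀) :=
  (isMaximalSolution_maximalSolution c.rep_prop x₀).congr_ae
    (c.rep_prop.ae_eq_of_ae_eq hg.1 (c.represents_rep.ae_eq hg))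

/-- The cocycle property of the maximal solutions. -/
lemma CSpace.maximal_translate (c : LCSpace Θ N) {x₀ : Euc N} {s : ℝ}
    (hs : s ∈ maximalInterval c.rep x₀) :
    maximalInterval (CSpace.translate s c).rep (maximalSolution c.rep x₀ s) =
        (fun u => u + s) ⁻¹' maximalInterval c.rep x₀ ∧
      EqOn (maximalSolution (CSpace.translate s c).rep (maximalSolution c.rep x₀ s))
        (fun u => maximalSolution c.rep x₀ (u + s))
        (maximalInterval (CSpace.translate s c).rep (maximalSolution c.rep x₀ s)) :=
  ((CSpace.translate s c).isMaximalSolution_of_represents _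
    (c.represents_rep.translate s)).unique
    ((isMaximalSolution_maximalSolution c.rep_prop x₀).translate c.rep_prop hs)

/-- Joint continuity at `t` needs a compact interval that contains the initial time and has `t` in
its interior, so that nearby times stay inside. -/
lemma exists_Icc_subset_of_mem {I : Set ℝ} (hI : IsOpen I) (hc : I.OrdConnected) (h0 : (0 : ℝ) ∈ I)
    {t : ℝ} (ht : t ∈ I) : ∃ p q : ℝ, p ≤ 0 ∧ 0 ≤ q ∧ t ∈ Ioo p q ∧ Icc p q ⊆ I := by
  have hlo : min 0 t ∈ I := by rcases min_choice 0 t with h | h <;> rwa [h]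
  have hhi : max 0 t ∈ I := by rcases max_choice 0 t with h | h <;> rwa [h]
  obtain ⟨p, hp, hpI⟩ := ((mem_nhdsLT_iff_exists_Ioo_subset' (sub_one_lt _)).1
    (mem_nhdsWithin_of_mem_nhds (hI.mem_nhds hlo))).imp fun p hp => hp
  obtain ⟨q, hq, hqI⟩ := ((mem_nhdsGT_iff_exists_Ioo_subset' (lt_add_one _)).1
    (mem_nhdsWithin_of_mem_nhds (hI.mem_nhds hhi))).imp fun q hq => hq
  have hp : p < min 0 t := hp
  have hq : max 0 t < q := hq
  have hp' : (p + min 0 t) / 2 ∈ I := hpI ⟨by linarith, by linarith⟩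
  have hq' : (max 0 t + q) / 2 ∈ I := hqI ⟨by linarith, by linarith⟩
  have a1 := min_le_left 0 t
  have a2 := min_le_right 0 t
  have a3 := le_max_left 0 t
  have a4 := le_max_right 0 t
  exact ⟨_, _, by linarith, by linarith, ⟨by linarith, by linarith⟩, hc.out hp' hq'⟩

variable {f : ℝ → Euc N → Euc N} {hf : IsLC f} {hfm : HasEquicontMBounds f}
  {ι : Type*} {l : Filter ι}

lemma eventually_maximalSolution_Icc (hΘ : Θ = moduliOf f hf hfm) {c₀ : LCSpace Θ N}
    (hc₀ : c₀ ∈ hull CSpace.translate (CSpace.mk Θ f hf)) {x₀ : Euc N} {p q : ℝ} (hp : p ≤ 0)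
    (hq : 0 ≤ q) (hpq : Icc p q ⊆ maximalInterval c₀.rep x₀) {c : ι → LCSpace Θ N} {x : ι → Euc N}
    (hc : Tendsto c l (𝓝[hull CSpace.translate (CSpace.mk Θ f hf)] c₀))
    (hx : Tendsto x l (𝓝 x₀)) {ε : ℝ} (hε : 0 < ε) :
    ∀ᶠ i in l, Icc p q ⊆ maximalInterval (c i).rep (x i) ∧ ∀ t ∈ Icc p q,
      ‖maximalSolution (c i).rep (x i) t - maximalSolution c₀.rep x₀ t‖ ≤ ε := by
  have hsplit : Icc p q = uIcc 0 p ∪ uIcc 0 q := by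
    rw [uIcc_of_ge hp, uIcc_of_le hq, Icc_union_Icc_eq_Icc hp hq]
  rw [hsplit, union_subset_iff] at hpq
  have h1 := (hc.prodMk hx).eventually (eventually_maximalSolution_sub_le hΘ hc₀ x₀ hpq.1 hε)
  have h2 := (hc.prodMk hx).eventually (eventually_maximalSolution_sub_le hΘ hc₀ x₀ hpq.2 hε)
  filter_upwards [h1, h2] with i hi hi'
  rw [hsplit]
  exact ⟨union_subset hi.1 hi'.1, fun t ht => ht.elim (hi.2 t) (hi'.2 t)⟩

lemma tendsto_of_eventually_sub_le {E : Type*} [NormedAddCommGroup E] {y : ι → ℝ → E} {υ : ℝ → E}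
    {p q t₀ : ℝ} (ht₀ : t₀ ∈ Ioo p q) (hυ : ContinuousOn υ (Icc p q))
    (h : ∀ ε > 0, ∀ᶠ i in l, ∀ t ∈ Icc p q, ‖y i t - υ t‖ ≤ ε) {t : ι → ℝ}
    (ht : Tendsto t l (𝓝 t₀)) : Tendsto (fun i => y i (t i)) l (𝓝 (υ t₀)) := by
  have h1 : Tendsto (fun i => υ (t i)) l (𝓝 (υ t₀)) :=
    (hυ.continuousAt (Icc_mem_nhds ht₀.1 ht₀.2)).tendsto.comp ht
  have h2 : Tendsto (fun i => y i (t i) - υ (t i)) l (𝓝 0) := by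
    rw [Metric.tendsto_nhds]
    intro ε hε
    filter_upwards [h (ε / 2) (half_pos hε), ht.eventually (Icc_mem_nhds ht₀.1 ht₀.2)] with i hi hti
    rw [dist_zero_right]
    exact (hi _ hti).trans_lt (half_lt_self hε)
  simpa using h2.add h1

/-- Joint continuity of the maximal solutions, and openness of their domain. -/
lemma tendsto_maximalSolution (hΘ : Θ = moduliOf f hf hfm) {c₀ : LCSpace Θ N}
    (hc₀ : c₀ ∈ hull CSpace.translate (CSpace.mk Θ f hf)) {x₀ : Euc N} {t₀ : ℝ}
    (ht₀ : t₀ ∈ maximalInterval c₀.rep x₀) {c : ι → LCSpace Θ N} {x : ι → Euc N} {t : ι → ℝ}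
    (hc : Tendsto c l (𝓝[hull CSpace.translate (CSpace.mk Θ f hf)] c₀))
    (hx : Tendsto x l (𝓝 x₀)) (ht : Tendsto t l (𝓝 t₀)) :
    (∀ᶠ i in l, t i ∈ maximalInterval (c i).rep (x i)) ∧
      Tendsto (fun i => maximalSolution (c i).rep (x i) (t i)) l
        (𝓝 (maximalSolution c₀.rep x₀ t₀)) := by
  have hs := isMaximalSolution_maximalSolution c₀.rep_prop x₀
  obtain ⟨p, q, hp, hq, htpq, hpq⟩ :=
    exists_Icc_subset_of_mem hs.isOpen hs.ordConnected hs.zero_mem ht₀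
  have hev := fun ε hε => eventually_maximalSolution_Icc hΘ hc₀ hp hq hpq hc hx (ε := ε) hε
  refine ⟨?_, tendsto_of_eventually_sub_le htpq (hs.continuousOn.mono hpq)
    (fun ε hε => (hev ε hε).mono fun i hi => hi.2) ht⟩
  filter_upwards [hev 1 one_pos, ht.eventually (Icc_mem_nhds htpq.1 htpq.2)] with i hi hti
  exact hi.1 hti

/-- Joint continuity of the second component of the solutions of the triangular systems. -/
lemma tendsto_linearSolution (hΘ : Θ = moduliOf f hf hfm) {c₀ : LCSpace Θ N}
    (hc₀ : c₀ ∈ hull CSpace.translate (CSpace.mk Θ f hf)) {x₀ : Euc N} {t₀ : ℝ}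
    (ht₀ : t₀ ∈ maximalInterval c₀.rep x₀) {c : ι → LCSpace Θ N} {x : ι → Euc N} {t : ι → ℝ}
    (hc : Tendsto c l (𝓝[hull CSpace.translate (CSpace.mk Θ f hf)] c₀))
    (hx : Tendsto x l (𝓝 x₀)) (ht : Tendsto t l (𝓝 t₀))
    {A : Set (WTCSpace Θ N (Euc N →L[ℝ] Euc N))} (hA : EquiBounded A)
    {B : Set (WTCSpace Θ N (Euc N))} (hB : EquiBounded B)
    {G : ι → WTCSpace Θ N (Euc N →L[ℝ] Euc N)} {G₀ : WTCSpace Θ N (Euc N →L[ℝ] Euc N)}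
    {k : ι → WTCSpace Θ N (Euc N)} {k₀ : WTCSpace Θ N (Euc N)} (hG₀ : G₀ ∈ A) (hk₀ : k₀ ∈ B)
    (hG : Tendsto G l (𝓝[A] G₀)) (hk : Tendsto k l (𝓝[B] k₀)) {y₀ : ι → Euc N} {υ₀ : Euc N}
    (hy₀ : Tendsto y₀ l (𝓝 υ₀)) :
    Tendsto (fun i => linearSolution (G i).rep (k i).rep (maximalSolution (c i).rep (x i))
      (y₀ i) (t i)) l
      (𝓝 (linearSolution G₀.rep k₀.rep (maximalSolution c₀.rep x₀) υ₀ t₀)) := by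
  have hs := isMaximalSolution_maximalSolution c₀.rep_prop x₀
  obtain ⟨p, q, hp, hq, htpq, hpq⟩ :=
    exists_Icc_subset_of_mem hs.isOpen hs.ordConnected hs.zero_mem ht₀
  have hpq' : p ≤ q := hp.trans hq
  have hev := fun ε hε => eventually_maximalSolution_Icc hΘ hc₀ hp hq hpq hc hx (ε := ε) hε
  have hcH : ∀ᶠ i in l, c i ∈ hull CSpace.translate (CSpace.mk Θ f hf) :=
    hc.eventually self_mem_nhdsWithin
  have hscont := hs.continuousOn.mono hpq
  obtain ⟨j, hj⟩ := exists_nat_bound (by rwa [uIcc_of_le hpq'] : ContinuousOn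
    (maximalSolution c₀.rep x₀) (uIcc p q))
  rw [uIcc_of_le hpq'] at hj
  -- The index is `j + 1` so that the nearby solutions, within `1` of this one, belong to the same
  -- class.
  have hξ : maximalSolution c₀.rep x₀ ∈ modulusClass N Θ p q (j + 1) :=
    hs.toIsSolution.mem_modulusClass hΘ hc₀ hpq fun t ht => (hj t ht).trans (by simp)
  have hxK : ∀ᶠ i in l, maximalSolution (c i).rep (x i) ∈ modulusClass N Θ p q (j + 1) := by
    filter_upwards [hev 1 one_pos, hcH] with i hi hciH
    refine (isSolution_maximalSolution (c i).rep_prop (x i)).mem_modulusClass hΘ hciH hi.1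
      fun t ht => ?_
    have h1 := norm_add_le (maximalSolution (c i).rep (x i) t - maximalSolution c₀.rep x₀ t)
      (maximalSolution c₀.rep x₀ t)
    rw [sub_add_cancel] at h1
    push_cast
    linarith [hi.2 t ht, hj t ht]
  have h0 : (0 : ℝ) ∈ Icc p q := ⟨hp, hq⟩
  have hυ : IsSolution (linearField G₀.rep k₀.rep (maximalSolution c₀.rep x₀)) υ₀ (Icc p q)
      (linearSolution G₀.rep k₀.rep (maximalSolution c₀.rep x₀) υ₀) :=
    isSolution_linearSolution G₀.isWTC_rep.toIsCaratheodory k₀.isWTC_rep.toIsCaratheodory υ₀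
      ordConnected_Icc h0 hscont
  have hy : ∀ᶠ i in l, IsSolution
      (linearField (G i).rep (k i).rep (maximalSolution (c i).rep (x i))) (y₀ i) (Icc p q)
      (linearSolution (G i).rep (k i).rep (maximalSolution (c i).rep (x i)) (y₀ i)) := by
    filter_upwards [hev 1 one_pos] with i hi
    exact isSolution_linearSolution (G i).isWTC_rep.toIsCaratheodory
      (k i).isWTC_rep.toIsCaratheodory _ ordConnected_Icc h0
      ((isSolution_maximalSolution (c i).rep_prop (x i)).continuousOn.mono hi.1)
  exact tendsto_of_eventually_sub_le htpq hυ.continuousOn (fun ε hε =>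
    eventually_linear_sub_le hA hB hG₀ hk₀ hG hk hp hq hxK hξ
      (fun η hη => (hev η hη).mono fun i hi => hi.2) hy hυ hy₀ hε) ht

/-- The solution of the triangular system for arbitrary representatives. -/
lemma isMaximalTriangularSolution_of_represents (hΘ : Θ = moduliOf f hf hfm) {c : LCSpace Θ N}
    (hc : c ∈ hull CSpace.translate (CSpace.mk Θ f hf)) (x₀ y₀ : Euc N)
    {G : WTCSpace Θ N (Euc N →L[ℝ] Euc N)} {k : WTCSpace Θ N (Euc N)} {g' : ℝ → Euc N → Euc N}
    {G' : ℝ → Euc N → (Euc N →L[ℝ] Euc N)} {k' : ℝ → Euc N → Euc N}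
    (hg' : CSpace.Represents g' c) (hG' : CSpace.Represents G' G) (hk' : CSpace.Represents k' k) :
    IsMaximalTriangularSolution g' G' k' x₀ y₀ (maximalInterval c.rep x₀)
      (maximalSolution c.rep x₀) (linearSolution G.rep k.rep (maximalSolution c.rep x₀) y₀) := by
  have hs := isSolution_maximalSolution c.rep_prop x₀
  refine (c.isMaximalSolution_of_represents x₀ hg').triangular hG'.isWTC.toIsCaratheodory
    hk'.isWTC.toIsCaratheodory ?_
  refine (isSolution_linearSolution G.isWTC_rep.toIsCaratheodory k.isWTC_rep.toIsCaratheodory y₀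
    hs.ordConnected hs.zero_mem hs.continuousOn).congr_field fun t ht => ?_
  have hsub := hs.ordConnected.uIcc_subset hs.zero_mem ht
  obtain ⟨j, hj⟩ := exists_nat_bound (hs.continuousOn.mono hsub)
  -- Representatives of `G` and `k` are known to agree only along test paths; the solution is one
  -- because `c` lies in the hull of `f`.
  have hK : maximalSolution c.rep x₀ ∈ modulusClass N Θ (min 0 t) (max 0 t) j :=
    hs.mem_modulusClass hΘ hc hsub hj
  filter_upwards [G.represents_rep.ae_eq_along hG' min_le_max hK,
    k.represents_rep.ae_eq_along hk' min_le_max hK] with s h1 h2 hmem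
  rw [linearField, linearField, h1 hmem, h2 hmem]

/-- The translated pair solves the system given by the translated representatives, which represent
the translated classes. The maximal solution of that system therefore extends it. -/
lemma linearSolution_translate (hΘ : Θ = moduliOf f hf hfm) {c : LCSpace Θ N}
    (hc : c ∈ hull CSpace.translate (CSpace.mk Θ f hf)) {x₀ y₀ : Euc N} {s t : ℝ}
    (hct : CSpace.translate s c ∈ hull CSpace.translate (CSpace.mk Θ f hf))
    {G : WTCSpace Θ N (Euc N →L[ℝ] Euc N)} {k : WTCSpace Θ N (Euc N)}
    (hs : s ∈ maximalInterval c.rep x₀) (hts : t + s ∈ maximalInterval c.rep x₀) :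
    linearSolution G.rep k.rep (maximalSolution c.rep x₀) y₀ (t + s) =
      linearSolution (CSpace.translate s G).rep (CSpace.translate s k).rep
        (maximalSolution (CSpace.translate s c).rep (maximalSolution c.rep x₀ s))
        (linearSolution G.rep k.rep (maximalSolution c.rep x₀) y₀ s) t := by
  have h1 := isMaximalTriangularSolution_of_represents hΘ hct (maximalSolution c.rep x₀ s)
    (linearSolution G.rep k.rep (maximalSolution c.rep x₀) y₀ s) (c.represents_rep.translate s)
    (G.represents_rep.translate s) (k.represents_rep.translate s)
  obtain ⟨h2, h3⟩ := isTriangularSolution_iff.1 (isMaximalTriangularSolution_of_represents hΘ hc x₀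
    y₀ c.represents_rep G.represents_rep k.represents_rep).toIsTriangularSolution
  exact (h1.maximal _ _ _ (isTriangularSolution_iff.2 ⟨h2.translate hs, h3.translate hs⟩)).2.2 hts

end LimitSystems

/-! ### The skew-product flows -/

section Main

variable {N : ℕ} {Θ : SuitableModuli} {f : ℝ → Euc N → Euc N} {hf : IsLC f}
  {F : ℝ → Euc N → (Euc N →L[ℝ] Euc N)} {hF : IsWTC Θ F} {h : ℝ → Euc N → Euc N} {hh : IsWTC Θ h}

lemma mem_hull_of_mem_tripleHull {ω : TripleSpace Θ N}
    (hω : ω ∈ hull tripleTranslate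
      ((CSpace.mk Θ f hf, CSpace.mk Θ F hF, CSpace.mk Θ h hh) : TripleSpace Θ N)) :
    ω.1 ∈ hull CSpace.translate (CSpace.mk Θ f hf) ∧
      ω.2.1 ∈ hull CSpace.translate (CSpace.mk Θ F hF) ∧
      ω.2.2 ∈ hull CSpace.translate (CSpace.mk Θ h hh) := by
  refine ⟨map_mem_closure (f := fun ω : TripleSpace Θ N => ω.1) continuous_fst hω ?_,
    map_mem_closure (f := fun ω : TripleSpace Θ N => ω.2.1) continuous_snd.fst hω ?_,
    map_mem_closure (f := fun ω : TripleSpace Θ N => ω.2.2) continuous_snd.snd hω ?_⟩ <;>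
  · rintro _ ⟨t, rfl⟩
    exact ⟨t, rfl⟩

/-- The hull of the triple projects into the three separate hulls, each of which is equibounded, so
continuity holds componentwise. -/
lemma continuousOn_tripleTranslate (hfm : HasEquicontMBounds f) (hFm : HasEquicontMBounds F)
    (hhm : HasEquicontMBounds h) :
    ContinuousOn (fun z : ℝ × TripleSpace Θ N => tripleTranslate z.1 z.2) (univ ×ˢ hull
      tripleTranslate ((CSpace.mk Θ f hf, CSpace.mk Θ F hF, CSpace.mk Θ h hh) : TripleSpace Θ N)) := by
  have h1 := (equiBounded_hull (Θ := Θ) hf hfm).continuousOn_translate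
  have h2 := (equiBounded_hull (Θ := Θ) hF hFm).continuousOn_translate
  have h3 := (equiBounded_hull (Θ := Θ) hh hhm).continuousOn_translate
  refine ContinuousOn.prodMk ?_ (ContinuousOn.prodMk ?_ ?_)
  · exact h1.comp (f := fun z : ℝ × TripleSpace Θ N => (z.1, z.2.1)) (by fun_prop)
      fun z hz => ⟨mem_univ _, (mem_hull_of_mem_tripleHull hz.2).1⟩
  · exact h2.comp (f := fun z : ℝ × TripleSpace Θ N => (z.1, z.2.2.1)) (by fun_prop)
      fun z hz => ⟨mem_univ _, (mem_hull_of_mem_tripleHull hz.2).2.1⟩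
  · exact h3.comp (f := fun z : ℝ × TripleSpace Θ N => (z.1, z.2.2.2)) (by fun_prop)
      fun z hz => ⟨mem_univ _, (mem_hull_of_mem_tripleHull hz.2).2.2⟩

end Main

theorem mainTheorem1 (N : ℕ)
    (f : ℝ → Euc N → Euc N) (hf : IsLC f) (hfm : HasEquicontMBounds f)
    (Θ : SuitableModuli) (hΘ : Θ = moduliOf f hf hfm)
    (F : ℝ → Euc N → (Euc N →L[ℝ] Euc N)) (hF : IsWTC Θ F) (hFm : HasEquicontMBounds F)
    (h : ℝ → Euc N → Euc N) (hh : IsWTC Θ h) (hhm : HasEquicontMBounds h) :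
    -- `I g x₀` is the maximal interval and `X g x₀ = x(·, g, x₀)` the solution
    ∃ (I : LCSpace Θ N → Euc N → Set ℝ) (X : LCSpace Θ N → Euc N → ℝ → Euc N),
      (∀ (g : LCSpace Θ N) (x₀ : Euc N) (g' : ℝ → Euc N → Euc N), CSpace.Represents g' g →
        IsMaximalSolution g' x₀ (I g x₀) (X g x₀)) ∧
      -- the flow on the hull of `f`
      (∃ φ : Flow ℝ (hull CSpace.translate (CSpace.mk Θ f hf)),
        (∀ t g, (φ t g : LCSpace Θ N) = CSpace.translate t (g : LCSpace Θ N)) ∧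
        IsContinuousLocalSkewProductFlow (Y := Euc N) φ
          {p | p.1 ∈ I p.2.1 p.2.2}
          (fun p => (φ p.1 p.2.1, X p.2.1 p.2.2 p.1))) ∧
      -- the flow on the hull of the triple, with `Y ω x₀ y₀ = y(·, g, G, k, x₀, y₀)` for `ω = (g, G, k)` in the hull
      (∃ Y : hull tripleTranslate
            ((CSpace.mk Θ f hf, CSpace.mk Θ F hF, CSpace.mk Θ h hh) : TripleSpace Θ N) →
          Euc N → Euc N → ℝ → Euc N,
        (∀ ω x₀ y₀ g' G' k', CSpace.Represents g' ω.1.1 → CSpace.Represents G' ω.1.2.1 →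
          CSpace.Represents k' ω.1.2.2 →
          IsMaximalTriangularSolution g' G' k' x₀ y₀ (I ω.1.1 x₀) (X ω.1.1 x₀) (Y ω x₀ y₀)) ∧
        ∃ ψ : Flow ℝ (hull tripleTranslate
            ((CSpace.mk Θ f hf, CSpace.mk Θ F hF, CSpace.mk Θ h hh) : TripleSpace Θ N)),
          (∀ t ω, (ψ t ω : TripleSpace Θ N) = tripleTranslate t (ω : TripleSpace Θ N)) ∧
          IsContinuousLocalSkewProductFlow (Y := Euc N × Euc N) ψ
            {p | p.1 ∈ I p.2.1.1.1 p.2.2.1}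
            (fun p => (ψ p.1 p.2.1, X p.2.1.1.1 p.2.2.1 p.1, Y p.2.1 p.2.2.1 p.2.2.2 p.1))) := by
  have hcf := (equiBounded_hull (Θ := Θ) hf hfm).continuousOn_translate
  have hct := continuousOn_tripleTranslate (hf := hf) (hF := hF) (hh := hh) hfm hFm hhm
  have htadd : ∀ s t (ω : TripleSpace Θ N),
      tripleTranslate (s + t) ω = tripleTranslate s (tripleTranslate t ω) := fun s t ω => by
    simp only [tripleTranslate, CSpace.translate_add]
  have htzero : ∀ ω : TripleSpace Θ N, tripleTranslate 0 ω = ω := fun ω => by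
    simp only [tripleTranslate, CSpace.translate_zero]
  have hsol := fun (c : LCSpace Θ N) (x₀ : Euc N) => isMaximalSolution_maximalSolution c.rep_prop x₀
  have hsubtype : ∀ {Ω : Type} [TopologicalSpace Ω] {S : Set Ω} (ω : S),
      Tendsto (Subtype.val : S → Ω) (𝓝 ω) (𝓝[S] (ω : Ω)) := fun ω =>
    tendsto_nhdsWithin_iff.2 ⟨continuous_subtype_val.tendsto _, Eventually.of_forall Subtype.prop⟩
  refine ⟨fun c x₀ => maximalInterval c.rep x₀, fun c x₀ => maximalSolution c.rep x₀,
    fun c x₀ g' hg' => c.isMaximalSolution_of_represents x₀ hg',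
    ⟨hullFlow CSpace.translate_zero CSpace.translate_add hcf, fun _ _ => rfl, ?_⟩,
    ⟨fun ω x₀ y₀ => linearSolution ω.1.2.1.rep ω.1.2.2.rep (maximalSolution ω.1.1.rep x₀) y₀,
      fun ω x₀ y₀ g' G' k' hg' hG' hk' => isMaximalTriangularSolution_of_represents hΘ
        (mem_hull_of_mem_tripleHull ω.2).1 x₀ y₀ hg' hG' hk',
      hullFlow htzero htadd hct, fun _ _ => rfl, ?_⟩⟩
  -- Taken along the filter `𝓝 p`, joint dependence yields at once that the domain is a
  -- neighbourhood of `p` and that the solution is continuous at `p`.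
  · have hjoint : ∀ p : ℝ × hull CSpace.translate (CSpace.mk Θ f hf) × Euc N,
        p.1 ∈ maximalInterval (p.2.1 : LCSpace Θ N).rep p.2.2 → _ := fun p hp =>
      tendsto_maximalSolution (l := 𝓝 p) hΘ p.2.1.2 hp
        ((hsubtype p.2.1).comp (continuous_snd.fst.tendsto p)) (continuous_snd.snd.tendsto p)
        (continuous_fst.tendsto p)
    exact
      { isOpen := isOpen_iff_mem_nhds.2 fun p hp => (hjoint p hp).1
        zero_mem := fun z => (hsol _ _).zero_mem
        ordConnected := fun z => (hsol (z.1 : LCSpace Θ N) z.2).ordConnected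
        map_zero := fun z => Prod.ext
          (Subtype.ext (CSpace.translate_zero (z.1 : LCSpace Θ N))) (hsol _ _).toIsSolution.apply_zero
        mem_iff := fun s t z hs => by
          have := (CSpace.maximal_translate z.1.1 hs).1
          exact Set.ext_iff.1 this t
        map_add := fun s t z hs hts => Prod.ext
          (Subtype.ext (CSpace.translate_add t s (z.1 : LCSpace Θ N))) (by
          obtain ⟨h1, h2⟩ := CSpace.maximal_translate z.1.1 hs
          exact (h2 (by rw [h1]; exact hts)).symm)
        skew := fun t b y _ => rfl
        continuousOn := fun p hp => by
          refine ContinuousAt.continuousWithinAt ?_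
          exact ((Flow.cont' _).comp
            (continuous_fst.prodMk continuous_snd.fst)).continuousAt.prodMk (hjoint p hp).2 }
  · have hmem := fun ω : hull tripleTranslate
        ((CSpace.mk Θ f hf, CSpace.mk Θ F hF, CSpace.mk Θ h hh) : TripleSpace Θ N) =>
      mem_hull_of_mem_tripleHull ω.2
    have hlin := fun (ω : hull tripleTranslate
        ((CSpace.mk Θ f hf, CSpace.mk Θ F hF, CSpace.mk Θ h hh) : TripleSpace Θ N)) x₀ y₀ =>
      (isTriangularSolution_iff.1 (isMaximalTriangularSolution_of_represents hΘ (hmem ω).1 x₀ y₀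
        ω.1.1.represents_rep ω.1.2.1.represents_rep ω.1.2.2.represents_rep).toIsTriangularSolution).2
    -- Convergence in the triple hull is needed as convergence within the hull of `f`, where the
    -- mass bounds are available.
    have htendsto : ∀ p : ℝ × hull tripleTranslate
        ((CSpace.mk Θ f hf, CSpace.mk Θ F hF, CSpace.mk Θ h hh) : TripleSpace Θ N) ×
          Euc N × Euc N,
        Tendsto (fun q : ℝ × hull tripleTranslate
          ((CSpace.mk Θ f hf, CSpace.mk Θ F hF, CSpace.mk Θ h hh) : TripleSpace Θ N) ×
            Euc N × Euc N => q.2.1.1.1) (𝓝 p)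
          (𝓝[hull CSpace.translate (CSpace.mk Θ f hf)] p.2.1.1.1) := fun p =>
      tendsto_nhdsWithin_iff.2 ⟨Continuous.tendsto (by fun_prop) p,
        Eventually.of_forall fun q => (hmem q.2.1).1⟩
    have hjoint : ∀ p : ℝ × hull tripleTranslate
        ((CSpace.mk Θ f hf, CSpace.mk Θ F hF, CSpace.mk Θ h hh) : TripleSpace Θ N) ×
          Euc N × Euc N,
        p.1 ∈ maximalInterval p.2.1.1.1.rep p.2.2.1 → _ := fun p hp =>
      tendsto_maximalSolution (l := 𝓝 p) hΘ (hmem p.2.1).1 hp (htendsto p)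
        (continuous_snd.snd.fst.tendsto p) (continuous_fst.tendsto p)
    exact
      { isOpen := isOpen_iff_mem_nhds.2 fun p hp => (hjoint p hp).1
        zero_mem := fun z => (hsol _ _).zero_mem
        ordConnected := fun z => (hsol z.1.1.1 z.2.1).ordConnected
        map_zero := fun z => Prod.ext (Subtype.ext (htzero z.1)) (Prod.ext
          (hsol _ _).toIsSolution.apply_zero (hlin z.1 z.2.1 z.2.2).apply_zero)
        mem_iff := fun s t z hs => by
          have := (CSpace.maximal_translate z.1.1.1 hs).1
          exact Set.ext_iff.1 this t
        map_add := fun s t z hs hts => Prod.ext (Subtype.ext (htadd t s z.1)) (Prod.ext (by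
          obtain ⟨h1, h2⟩ := CSpace.maximal_translate z.1.1.1 hs
          exact (h2 (by rw [h1]; exact hts)).symm)
          (linearSolution_translate hΘ (hmem z.1).1
            (mem_hull_of_mem_tripleHull (map_mem_hull htadd hct s z.1.2)).1 hs hts))
        skew := fun t b y _ => rfl
        continuousOn := fun p hp => by
          refine ContinuousAt.continuousWithinAt ?_
          refine ((Flow.cont' _).comp
            (continuous_fst.prodMk continuous_snd.fst)).continuousAt.prodMk
            ((hjoint p hp).2.prodMk_nhds ?_)
          exact tendsto_linearSolution hΘ (hmem p.2.1).1 hp (htendsto p)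
            (continuous_snd.snd.fst.tendsto p) (continuous_fst.tendsto p)
            (equiBounded_hull hF hFm) (equiBounded_hull hh hhm) (hmem p.2.1).2.1 (hmem p.2.1).2.2
            (tendsto_nhdsWithin_iff.2 ⟨Continuous.tendsto (by fun_prop) p,
              Eventually.of_forall fun q => (hmem q.2.1).2.1⟩)
            (tendsto_nhdsWithin_iff.2 ⟨Continuous.tendsto (by fun_prop) p,
              Eventually.of_forall fun q => (hmem q.2.1).2.2⟩)
            (continuous_snd.snd.snd.tendsto p) }
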